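/- **Setting.** Let $X$ be a random variable with values in a measurable space $\mathcal X$, let $g:\mathcal X\times\mathbb R^d\to\mathbb R$ be a measurable loss such that $g(X,h)$ is integrable for every $h\in\mathbb R^d$, and suppose that $G(h):=\mathbb E[g(X,h)]$ is convex on $\mathbb R^d$. Let $X_1,X_2,\dots$ be i.i.d. copies of $X$ and $(\mathcal F_n)_{n\ge 0}$ a filtration. The iterates of the stochastic Newton algorithm satisfy, for a constant $c_\theta\ge 0$ and all $n\ge 0$, $$\theta_{n+1}=\theta_n-\frac{1}{n+1+c_\theta}\,\overline H_n^{-1}\nabla_h g(X_{n+1},\theta_n),$$ where $\overline H_n$ is a random symmetric positive definite $d\times d$ matrix, $\theta_n$ and $\overline H_n$ are $\mathcal F_n$-measurable, and $X_{n+1}$ is independent of $\mathcal F_n$. **Assumptions.** Let $\theta\in\mathbb R^d$. * (A1) For almost every $x$ (with respect to the law of $X$) the function $g(x,\cdot)$ is differentiable, and: (a) $\nabla G(\theta)=0$; (b) there are $C,C'\ge 0$ with $\mathbb E[\|\nabla_h g(X,h)\|^2]\le C+C'(G(h)-G(\theta))$ for all $h\in\mathbb R^d$; (c) the map $\Sigma:h\mapsto\mathbb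 E[\nabla_h g(X,h)\nabla_h g(X,h)^T]$ is continuous at $\theta$. * (A2) $G$ is twice continuously differentiable, and: (a) there is $L>0$ with $\|\nabla^2G(h)\|_{op}\le L$ for all $h\in\mathbb R^d$; (b) $H:=\nabla^2G(\theta)$ is positive definite. * (H1) There is $\beta\in(0,1/2)$ such that, almost surely, $\lambda_{\max}(\overline H_n)=O(1)$ and $\lambda_{\max}(\overline H_n^{-1})=O(n^\beta)$. * (H2a) $\overline H_n\to H$ almost surely. **Theorem.** Under (A1), (A2), (H1) and (H2a), for every $\delta>0$, $$\|\theta_n-\theta\|^2=o\!\left(\frac{(\ln n)^{1+\delta}}{n}\right)\quad\text{almost surely as } n\to\infty .$$ If moreover there are constants $\eta>0$ and $C_\eta>0$ such that $\mathbb E[\|\nabla_h g(X,h)\|^{2+2\eta}]\le C_\eta\,(1+\|h-\theta\|^{2+2\eta})$ for all $h\in\mathbb R^d$, then $$\|\theta_n-\theta\|^2=O\!\left(\frac{\ln n}{n}\right)\quad\text{almost surely as } n\to\infty .$$ -/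

import Mathlib

open MeasureTheory ProbabilityTheory Filter Topology Asymptotics
open scoped ENNReal Gradient

noncomputable section

namespace StochNewton

/-- The Euclidean space of dimension `d`, with its Euclidean norm. -/
abbrev Vec (d : ℕ) : Type := EuclideanSpace ℝ (Fin d)

variable {𝓧 : Type*} [MeasurableSpace 𝓧] {d : ℕ}

/-- The risk `G(h) = 𝔼[g(X, h)]`, where `ν` is the law of `X`. -/
def risk (ν : Measure 𝓧) (g : 𝓧 → Vec d → ℝ) (h : Vec d) : ℝ :=
  ∫ x, g x h ∂ν

/-- `Σ(h) = 𝔼[∇ₕg(X, h) ∇ₕg(X, h)ᵀ]`, where `ν` is the law of `X`. -/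
def gradCov (ν : Measure 𝓧) (g : 𝓧 → Vec d → ℝ) (h : Vec d) : Matrix (Fin d) (Fin d) ℝ :=
  Matrix.of fun i j => ∫ x, (∇ (g x) h) i * (∇ (g x) h) j ∂ν

/-- The Hessian matrix `∇²G(h)`: its `j`-th column is the derivative of `∇G` at `h` in the
direction of the `j`-th vector of the canonical basis. -/
def hessian (G : Vec d → ℝ) (h : Vec d) : Matrix (Fin d) (Fin d) ℝ :=
  Matrix.of fun i j => (fderiv ℝ (∇ G) h (EuclideanSpace.single j 1)) i

/-- The operator norm of a matrix with respect to the Euclidean norm (its largest singular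
value). -/
def opNorm (A : Matrix (Fin d) (Fin d) ℝ) : ℝ :=
  ‖Matrix.toEuclideanCLM (n := Fin d) (𝕜 := ℝ) A‖

/-- The largest (real) eigenvalue of a matrix; it is only used for symmetric matrices. -/
def lambdaMax (A : Matrix (Fin d) (Fin d) ℝ) : ℝ :=
  sSup (spectrum ℝ A)

/-- The standing framework: `g` is measurable, `G(h) = 𝔼[g(X, h)]` is well defined (and finite)
for every `h`, and `G` is convex. -/
structure Framework (ν : Measure 𝓧) (g : 𝓧 → Vec d → ℝ) : Prop where
  measurable_loss : Measurable (Function.uncurry g)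
  integrable_loss : ∀ h, Integrable (fun x => g x h) ν
  convex_risk : ConvexOn ℝ Set.univ (risk ν g)

/-- First order assumptions (at the point `θ`). The expectation of the nonnegative variable
`‖∇ₕg(X, h)‖²` is a Lebesgue integral with values in `[0, ∞]`, so the bound includes finiteness. -/
structure FirstOrder (ν : Measure 𝓧) (g : 𝓧 → Vec d → ℝ) (θ : Vec d) : Prop where
  differentiable_loss : ∀ᵐ x ∂ν, Differentiable ℝ (g x)
  gradient_eq_zero : ∇ (risk ν g) θ = 0
  second_moment : ∃ C C' : ℝ, 0 ≤ C ∧ 0 ≤ C' ∧ ∀ h,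
    ∫⁻ x, ‖∇ (g x) h‖ₑ ^ 2 ∂ν ≤ ENNReal.ofReal (C + C' * (risk ν g h - risk ν g θ))
  continuousAt_cov : ContinuousAt (gradCov ν g) θ

/-- Second order assumptions (at the point `θ`). -/
structure SecondOrder (G : Vec d → ℝ) (θ : Vec d) : Prop where
  contDiff : ContDiff ℝ 2 G
  hessian_bounded : ∃ L : ℝ, 0 < L ∧ ∀ h, opNorm (hessian G h) ≤ L
  hessian_pos : (hessian G θ).PosDef

/-- The moment condition of order `2 + 2η`, for some `η > 0`. -/
def MomentCondition (ν : Measure 𝓧) (g : 𝓧 → Vec d → ℝ) (θ : Vec d) : Prop :=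
  ∃ η C : ℝ, 0 < η ∧ 0 < C ∧ ∀ h,
    ∫⁻ x, ‖∇ (g x) h‖ₑ ^ (2 + 2 * η) ∂ν ≤ ENNReal.ofReal (C * (1 + ‖h - θ‖ ^ (2 + 2 * η)))

variable {Ω : Type*} [mΩ : MeasurableSpace Ω]

/-- `X 1, X 2, …` are i.i.d. random variables with law `ν` (the value `X 0` plays no role). -/
structure IsSample (P : Measure Ω) (ν : Measure 𝓧) (X : ℕ → Ω → 𝓧) : Prop where
  measurable : ∀ n, Measurable (X (n + 1))
  law : ∀ n, P.map (X (n + 1)) = ν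
  indep : iIndepFun (fun n => X (n + 1)) P

/-- `θs` are the iterates of the stochastic Newton algorithm
`θₙ₊₁ = θₙ - (n + 1 + c)⁻¹ H̄ₙ⁻¹ ∇ₕg(Xₙ₊₁, θₙ)`, with a symmetric positive definite estimate `H̄ₙ`
of the Hessian at each iteration. Here `H̄ₙ` and `θₙ` are `ℱₙ`-measurable and `Xₙ₊₁` is
independent of `ℱₙ`. -/
structure IsStochasticNewton (P : Measure Ω) (ℱ : Filtration ℕ mΩ) (g : 𝓧 → Vec d → ℝ) (c : ℝ)
    (X : ℕ → Ω → 𝓧) (Hbar : ℕ → Ω → Matrix (Fin d) (Fin d) ℝ) (θs : ℕ → Ω → Vec d) : Prop where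
  posDef : ∀ n ω, (Hbar n ω).PosDef
  measurable_hessian : ∀ n i j, Measurable[ℱ n] (fun ω => Hbar n ω i j)
  measurable_iterate : ∀ n, Measurable[ℱ n] (θs n)
  indep : ∀ n, Indep (MeasurableSpace.comap (X (n + 1)) inferInstance) (ℱ n) P
  step : ∀ n ω, θs (n + 1) ω = θs n ω - (1 / ((n : ℝ) + 1 + c)) •
    Matrix.toEuclideanCLM (n := Fin d) (𝕜 := ℝ) ((Hbar n ω)⁻¹) (∇ (g (X (n + 1) ω)) (θs n ω))

/-- Control of the largest eigenvalues of `H̄ₙ` and `H̄ₙ⁻¹`. -/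
def EigenvalueControl (P : Measure Ω) (Hbar : ℕ → Ω → Matrix (Fin d) (Fin d) ℝ) : Prop :=
  ∃ β : ℝ, 0 < β ∧ β < 1 / 2 ∧
    (∀ᵐ ω ∂P, (fun n => lambdaMax (Hbar n ω)) =O[atTop] fun _ : ℕ => (1 : ℝ)) ∧
    (∀ᵐ ω ∂P, (fun n => lambdaMax ((Hbar n ω)⁻¹)) =O[atTop] fun n : ℕ => (n : ℝ) ^ β)

/-- Strong consistency of the Hessian estimates: `H̄ₙ → H` almost surely. -/
def HessianConsistent (P : Measure Ω) (Hbar : ℕ → Ω → Matrix (Fin d) (Fin d) ℝ)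
    (H : Matrix (Fin d) (Fin d) ℝ) : Prop :=
  ∀ᵐ ω ∂P, Tendsto (fun n => Hbar n ω) atTop (𝓝 H)

end StochNewton

end

/-!
The rates of convergence of a stochastic Newton algorithm `θₙ₊₁ = θₙ - aₙ Kₙ Φₙ₊₁`, with step
`aₙ = 1 / (n + 1 + c)`, preconditioner `Kₙ = H̄ₙ⁻¹` and stochastic gradient `Φₙ₊₁`, rest on two
facts: the stochastic gradient is unbiased, and `Kₙ` converges to the inverse of the Hessian at `θ`.
Hence the preconditioned mean step `Kₙ ∇G(θₙ)` is asymptotically the exact Newton step `θₙ - θ`.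

*Unbiasedness.* The gradient of the loss is not dominated, but its second moment is locally bounded.
Difference quotients are averages of the gradient along segments, hence bounded in `L²`, and this is
enough to exchange gradient and expectation (`integral_deriv_eq_of_sq_bound`,
`integral_gradient_eq`).

*Conditioning.* Neither the iterates nor the preconditioners are integrable. No conditional
expectation is used: since the next observation is independent of the past, it is integrated out by
Tonelli's theorem, for nonnegative functions, on events of the past (`setLIntegral_comp_eq_of_indep`).
The Robbins–Siegmund theorem is proved in a localized form adapted to this (`robbinsSiegmund`).

*Consistency.* The excess risk satisfies a Robbins–Siegmund inequality, so it converges and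
`∑ aₙ ‖∇G(θₙ)‖²` is finite. As `∑ aₙ` diverges, the gradient is small infinitely often. By convexity
and the positivity of the Hessian at `θ`, a small gradient forces `θₙ` to be close to `θ`
(`exists_gradient_lower_bound`), so the limit of the excess risk is zero, and then `θₙ → θ`
(`ae_tendsto_iterate`).

*The first rate.* Near `θ` the squared distance contracts by a factor close to `1 - 2 / n`, with a
noise of order `1 / n²`. Thus `n ‖θₙ - θ‖² / (log n) ^ (1 + δ)` again satisfies a Robbins–Siegmund
inequality, with perturbations `1 / (n (log n) ^ (1 + δ))` that are summable, and its limit has to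
vanish (`ae_isLittleO_log_rpow_div`).

*The second rate.* Multiplying the recursion by `n + 1 + c` and summing it expresses
`(n + c) (θₙ - θ)` as a sum of residuals, which are `o(‖θₖ - θ‖)`, and of martingale increments
(`smul_sub_eq_sum`). The increments are truncated at the level `√(k / log k)`: the truncation is
eventually inactive because moments of order `2 + 2η` exist (`ae_eventually_norm_increment_le`), and
the truncated sum is `O(√(n log n))` by an exponential moment bound and Borel–Cantelli
(`ae_truncSum_le`). A Grönwall argument absorbs the residuals (`exists_le_mul_logScale`).
-/

noncomputable section

namespace StochNewton

/-! ### Convex functions with a Lipschitz gradient -/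

section Analysis
open scoped RealInnerProductSpace

variable {E : Type*} [NormedAddCommGroup E] [InnerProductSpace ℝ E] [CompleteSpace E]
  {G : E → ℝ} {L : ℝ}

theorem subgradient_ineq (hG : ConvexOn ℝ Set.univ G) (hd : Differentiable ℝ G) (x y : E) :
    G x + ⟪∇ G x, y - x⟫ ≤ G y := by
  have hline : ConvexOn ℝ Set.univ (G ∘ AffineMap.lineMap (k := ℝ) x y) :=
    hG.comp_affineMap (AffineMap.lineMap x y)
  have hderiv : HasDerivAt (G ∘ AffineMap.lineMap (k := ℝ) x y) ⟪∇ G x, y - x⟫ 0 := by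
    rw [inner_gradient_left]
    have h1 : HasDerivAt (AffineMap.lineMap (k := ℝ) x y) (y - x) (0 : ℝ) :=
      AffineMap.hasDerivAt_lineMap
    have h2 : HasFDerivAt G (fderiv ℝ G x) (AffineMap.lineMap (k := ℝ) x y (0 : ℝ)) := by
      simpa using (hd x).hasFDerivAt
    exact h2.comp_hasDerivAt 0 h1
  have := hline.le_slope_of_hasDerivAt (Set.mem_univ 0) (Set.mem_univ 1) one_pos hderiv
  simp only [slope_def_field, Function.comp_apply, AffineMap.lineMap_apply_one,
    AffineMap.lineMap_apply_zero, sub_zero, div_one] at this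
  linarith

theorem descent_ineq (hd : Differentiable ℝ G) (hL0 : 0 ≤ L)
    (hL : ∀ x y, ‖∇ G x - ∇ G y‖ ≤ L * ‖x - y‖) (x y : E) :
    G y ≤ G x + ⟪∇ G x, y - x⟫ + L * ‖y - x‖ ^ 2 := by
  have key : ‖G y - G x - fderiv ℝ G x (y - x)‖ ≤ L * ‖y - x‖ * ‖y - x‖ := by
    refine (convex_closedBall x ‖y - x‖).norm_image_sub_le_of_norm_fderiv_le'
      (fun z _ => hd z) (fun z hz => ?_) (by simp) (by simp [dist_eq_norm])
    rw [← toDual_gradient, ← toDual_gradient, ← map_sub, LinearIsometryEquiv.norm_map]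
    refine (hL z x).trans (mul_le_mul_of_nonneg_left ?_ hL0)
    simpa [dist_eq_norm] using hz
  have := (abs_le.1 key).2
  rw [inner_gradient_left]
  nlinarith

theorem isMinimum_of_gradient_eq_zero (hG : ConvexOn ℝ Set.univ G) (hd : Differentiable ℝ G)
    {θ : E} (hθ : ∇ G θ = 0) (x : E) : G θ ≤ G x := by
  simpa [hθ] using subgradient_ineq hG hd θ x

/-- For a convex function with Lipschitz gradient, the gradient is small where the excess risk
is small: a gradient step cannot go below the minimum. -/
theorem sq_norm_gradient_le (hG : ConvexOn ℝ Set.univ G) (hd : Differentiable ℝ G) (hL0 : 0 < L)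
    (hL : ∀ x y, ‖∇ G x - ∇ G y‖ ≤ L * ‖x - y‖) {θ : E} (hθ : ∇ G θ = 0) (x : E) :
    ‖∇ G x‖ ^ 2 ≤ 4 * L * (G x - G θ) := by
  have h1 := isMinimum_of_gradient_eq_zero hG hd hθ (x - (1 / (2 * L)) • ∇ G x)
  have h2 := descent_ineq hd hL0.le hL x (x - (1 / (2 * L)) • ∇ G x)
  have h3 : x - (1 / (2 * L)) • ∇ G x - x = -((1 / (2 * L)) • ∇ G x) := by abel
  rw [h3, inner_neg_right, inner_smul_right, real_inner_self_eq_norm_sq, norm_neg, norm_smul,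
    mul_pow, Real.norm_eq_abs, sq_abs] at h2
  have h4 : -(1 / (2 * L) * ‖∇ G x‖ ^ 2) + L * ((1 / (2 * L)) ^ 2 * ‖∇ G x‖ ^ 2)
      = - (‖∇ G x‖ ^ 2 / (4 * L)) := by field_simp; ring
  have h5 : ‖∇ G x‖ ^ 2 / (4 * L) ≤ G x - G θ := by linarith
  rw [div_le_iff₀ (by positivity)] at h5
  linarith

/-- A convex function whose gradient vanishes at `θ` and whose second derivative at `θ` is positive
definite has a gradient bounded below, linearly near `θ` and by a constant away from it. The bound
near `θ` is a Taylor expansion; it propagates along rays because the gradient is monotone. -/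
theorem exists_gradient_lower_bound (hG : ConvexOn ℝ Set.univ G) (hd : Differentiable ℝ G)
    {θ : E} (hθ : ∇ G θ = 0) {D : E →L[ℝ] E} (hD : HasFDerivAt (∇ G) D θ) {κ : ℝ} (hκ : 0 < κ)
    (hpos : ∀ v, 2 * κ * ‖v‖ ^ 2 ≤ ⟪v, D v⟫) :
    ∃ ρ : ℝ, 0 < ρ ∧ ∀ h, κ * min ‖h - θ‖ ρ ≤ ‖∇ G h‖ := by
  have hev := hD.isLittleO.def hκ
  obtain ⟨ρ, hρ, hball⟩ := Metric.eventually_nhds_iff.1 hev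
  have hloc : ∀ z, ‖z - θ‖ < ρ → κ * ‖z - θ‖ ^ 2 ≤ ⟪z - θ, ∇ G z⟫ := by
    intro z hz
    have h1 := hball (y := z) (by simpa [dist_eq_norm] using hz)
    rw [hθ, sub_zero] at h1
    have h2 : ⟪z - θ, ∇ G z⟫ = ⟪z - θ, D (z - θ)⟫ + ⟪z - θ, ∇ G z - D (z - θ)⟫ := by
      rw [← inner_add_right]; congr 1; abel
    have h3 := (abs_le.1 ((abs_real_inner_le_norm (z - θ) (∇ G z - D (z - θ))).trans
      (mul_le_mul_of_nonneg_left h1 (norm_nonneg _)))).1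
    have h4 := hpos (z - θ)
    rw [h2]; nlinarith
  refine ⟨ρ / 2, by positivity, fun h => ?_⟩
  rcases lt_or_ge ‖h - θ‖ (ρ / 2) with hlt | hge
  · rw [min_eq_left hlt.le]
    rcases (norm_nonneg (h - θ)).eq_or_lt with h0 | h0
    · rw [← h0]; simp
    · have h1 := (hloc h (by linarith)).trans (real_inner_le_norm _ _)
      refine le_of_mul_le_mul_left ?_ h0
      nlinarith
  · rw [min_eq_right hge]
    have hn : 0 < ‖h - θ‖ := by linarith
    set t : ℝ := ρ / 2 / ‖h - θ‖ with ht
    have ht0 : 0 < t := by positivity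
    have htn : t * ‖h - θ‖ = ρ / 2 := by rw [ht]; field_simp
    have ht1 : t ≤ 1 := by rw [ht, div_le_one hn]; exact hge
    set z := θ + t • (h - θ) with hz
    have hzθ : z - θ = t • (h - θ) := by rw [hz]; abel
    have hhz : h - z = (1 - t) • (h - θ) := by rw [hz, sub_smul, one_smul]; abel
    have hnz : ‖z - θ‖ = ρ / 2 := by rw [hzθ, norm_smul, Real.norm_of_nonneg ht0.le, htn]
    have hl := hloc z (by linarith)
    have hm1 := subgradient_ineq hG hd h z
    have hm2 := subgradient_ineq hG hd z h
    have hzh : z - h = -((1 - t) • (h - θ)) := by rw [← hhz]; abel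
    rw [hhz, inner_smul_right] at hm2
    rw [hzh, inner_neg_right, inner_smul_right] at hm1
    rw [hnz, hzθ, inner_smul_left, real_inner_comm] at hl
    simp only [conj_trivial] at hl
    have hcmp : ⟪∇ G z, h - θ⟫ ≤ ⟪∇ G h, h - θ⟫ := by
      rcases ht1.eq_or_lt with h1 | h1
      · have : z = h := by rw [hz, h1, one_smul]; abel
        rw [this]
      · have h1' : 0 < 1 - t := by linarith
        refine le_of_mul_le_mul_left ?_ h1'
        linarith
    have hcs := real_inner_le_norm (∇ G h) (h - θ)
    have h6 : κ * (ρ / 2) ^ 2 ≤ t * (‖∇ G h‖ * ‖h - θ‖) :=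
      hl.trans (mul_le_mul_of_nonneg_left (hcmp.trans hcs) ht0.le)
    have h7 : t * (‖∇ G h‖ * ‖h - θ‖) = (ρ / 2) * ‖∇ G h‖ := by rw [← htn]; ring
    rw [h7] at h6
    refine le_of_mul_le_mul_left ?_ (half_pos hρ)
    nlinarith

end Analysis

section Hessian
open scoped RealInnerProductSpace
variable {d : ℕ} {G : Vec d → ℝ}

theorem toEuclideanCLM_hessian (h : Vec d) :
    Matrix.toEuclideanCLM (n := Fin d) (𝕜 := ℝ) (hessian G h) = fderiv ℝ (∇ G) h := by
  apply ContinuousLinearMap.coe_injective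
  refine (EuclideanSpace.basisFun (Fin d) ℝ).toBasis.ext fun j => ?_
  ext i
  simp [hessian, Matrix.ofLp_toEuclideanCLM]

theorem differentiable_gradient (hG : ContDiff ℝ 2 G) : Differentiable ℝ (∇ G) := by
  have h1 : Differentiable ℝ (fderiv ℝ G) :=
    (hG.fderiv_right (m := 1) (by norm_num)).differentiable (by norm_num)
  exact (InnerProductSpace.toDual ℝ (Vec d)).symm.differentiable.comp h1

theorem norm_gradient_sub_le (hG : ContDiff ℝ 2 G) {L : ℝ} (hL : ∀ h, opNorm (hessian G h) ≤ L)
    (x y : Vec d) : ‖∇ G x - ∇ G y‖ ≤ L * ‖x - y‖ := by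
  refine convex_univ.norm_image_sub_le_of_norm_fderiv_le (𝕜 := ℝ)
    (fun z _ => differentiable_gradient hG z) (fun z _ => ?_) (Set.mem_univ y) (Set.mem_univ x)
  rw [← toEuclideanCLM_hessian]
  exact hL z

/-- A positive definite matrix is coercive, by compactness of the unit sphere. -/
theorem exists_coercive_of_posDef {A : Matrix (Fin d) (Fin d) ℝ} (hA : A.PosDef) :
    ∃ κ : ℝ, 0 < κ ∧ ∀ v : Vec d,
      2 * κ * ‖v‖ ^ 2 ≤ ⟪v, Matrix.toEuclideanCLM (n := Fin d) (𝕜 := ℝ) A v⟫ := by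
  set T := Matrix.toEuclideanCLM (n := Fin d) (𝕜 := ℝ) A
  have hpos : ∀ v : Vec d, v ≠ 0 → 0 < ⟪v, T v⟫ := by
    intro v hv
    have hv' : v.ofLp ≠ 0 := by simpa using hv
    have := hA.dotProduct_mulVec_pos hv'
    rw [EuclideanSpace.inner_eq_star_dotProduct, Matrix.ofLp_toEuclideanCLM, dotProduct_comm]
    simpa using this
  rcases (Metric.sphere (0 : Vec d) 1).eq_empty_or_nonempty with he | hne
  · refine ⟨1, one_pos, fun v => ?_⟩
    have hv : v = 0 := by
      by_contra hv
      have : (‖v‖⁻¹ • v) ∈ Metric.sphere (0 : Vec d) 1 := by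
        simp [norm_smul, inv_mul_cancel₀ (norm_ne_zero_iff.2 hv)]
      rw [he] at this; exact this
    simp [hv]
  · obtain ⟨w, hw, hmin⟩ := (isCompact_sphere (0 : Vec d) 1).exists_isMinOn hne
      (f := fun v => ⟪v, T v⟫) (by fun_prop)
    have hw1 : ‖w‖ = 1 := by simpa using hw
    have hw0 : w ≠ 0 := by rintro rfl; simp at hw1
    refine ⟨⟪w, T w⟫ / 2, half_pos (hpos w hw0), fun v => ?_⟩
    rcases eq_or_ne v 0 with rfl | hv
    · simp
    have hn : ‖v‖ ≠ 0 := norm_ne_zero_iff.2 hv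
    have h1 : ⟪w, T w⟫ ≤ ⟪‖v‖⁻¹ • v, T (‖v‖⁻¹ • v)⟫ :=
      hmin (a := ‖v‖⁻¹ • v) (by simp [norm_smul, inv_mul_cancel₀ hn])
    rw [map_smul, inner_smul_left, inner_smul_right] at h1
    simp only [conj_trivial] at h1
    calc 2 * (⟪w, T w⟫ / 2) * ‖v‖ ^ 2 = ⟪w, T w⟫ * ‖v‖ ^ 2 := by ring
      _ ≤ (‖v‖⁻¹ * (‖v‖⁻¹ * ⟪v, T v⟫)) * ‖v‖ ^ 2 := by gcongr
      _ = ⟪v, T v⟫ := by field_simp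

end Hessian

/-! ### Exchanging gradient and expectation -/

section Interchange
open scoped RealInnerProductSpace

variable {𝓧 : Type*} [MeasurableSpace 𝓧] {ν : Measure 𝓧}

/-- Convergence of the integrals of an almost everywhere convergent sequence that is bounded in
`L²`, over a finite measure. The tail beyond the level `M` costs at most a constant over `M`. -/
theorem tendsto_integral_of_sq_bound [IsFiniteMeasure ν] {q : ℕ → 𝓧 → ℝ} {p : 𝓧 → ℝ} {K : ℝ≥0∞}
    (hK : K ≠ ∞) (hq : ∀ k, Integrable (q k) ν) (hp : Integrable p ν)
    (hqK : ∀ k, ∫⁻ x, ‖q k x‖ₑ ^ 2 ∂ν ≤ K) (hpK : ∫⁻ x, ‖p x‖ₑ ^ 2 ∂ν ≤ K)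
    (hlim : ∀ᵐ x ∂ν, Tendsto (fun k => q k x) atTop (𝓝 (p x))) :
    Tendsto (fun k => ∫ x, q k x ∂ν) atTop (𝓝 (∫ x, p x ∂ν)) := by
  refine tendsto_integral_of_L1 p hp.1 (Eventually.of_forall hq) ?_
  have hsq : ∀ k, ∫⁻ x, ‖q k x - p x‖ₑ ^ 2 ∂ν ≤ 4 * K := by
    intro k
    calc ∫⁻ x, ‖q k x - p x‖ₑ ^ 2 ∂ν ≤ ∫⁻ x, (2 * ‖q k x‖ₑ ^ 2 + 2 * ‖p x‖ₑ ^ 2) ∂ν := by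
          refine lintegral_mono fun x => ?_
          rw [← ofReal_norm, ← ofReal_norm, ← ofReal_norm,
            ← ENNReal.ofReal_pow (norm_nonneg _), ← ENNReal.ofReal_pow (norm_nonneg _),
            ← ENNReal.ofReal_pow (norm_nonneg _), ← ENNReal.ofReal_ofNat 2,
            ← ENNReal.ofReal_mul (by norm_num), ← ENNReal.ofReal_mul (by norm_num),
            ← ENNReal.ofReal_add (by positivity) (by positivity)]
          refine ENNReal.ofReal_le_ofReal ?_
          simp only [Real.norm_eq_abs, sq_abs]
          nlinarith [sq_nonneg (q k x + p x)]
      _ = 2 * ∫⁻ x, ‖q k x‖ₑ ^ 2 ∂ν + 2 * ∫⁻ x, ‖p x‖ₑ ^ 2 ∂ν := by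
          rw [lintegral_add_left' (((hq k).1.enorm.pow_const 2).const_mul 2),
            lintegral_const_mul'' _ ((hq k).1.enorm.pow_const 2),
            lintegral_const_mul'' _ (hp.1.enorm.pow_const 2)]
      _ ≤ 2 * K + 2 * K := by gcongr; exact hqK k
      _ = 4 * K := by rw [← add_mul]; norm_num
  have hmin : ∀ M : ℝ≥0∞, M ≠ ∞ →
      Tendsto (fun k => ∫⁻ x, min ‖q k x - p x‖ₑ M ∂ν) atTop (𝓝 0) := by
    intro M hM
    have := tendsto_lintegral_of_dominated_convergence' (μ := ν)
      (F := fun k x => min ‖q k x - p x‖ₑ M) (f := fun _ => 0) (fun _ => M)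
      (fun k => ((hq k).1.sub hp.1).enorm.min aemeasurable_const)
      (fun k => Eventually.of_forall fun x => min_le_right _ _)
      (by simpa using ENNReal.mul_ne_top hM (measure_ne_top ν _)) (by
        filter_upwards [hlim] with x hx
        have h1 : Tendsto (fun k => ‖q k x - p x‖ₑ) atTop (𝓝 0) := by
          have := (hx.sub_const (p x)).enorm
          simpa using this
        have h2 := h1.min (tendsto_const_nhds (x := M))
        rwa [min_eq_left (zero_le : (0 : ℝ≥0∞) ≤ M)] at h2)
    simpa using this
  have hsplit : ∀ M : ℝ≥0∞, M ≠ 0 → M ≠ ∞ → ∀ y : ℝ≥0∞, y ≤ min y M + y ^ 2 / M := by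
    intro M hM0 hM y
    rcases le_total y M with h | h
    · rw [min_eq_left h]; exact le_self_add
    · refine le_trans ?_ le_add_self
      rw [ENNReal.le_div_iff_mul_le (Or.inl hM0) (Or.inl hM), sq]
      gcongr
  rw [ENNReal.tendsto_atTop_zero]
  intro ε hε
  rcases eq_or_ne ε ∞ with rfl | hεt
  · exact ⟨0, fun _ _ => le_top⟩
  have hε2 : 0 < ε / 2 := ENNReal.half_pos hε.ne'
  have hε2t : ε / 2 ≠ ∞ := ENNReal.div_ne_top hεt (by norm_num)
  set M : ℝ≥0∞ := (4 * K + 1) / (ε / 2) with hMdef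
  have h4K : 4 * K + 1 ≠ ∞ := ENNReal.add_ne_top.2 ⟨ENNReal.mul_ne_top (by norm_num) hK, by simp⟩
  have hM : M ≠ ∞ := ENNReal.div_ne_top h4K hε2.ne'
  have hM0 : M ≠ 0 := by
    rw [hMdef, Ne, ENNReal.div_eq_zero_iff, not_or]; exact ⟨by simp, hε2t⟩
  obtain ⟨N, hN⟩ := ENNReal.tendsto_atTop_zero.1 (hmin M hM) (ε / 2) hε2
  refine ⟨N, fun k hk => ?_⟩
  calc ∫⁻ x, ‖q k x - p x‖ₑ ∂ν
      ≤ ∫⁻ x, (min ‖q k x - p x‖ₑ M + ‖q k x - p x‖ₑ ^ 2 / M) ∂ν :=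
        lintegral_mono fun x => hsplit M hM0 hM _
    _ = ∫⁻ x, min ‖q k x - p x‖ₑ M ∂ν + (∫⁻ x, ‖q k x - p x‖ₑ ^ 2 ∂ν) / M := by
        have h1 : AEMeasurable (fun x => ‖q k x - p x‖ₑ) ν := ((hq k).1.sub hp.1).enorm
        rw [lintegral_add_left' (h1.min aemeasurable_const)]
        simp only [div_eq_mul_inv]
        rw [lintegral_mul_const'' _ (h1.pow_const 2)]
    _ ≤ ε / 2 + ε / 2 := by
        refine add_le_add (hN k hk) ?_
        rw [ENNReal.div_le_iff_le_mul (Or.inl hM0) (Or.inl hM), hMdef,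
          ENNReal.mul_div_cancel hε2.ne' hε2t]
        exact (hsq k).trans le_self_add
    _ = ε := ENNReal.add_halves ε

theorem sq_lintegral_le_measure_mul {α : Type*} [MeasurableSpace α] (μ : Measure α)
    {u : α → ℝ≥0∞} (hu : AEMeasurable u μ) :
    (∫⁻ t, u t ∂μ) ^ 2 ≤ μ Set.univ * ∫⁻ t, u t ^ 2 ∂μ := by
  have h := ENNReal.lintegral_mul_le_Lp_mul_Lq μ (p := 2) (q := 2)
    ⟨by norm_num, by norm_num, by norm_num⟩ (aemeasurable_const (b := (1 : ℝ≥0∞))) hu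
  simp only [Pi.mul_apply, one_mul, ENNReal.rpow_ofNat, one_pow, lintegral_const] at h
  calc (∫⁻ t, u t ∂μ) ^ 2
      ≤ (μ Set.univ ^ (1 / 2 : ℝ) * (∫⁻ t, u t ^ 2 ∂μ) ^ (1 / 2 : ℝ)) ^ 2 := by gcongr
    _ = μ Set.univ * ∫⁻ t, u t ^ 2 ∂μ := by
      rw [mul_pow, ← ENNReal.rpow_natCast, ← ENNReal.rpow_natCast, ← ENNReal.rpow_mul,
        ← ENNReal.rpow_mul]
      norm_num

/-- Differentiation under the integral sign when the derivative is only bounded in `L²`, locally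
uniformly in the parameter, instead of being dominated: the difference quotients are averages of
the derivative along a segment, so they are bounded in `L²` too. -/
theorem integral_deriv_eq_of_sq_bound [IsFiniteMeasure ν] {f f' : 𝓧 → ℝ → ℝ} {K : ℝ≥0∞} {D : ℝ}
    (hK : K ≠ ∞) (hf : ∀ t, Integrable (fun x => f x t) ν)
    (hf'm : Measurable (Function.uncurry f'))
    (hderiv : ∀ᵐ x ∂ν, ∀ t, HasDerivAt (f x) (f' x t) t)
    (hbd : ∀ t ∈ Set.Icc (0 : ℝ) 1, ∫⁻ x, ‖f' x t‖ₑ ^ 2 ∂ν ≤ K)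
    (hD : HasDerivAt (fun t => ∫ x, f x t ∂ν) D 0) :
    Integrable (fun x => f' x 0) ν ∧ ∫ x, f' x 0 ∂ν = D := by
  have hf'0 : Measurable (fun x => f' x 0) := hf'm.comp (measurable_id.prodMk measurable_const)
  have h0K := hbd 0 ⟨le_rfl, zero_le_one⟩
  have hint0 : Integrable (fun x => f' x 0) ν := by
    refine ⟨hf'0.aestronglyMeasurable, ?_⟩
    have h := sq_lintegral_le_measure_mul ν hf'0.enorm.aemeasurable
    have h2 : (∫⁻ x, ‖f' x 0‖ₑ ∂ν) ^ 2 < ∞ :=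
      h.trans_lt (ENNReal.mul_lt_top (measure_lt_top ν _) (h0K.trans_lt hK.lt_top))
    exact (ENNReal.pow_lt_top_iff.1 h2).resolve_right (by norm_num)
  refine ⟨hint0, ?_⟩
  set s : ℕ → ℝ := fun k => 1 / ((k : ℝ) + 1) with hs
  have hs0 : ∀ k, 0 < s k := fun k => by positivity
  have hs1 : ∀ k, s k ≤ 1 := fun k => by
    rw [hs]; simp only; rw [div_le_one (by positivity)]; linarith [(Nat.cast_nonneg k : (0:ℝ) ≤ k)]
  have hslim : Tendsto s atTop (𝓝[≠] 0) :=
    tendsto_nhdsWithin_iff.2 ⟨tendsto_one_div_add_atTop_nhds_zero_nat,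
      Eventually.of_forall fun k => (hs0 k).ne'⟩
  have hquot : ∀ {φ : ℝ → ℝ} {b : ℝ}, HasDerivAt φ b 0 →
      Tendsto (fun k => (φ (s k) - φ 0) / s k) atTop (𝓝 b) := by
    intro φ b hφ
    have := (hasDerivAt_iff_tendsto_slope.1 hφ).comp hslim
    refine this.congr fun k => ?_
    simp [slope_def_field]
  have hmeas2 : Measurable (fun z : 𝓧 × ℝ => ‖f' z.1 z.2‖ₑ ^ 2) := hf'm.enorm.pow_const 2
  have hfin : ∀ᵐ x ∂ν, ∫⁻ t in Set.Icc (0 : ℝ) 1, ‖f' x t‖ₑ ^ 2 < ∞ := by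
    refine ae_lt_top (Measurable.lintegral_prod_right hmeas2) ?_
    rw [lintegral_lintegral_swap hmeas2.aemeasurable]
    refine ne_of_lt ((setLIntegral_mono measurable_const hbd).trans_lt ?_)
    simpa using hK.lt_top
  have hpt : ∀ᵐ x ∂ν, ∀ k, ‖f x (s k) - f x 0‖ₑ ^ 2 ≤
      ENNReal.ofReal (s k) * ∫⁻ t in Set.Ioc 0 (s k), ‖f' x t‖ₑ ^ 2 := by
    filter_upwards [hfin, hderiv] with x hx hdx k
    have hfx : Measurable (f' x) := hf'm.comp (measurable_const.prodMk measurable_id)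
    have hsub : Set.Ioc 0 (s k) ⊆ Set.Icc (0 : ℝ) 1 := fun t ht => ⟨ht.1.le, ht.2.trans (hs1 k)⟩
    have hcs := sq_lintegral_le_measure_mul (volume.restrict (Set.Ioc 0 (s k)))
      hfx.enorm.aemeasurable
    rw [Measure.restrict_apply_univ, Real.volume_Ioc, sub_zero] at hcs
    have hii : IntervalIntegrable (f' x) volume 0 (s k) := by
      rw [intervalIntegrable_iff_integrableOn_Ioc_of_le (hs0 k).le]
      refine ⟨hfx.aestronglyMeasurable, ?_⟩
      have h2 : (∫⁻ t in Set.Ioc 0 (s k), ‖f' x t‖ₑ) ^ 2 < ∞ :=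
        hcs.trans_lt (ENNReal.mul_lt_top ENNReal.ofReal_lt_top
          ((lintegral_mono_set hsub).trans_lt hx))
      exact (ENNReal.pow_lt_top_iff.1 h2).resolve_right (by norm_num)
    rw [← intervalIntegral.integral_eq_sub_of_hasDerivAt (fun t _ => hdx t) hii,
      intervalIntegral.integral_of_le (hs0 k).le]
    exact (pow_le_pow_left' (enorm_integral_le_lintegral_enorm _) 2).trans hcs
  have hqK : ∀ k, ∫⁻ x, ‖(f x (s k) - f x 0) / s k‖ₑ ^ 2 ∂ν ≤ K := by
    intro k
    have hsk : ENNReal.ofReal (s k) ≠ 0 := by simpa using hs0 k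
    have hI : ∫⁻ x, ‖f x (s k) - f x 0‖ₑ ^ 2 ∂ν ≤ ENNReal.ofReal (s k) ^ 2 * K := by
      calc ∫⁻ x, ‖f x (s k) - f x 0‖ₑ ^ 2 ∂ν
          ≤ ∫⁻ x, (ENNReal.ofReal (s k) * ∫⁻ t in Set.Ioc 0 (s k), ‖f' x t‖ₑ ^ 2) ∂ν := by
            refine lintegral_mono_ae ?_
            filter_upwards [hpt] with x hx using hx k
        _ = ENNReal.ofReal (s k) * ∫⁻ t in Set.Ioc (0 : ℝ) (s k), ∫⁻ x, ‖f' x t‖ₑ ^ 2 ∂ν := by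
            rw [lintegral_const_mul _ (Measurable.lintegral_prod_right hmeas2),
              lintegral_lintegral_swap hmeas2.aemeasurable]
        _ ≤ ENNReal.ofReal (s k) * ∫⁻ t in Set.Ioc (0 : ℝ) (s k), K := by
            refine mul_le_mul' le_rfl ?_
            exact setLIntegral_mono (μ := volume) (s := Set.Ioc (0 : ℝ) (s k)) measurable_const
              fun t ht => hbd t ⟨ht.1.le, ht.2.trans (hs1 k)⟩
        _ = ENNReal.ofReal (s k) ^ 2 * K := by
            rw [setLIntegral_const, Real.volume_Ioc, sub_zero]; ring
    calc ∫⁻ x, ‖(f x (s k) - f x 0) / s k‖ₑ ^ 2 ∂ν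
        = ∫⁻ x, (ENNReal.ofReal (s k) ^ 2)⁻¹ * ‖f x (s k) - f x 0‖ₑ ^ 2 ∂ν := by
          refine lintegral_congr fun x => ?_
          rw [div_eq_mul_inv, enorm_mul, mul_pow, mul_comm, enorm_inv (hs0 k).ne',
            Real.enorm_of_nonneg (hs0 k).le, ENNReal.inv_pow]
      _ = (ENNReal.ofReal (s k) ^ 2)⁻¹ * ∫⁻ x, ‖f x (s k) - f x 0‖ₑ ^ 2 ∂ν :=
          lintegral_const_mul'' _ ((((hf _).sub (hf 0)).1.enorm).pow_const 2)
      _ ≤ (ENNReal.ofReal (s k) ^ 2)⁻¹ * (ENNReal.ofReal (s k) ^ 2 * K) := by gcongr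
      _ = K := by
          rw [← mul_assoc, ENNReal.inv_mul_cancel (pow_ne_zero 2 hsk)
            (ENNReal.pow_ne_top ENNReal.ofReal_ne_top), one_mul]
  have hlim := tendsto_integral_of_sq_bound hK (fun k => ((hf (s k)).sub (hf 0)).div_const (s k))
    hint0 hqK h0K (by
      filter_upwards [hderiv] with x hx using hquot (hx 0))
  refine tendsto_nhds_unique hlim ((hquot hD).congr fun k => ?_)
  have : ∫ x, (f x (s k) - f x 0) / s k ∂ν = (∫ x, f x (s k) ∂ν - ∫ x, f x 0 ∂ν) / s k := by
    rw [integral_div, integral_sub (hf _) (hf _)]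
  exact this.symm

variable {d : ℕ} {g : 𝓧 → Vec d → ℝ} {θ : Vec d}

theorem hasDerivAt_comp_line {G : Vec d → ℝ} {h : Vec d} {t : ℝ} (i : Fin d)
    (hG : DifferentiableAt ℝ G (h + t • EuclideanSpace.single i 1)) :
    HasDerivAt (fun s : ℝ => G (h + s • EuclideanSpace.single i 1))
      ((∇ G (h + t • EuclideanSpace.single i 1)) i) t := by
  have h1 : HasDerivAt (fun s : ℝ => h + s • (EuclideanSpace.single i 1 : Vec d))
      (EuclideanSpace.single i 1) t := by
    simpa using ((hasDerivAt_id t).smul_const (EuclideanSpace.single i 1 : Vec d)).const_add h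
  have h3 := hG.hasFDerivAt.comp_hasDerivAt t h1
  rw [← inner_gradient_left, EuclideanSpace.inner_single_right] at h3
  rw [conj_trivial, one_mul] at h3
  exact h3

/-- The gradient of the loss has a version that is jointly measurable, obtained by discarding a null
set of data points at which the loss is not differentiable. -/
theorem exists_measurable_gradient (hg : Measurable (Function.uncurry g))
    (hd : ∀ᵐ x ∂ν, Differentiable ℝ (g x)) :
    ∃ Φ : 𝓧 → Vec d → Vec d, Measurable (Function.uncurry Φ) ∧
      ∀ᵐ x ∂ν, Differentiable ℝ (g x) ∧ ∀ h, Φ x h = ∇ (g x) h := by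
  classical
  set N := toMeasurable ν {x | ¬ Differentiable ℝ (g x)} with hN
  have hN0 : ν N = 0 := by rw [hN, measure_toMeasurable]; exact hd
  have hNd : ∀ x, x ∉ N → Differentiable ℝ (g x) := fun x hx => by
    by_contra h
    exact hx (subset_toMeasurable ν _ h)
  refine ⟨fun x h => if x ∈ N then 0 else ∇ (g x) h, ?_, ?_⟩
  · set s : ℕ → ℝ := fun k => 1 / ((k : ℝ) + 1) with hs
    have hslim : Tendsto s atTop (𝓝[≠] 0) :=
      tendsto_nhdsWithin_iff.2 ⟨tendsto_one_div_add_atTop_nhds_zero_nat,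
        Eventually.of_forall fun k => by
          have : 0 < s k := by positivity
          exact this.ne'⟩
    refine measurable_of_tendsto_metrizable (f := fun k (z : 𝓧 × Vec d) => if z.1 ∈ N then 0 else
      WithLp.toLp 2 (fun i => (g z.1 (z.2 + s k • EuclideanSpace.single i 1) - g z.1 z.2) / s k))
      (fun k => ?_) ?_
    · refine Measurable.ite (measurable_fst (measurableSet_toMeasurable _ _)) measurable_const ?_
      refine (PiLp.continuous_toLp 2 _).measurable.comp (measurable_pi_lambda _ fun i => ?_)
      have h1 : Measurable (fun z : 𝓧 × Vec d => g z.1 (z.2 + s k • EuclideanSpace.single i 1)) :=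
        hg.comp (measurable_fst.prodMk (measurable_snd.add_const _))
      exact (h1.sub hg).div_const _
    · rw [tendsto_pi_nhds]
      rintro ⟨x, h⟩
      by_cases hx : x ∈ N
      · simp [hx]
      · simp only [hx, if_false, Function.uncurry_apply_pair]
        have hcomp : WithLp.toLp 2 (fun i => (∇ (g x) h) i) = ∇ (g x) h := rfl
        rw [← hcomp]
        refine ((PiLp.continuous_toLp 2 _).tendsto _).comp (tendsto_pi_nhds.2 fun i => ?_)
        have hli := hasDerivAt_comp_line (h := h) (t := 0) i (hNd x hx _)
        rw [zero_smul, add_zero] at hli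
        refine ((hasDerivAt_iff_tendsto_slope.1 hli).comp hslim).congr fun k => ?_
        simp [slope_def_field]
  · have : ∀ᵐ x ∂ν, x ∉ N := by rw [ae_iff]; simpa using hN0
    filter_upwards [this] with x hx
    exact ⟨hNd x hx, fun h => by simp [hx]⟩

/-- The stochastic gradient is unbiased: gradient and expectation may be exchanged, because the
second moment of the gradient is bounded along every segment. -/
theorem integral_gradient_eq [IsFiniteMeasure ν] (hframe : Framework ν g) (hA1 : FirstOrder ν g θ)
    (hG : ContDiff ℝ 2 (risk ν g)) {Φ : 𝓧 → Vec d → Vec d} (hΦ : Measurable (Function.uncurry Φ))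
    (hΦg : ∀ᵐ x ∂ν, Differentiable ℝ (g x) ∧ ∀ h, Φ x h = ∇ (g x) h) (h : Vec d) :
    Integrable (fun x => Φ x h) ν ∧ ∫ x, Φ x h ∂ν = ∇ (risk ν g) h := by
  obtain ⟨C, C', hC, hC', hbd⟩ := hA1.second_moment
  have hcoord : ∀ i : Fin d, Integrable (fun x => Φ x h i) ν ∧
      ∫ x, Φ x h i ∂ν = ∇ (risk ν g) h i := by
    intro i
    set e : Vec d := EuclideanSpace.single i 1 with he
    obtain ⟨B, hB⟩ := (isCompact_Icc (a := (0 : ℝ)) (b := 1)).bddAbove_image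
      (f := fun t => C + C' * (risk ν g (h + t • e) - risk ν g θ)) (by
        have := hG.continuous
        fun_prop)
    have hres := integral_deriv_eq_of_sq_bound (ν := ν) (f := fun x t => g x (h + t • e))
      (f' := fun x t => Φ x (h + t • e) i) (K := ENNReal.ofReal B)
      (D := ∇ (risk ν g) h i) ENNReal.ofReal_ne_top
      (fun t => hframe.integrable_loss _) ?_ ?_ ?_ ?_
    · simpa using hres
    · have h1 : Measurable (fun z : 𝓧 × ℝ => Φ z.1 (h + z.2 • e)) :=
        hΦ.comp (measurable_fst.prodMk (by fun_prop))
      exact (EuclideanSpace.proj (𝕜 := ℝ) i).continuous.measurable.comp h1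
    · filter_upwards [hΦg] with x hx t
      rw [hx.2]
      exact hasDerivAt_comp_line i (hx.1 _)
    · intro t ht
      calc ∫⁻ x, ‖Φ x (h + t • e) i‖ₑ ^ 2 ∂ν
          ≤ ∫⁻ x, ‖∇ (g x) (h + t • e)‖ₑ ^ 2 ∂ν := by
            refine lintegral_mono_ae ?_
            filter_upwards [hΦg] with x hx
            rw [← hx.2]
            gcongr
            rw [← ofReal_norm, ← ofReal_norm]
            exact ENNReal.ofReal_le_ofReal (PiLp.norm_apply_le _ i)
        _ ≤ _ := hbd _
        _ ≤ ENNReal.ofReal B := ENNReal.ofReal_le_ofReal (hB ⟨t, ht, rfl⟩)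
    · have h3 := hasDerivAt_comp_line (h := h) (t := 0) i (hG.differentiable (by norm_num) _)
      rw [zero_smul, add_zero] at h3
      exact h3
  have hint : Integrable (fun x => Φ x h) ν := by
    have : Integrable (fun x => (Φ x h).ofLp) ν := Integrable.of_eval fun i => (hcoord i).1
    exact (PiLp.continuousLinearEquiv 2 ℝ (fun _ : Fin d => ℝ)).symm.toContinuousLinearMap
      |>.integrable_comp this
  refine ⟨hint, ?_⟩
  ext i
  rw [← (hcoord i).2]
  exact ((EuclideanSpace.proj (𝕜 := ℝ) i).integral_comp_comm hint).symm

end Interchange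

/-! ### Integrating out the next observation, and the Robbins–Siegmund theorem -/

section Freezing

variable {Ω 𝓧 S : Type*} {m mΩ : MeasurableSpace Ω} [MeasurableSpace 𝓧] [MeasurableSpace S]

/-- Integrating out a random variable `Y` that is independent of `Z`. -/
theorem lintegral_comp_eq_of_indepFun {P : Measure Ω} [IsProbabilityMeasure P] {ν : Measure 𝓧}
    {Y : Ω → 𝓧} {Z : Ω → S} (hY : Measurable Y) (hZ : Measurable Z) (hν : P.map Y = ν)
    (hind : IndepFun Y Z P) {F : 𝓧 → S → ℝ≥0∞} (hF : Measurable (Function.uncurry F)) :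
    ∫⁻ ω, F (Y ω) (Z ω) ∂P = ∫⁻ ω, ∫⁻ x, F x (Z ω) ∂ν ∂P := by
  subst hν
  have : IsProbabilityMeasure (P.map Y) := Measure.isProbabilityMeasure_map hY.aemeasurable
  have hmap := (indepFun_iff_map_prod_eq_prod_map_map hY.aemeasurable hZ.aemeasurable).1 hind
  calc ∫⁻ ω, F (Y ω) (Z ω) ∂P = ∫⁻ z, Function.uncurry F z ∂(P.map fun ω => (Y ω, Z ω)) := by
        rw [lintegral_map hF (hY.prodMk hZ)]; rfl
    _ = ∫⁻ z, ∫⁻ x, F x z ∂(P.map Y) ∂(P.map Z) := by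
        rw [hmap, lintegral_prod_symm' _ hF]; rfl
    _ = _ := lintegral_map (f := fun z => ∫⁻ x, F x z ∂(P.map Y)) hF.lintegral_prod_left' hZ

/-- Integrating out a random variable `Y` that is independent of a σ-algebra `m`, on an event of
`m`. -/
theorem setLIntegral_comp_eq_of_indep {P : Measure Ω} [IsProbabilityMeasure P] {ν : Measure 𝓧}
    (hm : m ≤ mΩ) {Y : Ω → 𝓧} (hY : Measurable Y) (hν : P.map Y = ν)
    (hind : Indep (MeasurableSpace.comap Y inferInstance) m P) {Z : Ω → S}
    (hZ : Measurable[m] Z) {A : Set Ω} (hA : MeasurableSet[m] A)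
    {F : 𝓧 → S → ℝ≥0∞} (hF : Measurable (Function.uncurry F)) :
    ∫⁻ ω in A, F (Y ω) (Z ω) ∂P = ∫⁻ ω in A, ∫⁻ x, F x (Z ω) ∂ν ∂P := by
  classical
  have hZA : Measurable[m] (fun ω => (Z ω, A.indicator (1 : Ω → ℝ≥0∞) ω)) :=
    hZ.prodMk ((measurable_const (α := ℝ≥0∞) (a := 1)).indicator hA)
  have hind' : IndepFun Y (fun ω => (Z ω, A.indicator (1 : Ω → ℝ≥0∞) ω)) P := by
    rw [IndepFun_iff_Indep]
    exact indep_of_indep_of_le_right hind hZA.comap_le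
  have hF' : Measurable (Function.uncurry
      fun (x : 𝓧) (z : S × ℝ≥0∞) => z.2 * F x z.1) :=
    (measurable_snd.comp measurable_snd).mul
      (hF.comp (measurable_fst.prodMk (measurable_fst.comp measurable_snd)))
  have h := lintegral_comp_eq_of_indepFun hY (hZA.mono hm le_rfl) hν hind' hF'
  rw [← lintegral_indicator (hm _ hA), ← lintegral_indicator (hm _ hA)]
  refine Eq.trans ?_ (h.trans ?_)
  · refine lintegral_congr fun ω => ?_
    by_cases hω : ω ∈ A <;> simp [hω]
  · refine lintegral_congr fun ω => ?_
    by_cases hω : ω ∈ A <;> simp [hω]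

end Freezing

section RobbinsSiegmund

variable {Ω : Type*} {mΩ : MeasurableSpace Ω} {P : Measure Ω} [IsProbabilityMeasure P]
  {ℱ : Filtration ℕ mΩ} {U ψ : ℕ → Ω → ℝ} {α β : ℕ → ℝ}

/-- The Robbins–Siegmund theorem without multiplicative perturbation: adding the past gains and
subtracting the past perturbations turns `U` into a supermartingale bounded below. -/
theorem ae_tendsto_and_summable_of_setIntegral_le (hU0 : ∀ n ω, 0 ≤ U n ω)
    (hψ0 : ∀ n ω, 0 ≤ ψ n ω) (hUm : ∀ n, StronglyMeasurable[ℱ n] (U n))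
    (hψm : ∀ n, StronglyMeasurable[ℱ n] (ψ n)) (hUi : ∀ n, Integrable (U n) P)
    (hψi : ∀ n, Integrable (ψ n) P) (hβ0 : ∀ n, 0 ≤ β n) (hβ : Summable β)
    (h : ∀ n A, MeasurableSet[ℱ n] A →
      ∫ ω in A, U (n + 1) ω ∂P + ∫ ω in A, ψ n ω ∂P ≤ ∫ ω in A, U n ω ∂P + β n * P.real A) :
    ∀ᵐ ω ∂P, (∃ l, Tendsto (fun n => U n ω) atTop (𝓝 l)) ∧ Summable (fun n => ψ n ω) := by
  set b : ℕ → ℝ := fun n => ∑ k ∈ Finset.range n, β k with hb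
  set Y : ℕ → Ω → ℝ := fun n ω => U n ω + ∑ k ∈ Finset.range n, ψ k ω - b n with hY
  have hYi : ∀ n, Integrable (Y n) P := fun n =>
    ((hUi n).add (integrable_finsetSum _ fun k _ => hψi k)).sub (integrable_const _)
  have hYm : StronglyAdapted ℱ Y := fun n => by
    refine ((hUm n).add ?_).sub stronglyMeasurable_const
    exact Finset.stronglyMeasurable_fun_sum _ fun k hk =>
      (hψm k).mono (ℱ.mono (Finset.mem_range.1 hk).le)
  have hbB : ∀ n, b n ≤ ∑' k, β k := fun n => hβ.sum_le_tsum _ fun k _ => hβ0 k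
  have hY0 : ∀ n ω, -(∑' k, β k) ≤ Y n ω := fun n ω => by
    have h1 := hbB n
    have h2 := hU0 n ω
    have h3 : 0 ≤ ∑ k ∈ Finset.range n, ψ k ω := Finset.sum_nonneg fun k _ => hψ0 k ω
    simp only [hY]; linarith
  have hsuper : Supermartingale Y ℱ P := by
    refine supermartingale_of_setIntegral_succ_le hYm hYi fun n A hA => ?_
    have hsumi : Integrable (fun ω => ∑ k ∈ Finset.range n, ψ k ω) P :=
      integrable_finsetSum _ fun k _ => hψi k
    have e1 : ∫ ω in A, Y (n + 1) ω ∂P = ∫ ω in A, U (n + 1) ω ∂P + ∫ ω in A, ψ n ω ∂P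
        + ∫ ω in A, (∑ k ∈ Finset.range n, ψ k ω - b n) ∂P - β n * P.real A := by
      have : ∀ ω, Y (n + 1) ω
          = ((U (n + 1) ω + ψ n ω) + (∑ k ∈ Finset.range n, ψ k ω - b n)) - β n := fun ω => by
        simp only [hY, hb, Finset.sum_range_succ]; ring
      simp only [this]
      rw [integral_sub, integral_add, integral_add, setIntegral_const, smul_eq_mul, mul_comm]
      · exact (hUi _).integrableOn
      · exact (hψi _).integrableOn
      · exact ((hUi _).add (hψi _)).integrableOn
      · exact (hsumi.sub (integrable_const _)).integrableOn
      · exact (((hUi _).add (hψi _)).add (hsumi.sub (integrable_const _))).integrableOn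
      · exact integrable_const _
    have e2 : ∫ ω in A, Y n ω ∂P = ∫ ω in A, U n ω ∂P
        + ∫ ω in A, (∑ k ∈ Finset.range n, ψ k ω - b n) ∂P := by
      have : ∀ ω, Y n ω = U n ω + (∑ k ∈ Finset.range n, ψ k ω - b n) := fun ω => by
        simp only [hY]; ring
      simp only [this]
      exact integral_add (hUi _).integrableOn (hsumi.sub (integrable_const _)).integrableOn
    rw [e1, e2]
    linarith [h n A hA]
  have hmean : ∀ n, ∫ ω, Y n ω ∂P ≤ ∫ ω, Y 0 ω ∂P := fun n => by
    simpa using hsuper.setIntegral_le (Nat.zero_le n) (MeasurableSet.univ)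
  set B := ∑' k, β k with hB
  have hB0 : 0 ≤ B := tsum_nonneg hβ0
  have hbdd : ∀ n, eLpNorm ((-Y) n) 1 P ≤ ((∫ ω, Y 0 ω ∂P + 2 * B).toNNReal : ℝ≥0∞) := by
    intro n
    rw [eLpNorm_one_eq_lintegral_enorm]
    have hle : ∀ ω, ‖(-Y) n ω‖ ≤ Y n ω + 2 * B := fun ω => by
      have := hY0 n ω
      simp only [Pi.neg_apply, norm_neg, Real.norm_eq_abs]
      exact abs_le.2 ⟨by linarith, by linarith⟩
    calc ∫⁻ ω, ‖(-Y) n ω‖ₑ ∂P ≤ ∫⁻ ω, ENNReal.ofReal (Y n ω + 2 * B) ∂P := by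
          refine lintegral_mono fun ω => ?_
          rw [← ofReal_norm]
          exact ENNReal.ofReal_le_ofReal (hle ω)
      _ = ENNReal.ofReal (∫ ω, (Y n ω + 2 * B) ∂P) :=
          (ofReal_integral_eq_lintegral_ofReal ((hYi n).add (integrable_const _))
            (Eventually.of_forall fun ω => (norm_nonneg _).trans (hle ω))).symm
      _ ≤ ENNReal.ofReal (∫ ω, Y 0 ω ∂P + 2 * B) := by
          refine ENNReal.ofReal_le_ofReal ?_
          rw [integral_add (hYi n) (integrable_const _)]
          simpa using hmean n
  filter_upwards [hsuper.neg.exists_ae_tendsto_of_bdd hbdd] with ω ⟨l, hω⟩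
  have hYl : Tendsto (fun n => Y n ω) atTop (𝓝 (-l)) := by
    simpa using hω.neg
  have hbl : Tendsto b atTop (𝓝 B) := hβ.hasSum.tendsto_sum_nat
  have hψs : Summable (fun n => ψ n ω) := by
    obtain ⟨R, hR⟩ := hYl.bddAbove_range
    refine summable_of_sum_range_le (c := R + B) (fun n => hψ0 n ω) fun n => ?_
    have h1 := hR ⟨n, rfl⟩
    have h2 := hU0 n ω
    have h3 := hbB n
    simp only [hY] at h1
    linarith
  refine ⟨⟨_, ((hYl.sub hψs.hasSum.tendsto_sum_nat).add hbl).congr fun n => ?_⟩, hψs⟩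
  simp only [hY]; ring

/-- The Robbins–Siegmund theorem for an integrable initial value; the discount by
`∏ k < n, (1 + α k)` removes the multiplicative perturbation. -/
theorem ae_tendsto_and_summable_of_setLIntegral_le (hU0 : ∀ n ω, 0 ≤ U n ω)
    (hψ0 : ∀ n ω, 0 ≤ ψ n ω) (hUm : ∀ n, StronglyMeasurable[ℱ n] (U n))
    (hψm : ∀ n, StronglyMeasurable[ℱ n] (ψ n)) (hUi : Integrable (U 0) P)
    (hα0 : ∀ n, 0 ≤ α n) (hα : Summable α) (hβ0 : ∀ n, 0 ≤ β n) (hβ : Summable β)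
    (h : ∀ n A, MeasurableSet[ℱ n] A →
      ∫⁻ ω in A, ENNReal.ofReal (U (n + 1) ω) ∂P + ∫⁻ ω in A, ENNReal.ofReal (ψ n ω) ∂P
        ≤ ENNReal.ofReal (1 + α n) * ∫⁻ ω in A, ENNReal.ofReal (U n ω) ∂P
          + ENNReal.ofReal (β n) * P A) :
    ∀ᵐ ω ∂P, (∃ l, Tendsto (fun n => U n ω) atTop (𝓝 l)) ∧ Summable (fun n => ψ n ω) := by
  have hUm' : ∀ n, AEStronglyMeasurable (U n) P := fun n =>
    ((hUm n).mono (ℱ.le n)).aestronglyMeasurable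
  have hψm' : ∀ n, AEStronglyMeasurable (ψ n) P := fun n =>
    ((hψm n).mono (ℱ.le n)).aestronglyMeasurable
  have hint : ∀ {f : Ω → ℝ}, (∀ ω, 0 ≤ f ω) → AEStronglyMeasurable f P →
      (Integrable f P ↔ ∫⁻ ω, ENNReal.ofReal (f ω) ∂P < ∞) := fun {f} h0 hm => by
    rw [← hasFiniteIntegral_iff_ofReal (Eventually.of_forall h0)]
    exact ⟨fun h => h.2, fun h => ⟨hm, h⟩⟩
  have hfin : ∀ n, Integrable (U n) P →
      ∫⁻ ω, ENNReal.ofReal (U (n + 1) ω) ∂P + ∫⁻ ω, ENNReal.ofReal (ψ n ω) ∂P < ∞ := by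
    intro n hn
    have h1 := h n Set.univ MeasurableSet.univ
    simp only [Measure.restrict_univ] at h1
    refine h1.trans_lt (ENNReal.add_lt_top.2 ⟨ENNReal.mul_lt_top ENNReal.ofReal_lt_top
      ((hint (hU0 n) (hUm' n)).1 hn), ENNReal.mul_lt_top ENNReal.ofReal_lt_top (measure_lt_top _ _)⟩)
  have hUi' : ∀ n, Integrable (U n) P := by
    intro n
    induction n with
    | zero => exact hUi
    | succ n ih =>
      exact (hint (hU0 _) (hUm' _)).2 (ENNReal.add_lt_top.1 (hfin n ih)).1
  have hψi : ∀ n, Integrable (ψ n) P := fun n =>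
    (hint (hψ0 _) (hψm' _)).2 (ENNReal.add_lt_top.1 (hfin n (hUi' n))).2
  have hreal : ∀ n A, MeasurableSet[ℱ n] A →
      ∫ ω in A, U (n + 1) ω ∂P + ∫ ω in A, ψ n ω ∂P
        ≤ (1 + α n) * ∫ ω in A, U n ω ∂P + β n * P.real A := by
    intro n A hA
    have hα1 : 0 ≤ 1 + α n := by linarith [hα0 n]
    have hof : ∀ {f : Ω → ℝ}, (∀ ω, 0 ≤ f ω) → Integrable f P →
        ∫⁻ ω in A, ENNReal.ofReal (f ω) ∂P = ENNReal.ofReal (∫ ω in A, f ω ∂P) := fun h0 hi =>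
      (ofReal_integral_eq_lintegral_ofReal hi.integrableOn (Eventually.of_forall h0)).symm
    have hnn : ∀ {f : Ω → ℝ}, (∀ ω, 0 ≤ f ω) → 0 ≤ ∫ ω in A, f ω ∂P := fun h0 =>
      integral_nonneg h0
    have h1 := h n A hA
    have hPA : P A = ENNReal.ofReal (P.real A) := (ofReal_measureReal).symm
    rw [hof (hU0 _) (hUi' _), hof (hψ0 _) (hψi _), hof (hU0 _) (hUi' _), hPA,
      ← ENNReal.ofReal_add (hnn (hU0 _)) (hnn (hψ0 _)), ← ENNReal.ofReal_mul hα1,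
      ← ENNReal.ofReal_mul (hβ0 n), ← ENNReal.ofReal_add (mul_nonneg hα1 (hnn (hU0 _)))
      (mul_nonneg (hβ0 n) measureReal_nonneg)] at h1
    exact (ENNReal.ofReal_le_ofReal_iff (add_nonneg (mul_nonneg hα1 (hnn (hU0 _)))
      (mul_nonneg (hβ0 n) measureReal_nonneg))).1 h1
  set p : ℕ → ℝ := fun n => ∏ k ∈ Finset.range n, (1 + α k) with hp
  have hp1 : ∀ n, 1 ≤ p n := fun n =>
    Finset.one_le_prod (f := fun k => 1 + α k) fun k _ => by
      linarith [hα0 k]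
  have hp0 : ∀ n, 0 < p n := fun n => one_pos.trans_le (hp1 n)
  have hps : ∀ n, p (n + 1) = p n * (1 + α n) := fun n => Finset.prod_range_succ _ _
  have hpmono : Monotone p := monotone_nat_of_le_succ fun n => by
    rw [hps]; nlinarith [hp1 n, hα0 n]
  have hpbdd : ∀ n, p n ≤ Real.exp (∑' k, α k) := fun n => by
    calc p n ≤ ∏ k ∈ Finset.range n, Real.exp (α k) :=
          Finset.prod_le_prod (fun k _ => by linarith [hα0 k])
            fun k _ => by linarith [Real.add_one_le_exp (α k)]
      _ = Real.exp (∑ k ∈ Finset.range n, α k) := (Real.exp_sum _ _).symm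
      _ ≤ _ := Real.exp_le_exp.2 (hα.sum_le_tsum _ fun k _ => hα0 k)
  obtain ⟨q, hq⟩ : ∃ q, Tendsto p atTop (𝓝 q) :=
    ⟨_, tendsto_atTop_ciSup hpmono ⟨_, by rintro _ ⟨n, rfl⟩; exact hpbdd n⟩⟩
  have hmain := ae_tendsto_and_summable_of_setIntegral_le (P := P) (ℱ := ℱ)
    (U := fun n ω => (p n)⁻¹ * U n ω) (ψ := fun n ω => (p (n + 1))⁻¹ * ψ n ω) (β := β)
    (fun n ω => mul_nonneg (inv_nonneg.2 (hp0 n).le) (hU0 n ω))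
    (fun n ω => mul_nonneg (inv_nonneg.2 (hp0 _).le) (hψ0 n ω))
    (fun n => (hUm n).const_mul _) (fun n => (hψm n).const_mul _)
    (fun n => (hUi' n).const_mul _) (fun n => (hψi n).const_mul _) hβ0 hβ (by
      intro n A hA
      simp only [integral_const_mul]
      have h1 := mul_le_mul_of_nonneg_left (hreal n A hA) (inv_nonneg.2 (hp0 (n + 1)).le)
      have h2 : (p (n + 1))⁻¹ * ((1 + α n) * ∫ ω in A, U n ω ∂P) = (p n)⁻¹ * ∫ ω in A, U n ω ∂P := by
        have := hp0 n
        have : 0 < 1 + α n := by linarith [hα0 n]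
        rw [hps]; field_simp
      have h3 : (p (n + 1))⁻¹ * (β n * P.real A) ≤ β n * P.real A :=
        mul_le_of_le_one_left (mul_nonneg (hβ0 n) measureReal_nonneg) (inv_le_one_of_one_le₀ (hp1 _))
      rw [mul_add, mul_add, h2] at h1
      linarith)
  filter_upwards [hmain] with ω ⟨⟨l, hl⟩, hs⟩
  refine ⟨⟨q * l, (hq.mul hl).congr fun n => ?_⟩, ?_⟩
  · rw [mul_inv_cancel_left₀ (hp0 n).ne']
  · refine Summable.of_nonneg_of_le (fun n => hψ0 n ω) (fun n => ?_)
      (hs.mul_left (Real.exp (∑' k, α k)))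
    calc ψ n ω = p (n + 1) * ((p (n + 1))⁻¹ * ψ n ω) := by
          rw [mul_inv_cancel_left₀ (hp0 _).ne']
      _ ≤ _ := mul_le_mul_of_nonneg_right (hpbdd _)
          (mul_nonneg (inv_nonneg.2 (hp0 _).le) (hψ0 n ω))

/-- The **Robbins–Siegmund theorem**, localized. The drift inequality is only required, from some
time on, on events `A ⊆ B n` of the past, where almost surely `B n` holds eventually; no
integrability is assumed. One stops the process when it first leaves the events `B n`, and starts it
where its value is bounded. -/
theorem robbinsSiegmund (hU0 : ∀ n ω, 0 ≤ U n ω)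
    (hψ0 : ∀ n ω, 0 ≤ ψ n ω) (hUm : ∀ n, Measurable[ℱ n] (U n))
    (hψm : ∀ n, Measurable[ℱ n] (ψ n))
    (hα0 : ∀ n, 0 ≤ α n) (hα : Summable α) (hβ0 : ∀ n, 0 ≤ β n) (hβ : Summable β)
    {B : ℕ → Set Ω} (hBm : ∀ n, MeasurableSet[ℱ n] (B n)) (hB : ∀ᵐ ω ∂P, ∀ᶠ n in atTop, ω ∈ B n)
    (h : ∀ᶠ n in atTop, ∀ A, MeasurableSet[ℱ n] A → A ⊆ B n →
      ∫⁻ ω in A, ENNReal.ofReal (U (n + 1) ω) ∂P + ∫⁻ ω in A, ENNReal.ofReal (ψ n ω) ∂P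
        ≤ ENNReal.ofReal (1 + α n) * ∫⁻ ω in A, ENNReal.ofReal (U n ω) ∂P
          + ENNReal.ofReal (β n) * P A) :
    ∀ᵐ ω ∂P, (∃ l, Tendsto (fun n => U n ω) atTop (𝓝 l)) ∧ Summable (fun n => ψ n ω) := by
  obtain ⟨n₀, hn₀⟩ := eventually_atTop.1 h
  have hloc : ∀ N, n₀ ≤ N → ∀ m : ℕ, ∀ᵐ ω ∂P, U N ω ≤ m → (∀ k, N ≤ k → ω ∈ B k) →
      (∃ l, Tendsto (fun n => U n ω) atTop (𝓝 l)) ∧ Summable (fun n => ψ n ω) := by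
    intro N hN m
    -- The process is observed from time `N` on, and killed at the first exit from the events `B`.
    let 𝒢 : Filtration ℕ mΩ :=
      ⟨fun j => ℱ (N + j), fun i j hij => ℱ.mono (by omega), fun j => ℱ.le _⟩
    let S : ℕ → Set Ω := fun j => {ω | U N ω ≤ m} ∩ ⋂ i ∈ Finset.range j, B (N + i)
    have hSsucc : ∀ j, S (j + 1) = S j ∩ B (N + j) := fun j => by
      ext ω
      simp only [S, Set.mem_inter_iff, Set.mem_iInter, Finset.mem_range, Set.mem_ofPred_eq,
        Nat.lt_succ_iff_lt_or_eq]
      constructor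
      · rintro ⟨h1, h2⟩; exact ⟨⟨h1, fun i hi => h2 i (Or.inl hi)⟩, h2 j (Or.inr rfl)⟩
      · rintro ⟨⟨h1, h2⟩, h3⟩
        exact ⟨h1, fun i hi => hi.elim (h2 i) (fun e => e ▸ h3)⟩
    have hSm : ∀ j, MeasurableSet[ℱ (N + j)] (S j) := by
      intro j
      refine MeasurableSet.inter (ℱ.mono (Nat.le_add_right N j) _ ?_) ?_
      · exact measurableSet_le (hUm N) measurable_const
      · exact Finset.measurableSet_biInter _ fun i hi =>
          ℱ.mono (by have := Finset.mem_range.1 hi; omega) _ (hBm (N + i))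
    have hSm1 : ∀ j, MeasurableSet[ℱ (N + j)] (S (j + 1)) := fun j => by
      rw [hSsucc]; exact (hSm j).inter (hBm _)
    have hmain := ae_tendsto_and_summable_of_setLIntegral_le (P := P) (ℱ := 𝒢)
      (U := fun j => (S j).indicator (U (N + j))) (ψ := fun j => (S (j + 1)).indicator (ψ (N + j)))
      (α := fun j => α (N + j)) (β := fun j => β (N + j))
      (fun j ω => Set.indicator_nonneg (fun ω _ => hU0 _ ω) ω)
      (fun j ω => Set.indicator_nonneg (fun ω _ => hψ0 _ ω) ω)
      (fun j => ((hUm _).indicator (hSm j)).stronglyMeasurable)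
      (fun j => ((hψm _).indicator (hSm1 j)).stronglyMeasurable)
      (by
        refine Integrable.of_bound (C := m)
          (((hUm N).indicator (hSm 0)).mono (ℱ.le N) le_rfl).aestronglyMeasurable
          (Eventually.of_forall fun ω => ?_)
        rw [Real.norm_of_nonneg (Set.indicator_nonneg (fun ω _ => hU0 _ ω) ω)]
        refine Set.indicator_le' (s := S 0) (g := fun _ => (m : ℝ)) (fun ω hω => hω.1)
          (fun _ _ => Nat.cast_nonneg m) ω)
      (fun j => hα0 _) ((summable_nat_add_iff N).2 hα |>.congr fun j => by rw [add_comm])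
      (fun j => hβ0 _) ((summable_nat_add_iff N).2 hβ |>.congr fun j => by rw [add_comm])
      (by
        intro j A hA
        have hS1 : MeasurableSet (S (j + 1)) := ℱ.le _ _ (hSm1 j)
        have hS0 : MeasurableSet (S j) := ℱ.le _ _ (hSm j)
        have hind : ∀ {T : Set Ω} (f : Ω → ℝ), MeasurableSet T →
            ∫⁻ ω in A, ENNReal.ofReal (T.indicator f ω) ∂P
              = ∫⁻ ω in A ∩ T, ENNReal.ofReal (f ω) ∂P := by
          intro T f hT
          rw [Set.inter_comm, ← setLIntegral_indicator hT]
          refine lintegral_congr fun ω => ?_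
          by_cases hω : ω ∈ T <;> simp [hω]
        have hsub : S (j + 1) ⊆ S j := by rw [hSsucc]; exact Set.inter_subset_left
        rw [hind _ hS1, hind _ hS1, hind _ hS0]
        refine (hn₀ (N + j) (by omega) (A ∩ S (j + 1)) (MeasurableSet.inter hA (hSm1 j)) ?_).trans ?_
        · rw [hSsucc]; exact fun ω hω => hω.2.2
        · gcongr
          exact Set.inter_subset_left)
    filter_upwards [hmain] with ω hω hUN hBN
    have hmem : ∀ j, ω ∈ S j := fun j =>
      ⟨hUN, Set.mem_iInter₂.2 fun i _ => hBN _ (Nat.le_add_right N i)⟩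
    simp only [Set.indicator_of_mem (hmem _)] at hω
    obtain ⟨⟨l, hl⟩, hs⟩ := hω
    refine ⟨⟨l, (tendsto_add_atTop_iff_nat N).1 (hl.congr fun n => by rw [add_comm])⟩,
      (summable_nat_add_iff N).1 (hs.congr fun n => by rw [add_comm])⟩
  have hall : ∀ᵐ ω ∂P, ∀ N, n₀ ≤ N → ∀ m : ℕ, U N ω ≤ m → (∀ k, N ≤ k → ω ∈ B k) →
      (∃ l, Tendsto (fun n => U n ω) atTop (𝓝 l)) ∧ Summable (fun n => ψ n ω) := by
    rw [ae_all_iff]; intro N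
    by_cases hN : n₀ ≤ N
    · have := (ae_all_iff (μ := P)).2 (hloc N hN)
      filter_upwards [this] with ω hω _ m using hω m
    · exact Eventually.of_forall fun ω hN' => absurd hN' hN
  filter_upwards [hall, hB] with ω hω hBω
  obtain ⟨N, hN⟩ := eventually_atTop.1 hBω
  obtain ⟨m, hm⟩ := exists_nat_ge (U (max N n₀) ω)
  exact hω (max N n₀) (le_max_right _ _) m hm fun k hk => hN k ((le_max_left _ _).trans hk)

end RobbinsSiegmund

/-! ### Preconditioned stochastic descent and its consistency -/

section Model
open scoped RealInnerProductSpace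

variable {Ω 𝓧 : Type*} {mΩ : MeasurableSpace Ω} [MeasurableSpace 𝓧] {d : ℕ}

/-- The step size `1 / (n + 1 + c)`. -/
def gain (c : ℝ) (n : ℕ) : ℝ := 1 / ((n : ℝ) + 1 + c)

/-- A stochastic gradient algorithm `θₙ₊₁ = θₙ - (n + 1 + c)⁻¹ Kₙ Φ(Xₙ₊₁, θₙ)` with unbiased
measurable gradients `Φ`, preconditioned by random operators `Kₙ` that converge almost surely to a
deterministic coercive operator `T`, the inverse of the derivative `D` of `∇G` at `θ`. The
constants are: `L` a Lipschitz constant of `∇G`, `C` a bound of the second moments of `Φ`, and `κ` a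
coercivity constant of both `D` and `T`. -/
structure PreconditionedDescent (P : Measure Ω) (ν : Measure 𝓧) (ℱ : Filtration ℕ mΩ) (c : ℝ)
    (G : Vec d → ℝ) (θ : Vec d) (Φ : 𝓧 → Vec d → Vec d) (X : ℕ → Ω → 𝓧)
    (K : ℕ → Ω → Vec d →L[ℝ] Vec d) (θs : ℕ → Ω → Vec d) (D T : Vec d →L[ℝ] Vec d)
    (L C κ : ℝ) : Prop where
  c_nonneg : 0 ≤ c
  L_pos : 0 < L
  C_nonneg : 0 ≤ C
  κ_pos : 0 < κ
  convex : ConvexOn ℝ Set.univ G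
  differentiable : Differentiable ℝ G
  lipschitz : ∀ x y, ‖∇ G x - ∇ G y‖ ≤ L * ‖x - y‖
  gradient_eq_zero : ∇ G θ = 0
  hasFDerivAt : HasFDerivAt (∇ G) D θ
  coercive_D : ∀ v, 2 * κ * ‖v‖ ^ 2 ≤ ⟪v, D v⟫
  coercive_T : ∀ v, 2 * κ * ‖v‖ ^ 2 ≤ ⟪v, T v⟫
  inverse : ∀ v, T (D v) = v
  measurable_oracle : Measurable (Function.uncurry Φ)
  unbiased : ∀ h, Integrable (fun x => Φ x h) ν ∧ ∫ x, Φ x h ∂ν = ∇ G h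
  second_moment : ∀ h, ∫⁻ x, ‖Φ x h‖ₑ ^ 2 ∂ν ≤ ENNReal.ofReal (C * (1 + (G h - G θ)))
  measurable_data : ∀ n, Measurable (X (n + 1))
  law : ∀ n, P.map (X (n + 1)) = ν
  indep : ∀ n, Indep (MeasurableSpace.comap (X (n + 1)) inferInstance) (ℱ n) P
  measurable_iterate : ∀ n, Measurable[ℱ n] (θs n)
  measurable_precond : ∀ n, Measurable[ℱ n] (K n)
  step : ∀ᵐ ω ∂P, ∀ n, θs (n + 1) ω = θs n ω - gain c n • K n ω (Φ (X (n + 1) ω) (θs n ω))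
  tendsto_precond : ∀ᵐ ω ∂P, Tendsto (fun n => K n ω) atTop (𝓝 T)

theorem gain_pos {c : ℝ} (hc : 0 ≤ c) (n : ℕ) : 0 < gain c n := by
  unfold gain; positivity

theorem gain_le {c : ℝ} (hc : 0 ≤ c) (n : ℕ) : gain c n ≤ 1 / ((n : ℝ) + 1) := by
  exact one_div_le_one_div_of_le (by positivity) (by linarith)

theorem summable_gain_sq {c : ℝ} (hc : 0 ≤ c) : Summable (fun n => gain c n ^ 2) := by
  have h : Summable (fun n : ℕ => 1 / ((n : ℝ) + 1) ^ 2) := by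
    have := (summable_nat_add_iff 1).2 (Real.summable_one_div_nat_pow.2 one_lt_two)
    simpa using this
  refine Summable.of_nonneg_of_le (fun n => sq_nonneg _) (fun n => ?_) h
  calc gain c n ^ 2 ≤ (1 / ((n : ℝ) + 1)) ^ 2 :=
        pow_le_pow_left₀ (gain_pos hc n).le (gain_le hc n) 2
    _ = _ := by rw [div_pow, one_pow]

theorem not_summable_gain {c : ℝ} (hc : 0 ≤ c) : ¬ Summable (gain c) := by
  intro h
  refine Real.not_summable_one_div_natCast ?_
  refine Summable.of_nonneg_of_le (fun n => by positivity) (fun n => ?_) (h.mul_left (2 + c))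
  rcases Nat.eq_zero_or_pos n with rfl | hn
  · simpa using mul_nonneg (by linarith) (gain_pos hc 0).le
  · have hn1 : (1 : ℝ) ≤ n := by exact_mod_cast hn
    unfold gain
    rw [mul_one_div, div_le_div_iff₀ (by positivity) (by positivity)]
    nlinarith

/-- One step of preconditioned stochastic descent from `h`, seen through a nonnegative function `f`
with a quadratic upper bound at `h`. -/
theorem lintegral_step_le {ν : Measure 𝓧} [IsProbabilityMeasure ν] {φ : 𝓧 → Vec d} {γ h p : Vec d}
    (hint : Integrable φ ν) (hmean : ∫ x, φ x ∂ν = γ) {M : ℝ} (hM : 0 ≤ M)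
    (hsq : ∫⁻ x, ‖φ x‖ₑ ^ 2 ∂ν ≤ ENNReal.ofReal M) {f : Vec d → ℝ} (hf0 : ∀ y, 0 ≤ f y) {Λ : ℝ}
    (hΛ : 0 ≤ Λ) (hf : ∀ y, f y ≤ f h + ⟪p, y - h⟫ + Λ * ‖y - h‖ ^ 2) (a : ℝ)
    (k : Vec d →L[ℝ] Vec d) :
    0 ≤ f h - a * ⟪p, k γ⟫ + Λ * (a ^ 2 * (‖k‖ ^ 2 * M)) ∧
    ∫⁻ x, ENNReal.ofReal (f (h - a • k (φ x))) ∂ν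
      ≤ ENNReal.ofReal (f h - a * ⟪p, k γ⟫ + Λ * (a ^ 2 * (‖k‖ ^ 2 * M))) := by
  have hsqi : Integrable (fun x => ‖φ x‖ ^ 2) ν := by
    refine ⟨(hint.1.norm.pow 2), ?_⟩
    rw [hasFiniteIntegral_iff_ofReal (Eventually.of_forall fun x => by positivity)]
    refine lt_of_le_of_lt (le_of_eq ?_) (hsq.trans_lt ENNReal.ofReal_lt_top)
    refine lintegral_congr fun x => ?_
    rw [ENNReal.ofReal_pow (norm_nonneg _), ofReal_norm]
  have hsqM : ∫ x, ‖φ x‖ ^ 2 ∂ν ≤ M := by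
    rw [← ENNReal.ofReal_le_ofReal_iff hM,
      ofReal_integral_eq_lintegral_ofReal hsqi (Eventually.of_forall fun x => by positivity)]
    refine le_trans (le_of_eq ?_) hsq
    refine lintegral_congr fun x => ?_
    rw [ENNReal.ofReal_pow (norm_nonneg _), ofReal_norm]
  set R : 𝓧 → ℝ := fun x => f h - a * ⟪p, k (φ x)⟫ + Λ * (a ^ 2 * (‖k‖ ^ 2 * ‖φ x‖ ^ 2)) with hR
  have hfR : ∀ x, f (h - a • k (φ x)) ≤ R x := by
    intro x
    refine (hf _).trans ?_
    have e : h - a • k (φ x) - h = -(a • k (φ x)) := by abel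
    rw [e, inner_neg_right, inner_smul_right, norm_neg, norm_smul, mul_pow, Real.norm_eq_abs,
      sq_abs]
    have h1 : ‖k (φ x)‖ ^ 2 ≤ ‖k‖ ^ 2 * ‖φ x‖ ^ 2 := by
      rw [← mul_pow]; exact pow_le_pow_left₀ (norm_nonneg _) (k.le_opNorm _) 2
    have h2 : Λ * (a ^ 2 * ‖k (φ x)‖ ^ 2) ≤ Λ * (a ^ 2 * (‖k‖ ^ 2 * ‖φ x‖ ^ 2)) := by gcongr
    simp only [hR]; linarith
  have hki : Integrable (fun x => ⟪p, k (φ x)⟫) ν := (k.integrable_comp hint).const_inner p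
  have hRi : Integrable R ν :=
    ((integrable_const _).sub (hki.const_mul a)).add
      (((hsqi.const_mul _).const_mul _).const_mul _)
  have hR0 : ∀ x, 0 ≤ R x := fun x => (hf0 _).trans (hfR x)
  have hRint : ∫ x, R x ∂ν ≤ f h - a * ⟪p, k γ⟫ + Λ * (a ^ 2 * (‖k‖ ^ 2 * M)) := by
    have e1 : ∫ x, R x ∂ν
        = f h - a * ⟪p, k γ⟫ + Λ * (a ^ 2 * (‖k‖ ^ 2 * ∫ x, ‖φ x‖ ^ 2 ∂ν)) := by
      simp only [hR]
      rw [integral_add, integral_sub, integral_const_mul, integral_const_mul, integral_const_mul,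
        integral_const_mul, integral_inner (k.integrable_comp hint),
        ContinuousLinearMap.integral_comp_comm k hint, hmean]
      · simp
      · exact integrable_const _
      · exact hki.const_mul a
      · exact (integrable_const _).sub (hki.const_mul a)
      · exact ((hsqi.const_mul _).const_mul _).const_mul _
    rw [e1]; gcongr
  refine ⟨(integral_nonneg hR0).trans hRint, ?_⟩
  calc ∫⁻ x, ENNReal.ofReal (f (h - a • k (φ x))) ∂ν ≤ ∫⁻ x, ENNReal.ofReal (R x) ∂ν :=
        lintegral_mono fun x => ENNReal.ofReal_le_ofReal (hfR x)
    _ = ENNReal.ofReal (∫ x, R x ∂ν) :=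
        (ofReal_integral_eq_lintegral_ofReal hRi (Eventually.of_forall hR0)).symm
    _ ≤ _ := ENNReal.ofReal_le_ofReal hRint

theorem measurable_clm_apply :
    Measurable fun q : (Vec d →L[ℝ] Vec d) × Vec d => q.1 q.2 := by
  have : Continuous fun q : (Vec d →L[ℝ] Vec d) × Vec d => q.1 q.2 := by fun_prop
  exact this.measurable

theorem measurable_descent_step {Φ : 𝓧 → Vec d → Vec d} (hΦ : Measurable (Function.uncurry Φ))
    (a : ℝ) : Measurable fun q : 𝓧 × (Vec d × (Vec d →L[ℝ] Vec d)) =>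
      q.2.1 - a • q.2.2 (Φ q.1 q.2.1) := by
  have h0 : Measurable fun q : 𝓧 × (Vec d × (Vec d →L[ℝ] Vec d)) => q.2.1 :=
    measurable_fst.comp measurable_snd
  have h1 : Measurable fun q : 𝓧 × (Vec d × (Vec d →L[ℝ] Vec d)) => Φ q.1 q.2.1 :=
    hΦ.comp (measurable_fst.prodMk h0)
  have h2 : Measurable fun q : 𝓧 × (Vec d × (Vec d →L[ℝ] Vec d)) => q.2.2 :=
    measurable_snd.comp measurable_snd
  have h3 : Measurable fun q : 𝓧 × (Vec d × (Vec d →L[ℝ] Vec d)) => q.2.2 (Φ q.1 q.2.1) :=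
    measurable_clm_apply.comp (h2.prodMk h1)
  exact h0.sub (h3.const_smul a)

namespace PreconditionedDescent

variable {P : Measure Ω} {ν : Measure 𝓧}
  {ℱ : Filtration ℕ mΩ} {c : ℝ} {G : Vec d → ℝ} {θ : Vec d} {Φ : 𝓧 → Vec d → Vec d}
  {X : ℕ → Ω → 𝓧} {K : ℕ → Ω → Vec d →L[ℝ] Vec d} {θs : ℕ → Ω → Vec d}
  {D T : Vec d →L[ℝ] Vec d} {L C κ : ℝ}

theorem excess_nonneg (S : PreconditionedDescent P ν ℱ c G θ Φ X K θs D T L C κ) (h : Vec d) :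
    0 ≤ G h - G θ :=
  sub_nonneg.2 (isMinimum_of_gradient_eq_zero S.convex S.differentiable S.gradient_eq_zero h)

theorem continuous_gradient (S : PreconditionedDescent P ν ℱ c G θ Φ X K θs D T L C κ) :
    Continuous (∇ G) :=
  (LipschitzWith.of_dist_le_mul (K := ⟨L, S.L_pos.le⟩) fun x y => by
    rw [dist_eq_norm, dist_eq_norm]; exact S.lipschitz x y).continuous

theorem excess_le (S : PreconditionedDescent P ν ℱ c G θ Φ X K θs D T L C κ) (h : Vec d) :
    G h - G θ ≤ L * ‖h - θ‖ ^ 2 := by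
  have := descent_ineq S.differentiable S.L_pos.le S.lipschitz θ h
  rw [S.gradient_eq_zero, inner_zero_left] at this
  linarith

theorem norm_gradient_le (S : PreconditionedDescent P ν ℱ c G θ Φ X K θs D T L C κ) (h : Vec d) :
    ‖∇ G h‖ ≤ L * ‖h - θ‖ := by
  simpa [S.gradient_eq_zero] using S.lipschitz h θ

theorem mul_sq_norm_le_inner (S : PreconditionedDescent P ν ℱ c G θ Φ X K θs D T L C κ)
    {k : Vec d →L[ℝ] Vec d} (hk : ‖k - T‖ ≤ κ) (v : Vec d) : κ * ‖v‖ ^ 2 ≤ ⟪v, k v⟫ := by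
  have h1 : ⟪v, k v⟫ = ⟪v, T v⟫ + ⟪v, (k - T) v⟫ := by
    rw [← inner_add_right]; simp
  have h2 := (abs_le.1 ((abs_real_inner_le_norm v ((k - T) v)).trans
    (mul_le_mul_of_nonneg_left (((k - T).le_opNorm v).trans
      (mul_le_mul_of_nonneg_right hk (norm_nonneg v))) (norm_nonneg v)))).1
  have h3 := S.coercive_T v
  rw [h1]; nlinarith

theorem norm_le_of_norm_sub_le {k : Vec d →L[ℝ] Vec d} (hk : ‖k - T‖ ≤ κ) : ‖k‖ ≤ ‖T‖ + κ := by
  have := norm_add_le T (k - T)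
  rw [add_sub_cancel] at this
  linarith

theorem eventually_norm_sub_le (S : PreconditionedDescent P ν ℱ c G θ Φ X K θs D T L C κ) :
    ∀ᵐ ω ∂P, ∀ᶠ n in atTop, ‖K n ω - T‖ ≤ κ := by
  filter_upwards [S.tendsto_precond] with ω hω
  have := (tendsto_iff_norm_sub_tendsto_zero.1 hω).eventually (gt_mem_nhds S.κ_pos)
  filter_upwards [this] with n hn using le_of_lt hn

theorem measurableSet_norm_sub_le (S : PreconditionedDescent P ν ℱ c G θ Φ X K θs D T L C κ)
    (n : ℕ) : MeasurableSet[ℱ n] {ω | ‖K n ω - T‖ ≤ κ} :=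
  measurableSet_le ((measurable_norm.comp (measurable_id.sub_const T)).comp
    (S.measurable_precond n)) measurable_const

variable [IsProbabilityMeasure P] [IsProbabilityMeasure ν]

/-- The drift inequality of the algorithm on an event `A` of the past, for a nonnegative function
`f` of the iterate that has quadratic upper bounds. -/
theorem setLIntegral_step_le (S : PreconditionedDescent P ν ℱ c G θ Φ X K θs D T L C κ) (n : ℕ)
    {A : Set Ω} (hA : MeasurableSet[ℱ n] A) {f : Vec d → ℝ} (hfm : Measurable f)
    (hf0 : ∀ y, 0 ≤ f y) {p : Vec d → Vec d} {Λ : ℝ} (hΛ : 0 ≤ Λ)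
    (hf : ∀ h y, f y ≤ f h + ⟪p h, y - h⟫ + Λ * ‖y - h‖ ^ 2) {ψ u : Ω → ℝ}
    (hψm : Measurable[ℱ n] ψ) (hum : Measurable[ℱ n] u)
    (hψ0 : ∀ ω, 0 ≤ ψ ω) (hu0 : ∀ ω, 0 ≤ u ω) {α β : ℝ} (hα : 0 ≤ α) (hβ : 0 ≤ β)
    (hbound : ∀ ω ∈ A, f (θs n ω) - gain c n * ⟪p (θs n ω), K n ω (∇ G (θs n ω))⟫
      + Λ * (gain c n ^ 2 * (‖K n ω‖ ^ 2 * (C * (1 + (G (θs n ω) - G θ))))) + ψ ω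
      ≤ (1 + α) * u ω + β) :
    ∫⁻ ω in A, ENNReal.ofReal (f (θs (n + 1) ω)) ∂P + ∫⁻ ω in A, ENNReal.ofReal (ψ ω) ∂P
      ≤ ENNReal.ofReal (1 + α) * ∫⁻ ω in A, ENNReal.ofReal (u ω) ∂P + ENNReal.ofReal β * P A := by
  have hA' : MeasurableSet A := ℱ.le n _ hA
  have hψm' : Measurable ψ := hψm.mono (ℱ.le n) le_rfl
  have hum' : Measurable u := hum.mono (ℱ.le n) le_rfl
  have hF : Measurable (Function.uncurry fun (x : 𝓧) (z : Vec d × (Vec d →L[ℝ] Vec d)) =>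
      ENNReal.ofReal (f (z.1 - gain c n • z.2 (Φ x z.1)))) := by
    exact (hfm.comp (measurable_descent_step S.measurable_oracle (gain c n))).ennreal_ofReal
  have hfreeze := setLIntegral_comp_eq_of_indep (ℱ.le n) (S.measurable_data n) (S.law n)
    (S.indep n) ((S.measurable_iterate n).prodMk (S.measurable_precond n)) hA hF
  have hstep : ∫⁻ ω in A, ENNReal.ofReal (f (θs (n + 1) ω)) ∂P
      = ∫⁻ ω in A, ∫⁻ x, ENNReal.ofReal
          (f (θs n ω - gain c n • K n ω (Φ x (θs n ω)))) ∂ν ∂P := by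
    rw [← hfreeze]
    refine lintegral_congr_ae (ae_restrict_of_ae ?_)
    filter_upwards [S.step] with ω hω
    rw [hω n]
  rw [hstep, ← lintegral_add_right _ hψm'.ennreal_ofReal,
    ← lintegral_const_mul _ hum'.ennreal_ofReal, ← setLIntegral_const,
    ← lintegral_add_right _ measurable_const]
  refine setLIntegral_mono ((hum'.ennreal_ofReal.const_mul _).add measurable_const) fun ω hω => ?_
  have hM : 0 ≤ C * (1 + (G (θs n ω) - G θ)) :=
    mul_nonneg S.C_nonneg (by linarith [S.excess_nonneg (θs n ω)])
  obtain ⟨h0, h1⟩ := lintegral_step_le (S.unbiased (θs n ω)).1 (S.unbiased (θs n ω)).2 hM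
    (S.second_moment (θs n ω)) hf0 hΛ (hf (θs n ω)) (gain c n) (K n ω)
  calc _ ≤ _ := add_le_add_left h1 _
    _ = _ := (ENNReal.ofReal_add h0 (hψ0 ω)).symm
    _ ≤ ENNReal.ofReal ((1 + α) * u ω + β) := ENNReal.ofReal_le_ofReal (hbound ω hω)
    _ = _ := by
      rw [ENNReal.ofReal_add (mul_nonneg (by linarith) (hu0 ω)) hβ,
        ENNReal.ofReal_mul (by linarith)]

/-- Almost surely the excess risk converges, and the squared gradients along the trajectory are
summable against the step sizes. -/
theorem ae_tendsto_excess (S : PreconditionedDescent P ν ℱ c G θ Φ X K θs D T L C κ) :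
    ∀ᵐ ω ∂P, (∃ l, Tendsto (fun n => G (θs n ω) - G θ) atTop (𝓝 l)) ∧
      Summable (fun n => gain c n * (κ * ‖∇ G (θs n ω)‖ ^ 2)) := by
  set m : ℝ := ‖T‖ + κ with hm
  have hm0 : 0 ≤ m := add_nonneg (norm_nonneg _) S.κ_pos.le
  have hV : Measurable fun h : Vec d => G h - G θ :=
    (S.differentiable.continuous.sub continuous_const).measurable
  have hψ : Measurable fun h : Vec d => κ * ‖∇ G h‖ ^ 2 :=
    (continuous_const.mul (S.continuous_gradient.norm.pow 2)).measurable
  have hγ0 : ∀ n : ℕ, 0 ≤ L * m ^ 2 * C * gain c n ^ 2 := fun n => by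
    have := S.L_pos; have := S.C_nonneg; positivity
  refine robbinsSiegmund (ℱ := ℱ) (B := fun n => {ω | ‖K n ω - T‖ ≤ κ})
    (α := fun n => L * m ^ 2 * C * gain c n ^ 2) (β := fun n => L * m ^ 2 * C * gain c n ^ 2)
    (fun n ω => S.excess_nonneg _)
    (fun n ω => mul_nonneg (gain_pos S.c_nonneg n).le (mul_nonneg S.κ_pos.le (sq_nonneg _)))
    (fun n => hV.comp (S.measurable_iterate n))
    (fun n => (hψ.comp (S.measurable_iterate n)).const_mul _)
    hγ0 ((summable_gain_sq S.c_nonneg).mul_left _) hγ0 ((summable_gain_sq S.c_nonneg).mul_left _)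
    S.measurableSet_norm_sub_le S.eventually_norm_sub_le
    (Eventually.of_forall fun n A hA hAB => ?_)
  refine S.setLIntegral_step_le n hA hV S.excess_nonneg (p := ∇ G) S.L_pos.le
    (fun h y => by
      have := descent_ineq S.differentiable S.L_pos.le S.lipschitz h y
      linarith)
    ((hψ.comp (S.measurable_iterate n)).const_mul _) (hV.comp (S.measurable_iterate n))
    (fun ω => mul_nonneg (gain_pos S.c_nonneg n).le (mul_nonneg S.κ_pos.le (sq_nonneg _)))
    (fun ω => S.excess_nonneg _) (hγ0 n) (hγ0 n) fun ω hω => ?_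
  have hk := hAB hω
  have h1 := mul_le_mul_of_nonneg_left (S.mul_sq_norm_le_inner hk (∇ G (θs n ω)))
    (gain_pos S.c_nonneg n).le
  have hkm : ‖K n ω‖ ^ 2 ≤ m ^ 2 := pow_le_pow_left₀ (norm_nonneg _) (norm_le_of_norm_sub_le hk) 2
  have hV0 := S.excess_nonneg (θs n ω)
  have h2 : L * (gain c n ^ 2 * (‖K n ω‖ ^ 2 * (C * (1 + (G (θs n ω) - G θ)))))
      ≤ L * (gain c n ^ 2 * (m ^ 2 * (C * (1 + (G (θs n ω) - G θ))))) := by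
    have := S.L_pos
    have : 0 ≤ C * (1 + (G (θs n ω) - G θ)) := mul_nonneg S.C_nonneg (by linarith)
    gcongr
  simp only [Function.comp_apply]
  nlinarith

/-- The iterates are strongly consistent. -/
theorem ae_tendsto_iterate (S : PreconditionedDescent P ν ℱ c G θ Φ X K θs D T L C κ) :
    ∀ᵐ ω ∂P, Tendsto (fun n => θs n ω) atTop (𝓝 θ) := by
  obtain ⟨ρ, hρ, hlow⟩ := exists_gradient_lower_bound S.convex S.differentiable S.gradient_eq_zero
    S.hasFDerivAt S.κ_pos S.coercive_D
  have hκ := S.κ_pos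
  filter_upwards [S.ae_tendsto_excess] with ω ⟨⟨l, hl⟩, hs⟩
  -- The step sizes are not summable, so the gradient is small infinitely often.
  have hfreq : ∀ ε : ℝ, 0 < ε → ∃ᶠ n in atTop, ‖∇ G (θs n ω)‖ < ε := by
    intro ε hε hnot
    refine not_summable_gain S.c_nonneg ?_
    have hev : ∀ᶠ n in atTop, ε ≤ ‖∇ G (θs n ω)‖ := hnot.mono fun n hn => not_lt.1 hn
    refine (hs.mul_left (κ * ε ^ 2)⁻¹).of_norm_bounded_eventually_nat ?_
    filter_upwards [hev] with n hn
    rw [Real.norm_of_nonneg (gain_pos S.c_nonneg n).le]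
    have h1 : κ * ε ^ 2 ≤ κ * ‖∇ G (θs n ω)‖ ^ 2 := by gcongr
    have h2 := mul_le_mul_of_nonneg_left h1 (gain_pos S.c_nonneg n).le
    rw [inv_mul_eq_div, le_div_iff₀ (by positivity)]
    exact h2
  have hl0 : l = 0 := by
    refine le_antisymm (not_lt.1 fun hlpos => ?_)
      (ge_of_tendsto hl (Eventually.of_forall fun n => S.excess_nonneg _))
    have hL := S.L_pos
    -- Where the iterate is at distance at most `r`, the excess risk is at most `l / 2`.
    set r := min (ρ / 2) (Real.sqrt (l / (2 * L))) with hr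
    have hr0 : 0 < r := lt_min (by positivity) (Real.sqrt_pos.2 (by positivity))
    obtain ⟨n, hn1, hn2⟩ := ((hfreq (κ * r) (by positivity)).and_eventually
      (hl.eventually (lt_mem_nhds (half_lt_self hlpos)))).exists
    have h1 : min ‖θs n ω - θ‖ ρ < r := lt_of_mul_lt_mul_left ((hlow _).trans_lt hn1) hκ.le
    have h2 : ‖θs n ω - θ‖ < r := by
      rcases min_lt_iff.1 h1 with h | h
      · exact h
      · have := min_le_left (ρ / 2) (Real.sqrt (l / (2 * L)))
        linarith
    have h3 : ‖θs n ω - θ‖ ^ 2 ≤ l / (2 * L) := by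
      have := (h2.trans_le (min_le_right _ _)).le
      calc _ ≤ Real.sqrt (l / (2 * L)) ^ 2 := pow_le_pow_left₀ (norm_nonneg _) this 2
        _ = _ := Real.sq_sqrt (by positivity)
    have h4 := (S.excess_le (θs n ω)).trans (mul_le_mul_of_nonneg_left h3 hL.le)
    have h5 : L * (l / (2 * L)) = l / 2 := by field_simp
    linarith
  rw [hl0] at hl
  have hgrad : Tendsto (fun n => ‖∇ G (θs n ω)‖ ^ 2) atTop (𝓝 0) := by
    refine squeeze_zero (fun n => sq_nonneg _) (fun n => sq_norm_gradient_le S.convex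
      S.differentiable S.L_pos S.lipschitz S.gradient_eq_zero _) ?_
    simpa using hl.const_mul (4 * L)
  rw [Metric.tendsto_atTop']
  intro ε hε
  have hmin : 0 < min ε ρ := lt_min hε hρ
  have hev := hgrad.eventually (gt_mem_nhds (show (0 : ℝ) < (κ * min ε ρ) ^ 2 by positivity))
  obtain ⟨N, hN⟩ := eventually_atTop.1 hev
  refine ⟨N, fun n hn => ?_⟩
  have h1 := lt_of_pow_lt_pow_left₀ 2 (by positivity) (hN n hn.le)
  have h2 : min ‖θs n ω - θ‖ ρ < min ε ρ :=
    lt_of_mul_lt_mul_left ((hlow _).trans_lt h1) hκ.le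
  rw [dist_eq_norm]
  rcases min_lt_iff.1 h2 with h | h
  · exact h.trans_le (min_le_left _ _)
  · exact absurd (h.trans_le (min_le_right _ _)) (lt_irrefl _)

end PreconditionedDescent
end Model

/-! ### The rate of convergence under second moments -/

section LogWeights
open scoped RealInnerProductSpace

theorem summable_one_div_mul_log_rpow {δ : ℝ} (hδ : 0 < δ) :
    Summable (fun n : ℕ => 1 / ((n : ℝ) * Real.log ((n : ℝ) + 1) ^ (1 + δ))) := by
  have hlog : ∀ n : ℕ, 0 ≤ Real.log ((n : ℝ) + 1) := fun n =>
    Real.log_nonneg (by linarith [(Nat.cast_nonneg n : (0 : ℝ) ≤ n)])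
  refine (summable_condensed_iff_of_nonneg
    (fun n => by have := Real.rpow_nonneg (hlog n) (1 + δ); positivity) ?_).1 ?_
  · intro m n hm hmn
    have hm' : (0 : ℝ) < m := by exact_mod_cast hm
    have hmn' : (m : ℝ) ≤ n := by exact_mod_cast hmn
    have hlm : 0 < Real.log ((m : ℝ) + 1) := Real.log_pos (by linarith)
    have h1 : Real.log ((m : ℝ) + 1) ^ (1 + δ) ≤ Real.log ((n : ℝ) + 1) ^ (1 + δ) :=
      Real.rpow_le_rpow hlm.le (Real.log_le_log (by linarith) (by linarith)) (by linarith)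
    have h2 : 0 < Real.log ((m : ℝ) + 1) ^ (1 + δ) := Real.rpow_pos_of_pos hlm _
    exact one_div_le_one_div_of_le (by positivity) (by gcongr)
  · have hs : Summable (fun k : ℕ => (Real.log 2 ^ (1 + δ))⁻¹ * (1 / (k : ℝ) ^ (1 + δ))) :=
      (Real.summable_one_div_nat_rpow.2 (by linarith)).mul_left _
    refine hs.of_norm_bounded_eventually_nat ?_
    filter_upwards [eventually_ge_atTop 1] with k hk
    have hk' : (0 : ℝ) < k := by exact_mod_cast hk
    have hl2 : 0 < Real.log 2 := Real.log_pos one_lt_two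
    have h1 : (k : ℝ) * Real.log 2 ≤ Real.log ((2 : ℝ) ^ k + 1) := by
      rw [← Real.log_pow]
      exact Real.log_le_log (by positivity) (by linarith)
    have h2 : Real.log 2 ^ (1 + δ) * (k : ℝ) ^ (1 + δ) ≤ Real.log ((2 : ℝ) ^ k + 1) ^ (1 + δ) := by
      rw [← Real.mul_rpow hl2.le hk'.le, mul_comm]
      exact Real.rpow_le_rpow (by positivity) h1 (by linarith)
    have h3 : 0 < Real.log 2 ^ (1 + δ) * (k : ℝ) ^ (1 + δ) := by positivity
    have h4 : 0 < Real.log ((2 : ℝ) ^ k + 1) ^ (1 + δ) := h3.trans_le h2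
    push_cast
    rw [Real.norm_of_nonneg (by positivity), inv_eq_one_div, ← one_div_mul_one_div_rev,
      mul_left_comm, mul_one_div_cancel (by positivity), mul_one, one_div_mul_one_div]
    exact one_div_le_one_div_of_le h3 h2

/-- The weight `n / (log n) ^ (1 + δ)`. -/
def weight (δ : ℝ) (n : ℕ) : ℝ := (n : ℝ) / Real.log n ^ (1 + δ)

theorem weight_nonneg (δ : ℝ) (n : ℕ) : 0 ≤ weight δ n :=
  div_nonneg (Nat.cast_nonneg n) (Real.rpow_nonneg (Real.log_natCast_nonneg n) _)

theorem weight_succ_le {δ : ℝ} (hδ : 0 < δ) {n : ℕ} (hn : 2 ≤ n) :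
    weight δ (n + 1) ≤ (1 + 1 / (n : ℝ)) * weight δ n := by
  have hn' : (2 : ℝ) ≤ n := by exact_mod_cast hn
  have hl : 0 < Real.log n := Real.log_pos (by linarith)
  have h0 : 0 < Real.log n ^ (1 + δ) := Real.rpow_pos_of_pos hl _
  have h1 : Real.log n ^ (1 + δ) ≤ Real.log ((n : ℝ) + 1) ^ (1 + δ) :=
    Real.rpow_le_rpow hl.le (Real.log_le_log (by linarith) (by linarith)) (by linarith)
  unfold weight
  push_cast
  calc ((n : ℝ) + 1) / Real.log ((n : ℝ) + 1) ^ (1 + δ) ≤ ((n : ℝ) + 1) / Real.log n ^ (1 + δ) := by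
        gcongr
    _ = _ := by field_simp

/-- The one-step inequality for the weighted squared distance: once the residual of the Newton step
is at most an eighth of the distance, the contraction by the factor `1 - 7 / 4 * gain c n`
beats the growth of the weight. -/
theorem weight_step_le {E : Type*} [NormedAddCommGroup E] [InnerProductSpace ℝ E] {c δ : ℝ}
    (hc : 0 ≤ c) (hδ : 0 < δ) {n : ℕ} (hn2 : 2 ≤ n) (hn6 : 6 + 6 * c ≤ n) {u γ : E}
    (hr : ‖u - γ‖ ≤ 1 / 8 * ‖u‖) {M q : ℝ} (hM0 : 0 ≤ M) (hqM : q ≤ M) :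
    weight δ (n + 1) * ‖u‖ ^ 2 - gain c n * ⟪(2 * weight δ (n + 1)) • u, γ⟫
      + weight δ (n + 1) * (gain c n ^ 2 * q) + 1 / (2 * (n : ℝ)) * (weight δ n * ‖u‖ ^ 2)
      ≤ (1 + 0) * (weight δ n * ‖u‖ ^ 2)
        + M * (1 / ((n : ℝ) * Real.log ((n : ℝ) + 1) ^ (1 + δ))) := by
  have hn2' : (2 : ℝ) ≤ n := by exact_mod_cast hn2
  have hw := weight_nonneg δ n
  have hw1 := weight_nonneg δ (n + 1)
  have hlog : 0 < Real.log ((n : ℝ) + 1) := Real.log_pos (by linarith)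
  have hlogr : 0 < Real.log ((n : ℝ) + 1) ^ (1 + δ) := Real.rpow_pos_of_pos hlog _
  set a := gain c n with ha
  have ha0 : 0 < a := gain_pos hc n
  have hinner : 7 / 8 * ‖u‖ ^ 2 ≤ ⟪u, γ⟫ := by
    have e : ⟪u, γ⟫ = ‖u‖ ^ 2 - ⟪u, u - γ⟫ := by
      rw [inner_sub_right, real_inner_self_eq_norm_sq]; ring
    have h1 := (real_inner_le_norm u (u - γ)).trans
      (mul_le_mul_of_nonneg_left hr (norm_nonneg _))
    rw [e]; nlinarith
  have ha1 : a ≤ 1 / ((n : ℝ) + 1) := gain_le hc n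
  -- For `n` large the step size is close to `1 / n`.
  have ha2 : 6 / (7 * (n : ℝ)) ≤ a := by
    rw [ha, gain, div_le_div_iff₀ (by positivity) (by positivity)]
    linarith
  have hvar : weight δ (n + 1) * (a ^ 2 * q)
      ≤ M * (1 / ((n : ℝ) * Real.log ((n : ℝ) + 1) ^ (1 + δ))) := by
    have h1 : weight δ (n + 1) * a ^ 2
        ≤ 1 / ((n : ℝ) * Real.log ((n : ℝ) + 1) ^ (1 + δ)) := by
      have h2 : a ^ 2 ≤ (1 / ((n : ℝ) + 1)) ^ 2 := pow_le_pow_left₀ ha0.le ha1 2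
      calc weight δ (n + 1) * a ^ 2 ≤ weight δ (n + 1) * (1 / ((n : ℝ) + 1)) ^ 2 := by gcongr
        _ = 1 / (((n : ℝ) + 1) * Real.log ((n : ℝ) + 1) ^ (1 + δ)) := by
          unfold weight; push_cast; field_simp
        _ ≤ _ := one_div_le_one_div_of_le (by positivity) (by gcongr; linarith)
    calc _ ≤ weight δ (n + 1) * (a ^ 2 * M) := by gcongr
      _ = M * (weight δ (n + 1) * a ^ 2) := by ring
      _ ≤ _ := by gcongr
  have hmainpart : weight δ (n + 1) * (‖u‖ ^ 2 - 2 * (a * ⟪u, γ⟫))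
      + 1 / (2 * (n : ℝ)) * (weight δ n * ‖u‖ ^ 2) ≤ weight δ n * ‖u‖ ^ 2 := by
    have h1 : ‖u‖ ^ 2 - 2 * (a * ⟪u, γ⟫) ≤ (1 - 3 / 2 * (1 / (n : ℝ))) * ‖u‖ ^ 2 := by
      have h2 : 6 / (7 * (n : ℝ)) * (7 / 8 * ‖u‖ ^ 2) ≤ a * ⟪u, γ⟫ :=
        mul_le_mul ha2 hinner (by positivity) ha0.le
      have h3 : 6 / (7 * (n : ℝ)) * (7 / 8 * ‖u‖ ^ 2) = 3 / 4 * (1 / (n : ℝ)) * ‖u‖ ^ 2 := by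
        field_simp; ring
      rw [h3] at h2; linarith
    have hninv : 1 / (n : ℝ) ≤ 1 / 2 := one_div_le_one_div_of_le (by norm_num) hn2'
    have hninv0 : 0 ≤ 1 / (n : ℝ) := by positivity
    have h4 : weight δ (n + 1) * (‖u‖ ^ 2 - 2 * (a * ⟪u, γ⟫))
        ≤ ((1 + 1 / (n : ℝ)) * weight δ n) * ((1 - 3 / 2 * (1 / (n : ℝ))) * ‖u‖ ^ 2) := by
      calc _ ≤ weight δ (n + 1) * ((1 - 3 / 2 * (1 / (n : ℝ))) * ‖u‖ ^ 2) := by gcongr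
        _ ≤ _ := mul_le_mul_of_nonneg_right (weight_succ_le hδ hn2)
          (mul_nonneg (by linarith) (sq_nonneg _))
    have h5 : 1 / (2 * (n : ℝ)) = 1 / 2 * (1 / (n : ℝ)) := by field_simp
    rw [h5]
    have h6 : 0 ≤ weight δ n * ‖u‖ ^ 2 := by positivity
    nlinarith [mul_nonneg (mul_nonneg hninv0 hninv0) h6]
  rw [inner_smul_left]
  simp only [conj_trivial]
  nlinarith [hvar, hmainpart]

end LogWeights

section Rate
open scoped RealInnerProductSpace

variable {Ω 𝓧 : Type*} {mΩ : MeasurableSpace Ω} [MeasurableSpace 𝓧] {d : ℕ}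

theorem measurable_norm_sub_clm_apply {S : Type*} [MeasurableSpace S] {G : Vec d → ℝ} {θ : Vec d} {k : S → Vec d →L[ℝ] Vec d}
    {z : S → Vec d} (hG : Measurable (∇ G)) (hk : Measurable k) (hz : Measurable z) :
    Measurable fun s => ‖(z s - θ) - k s (∇ G (z s))‖ := by
  have h1 : Measurable fun s => ∇ G (z s) := hG.comp hz
  have h2 : Measurable fun s => k s (∇ G (z s)) := measurable_clm_apply.comp (hk.prodMk h1)
  exact ((hz.sub_const θ).sub h2).norm

namespace PreconditionedDescent

variable {P : Measure Ω} {ν : Measure 𝓧}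
  {ℱ : Filtration ℕ mΩ} {c : ℝ} {G : Vec d → ℝ} {θ : Vec d} {Φ : 𝓧 → Vec d → Vec d}
  {X : ℕ → Ω → 𝓧} {K : ℕ → Ω → Vec d →L[ℝ] Vec d} {θs : ℕ → Ω → Vec d}
  {D T : Vec d →L[ℝ] Vec d} {L C κ : ℝ}

theorem measurable_sq_dist (S : PreconditionedDescent P ν ℱ c G θ Φ X K θs D T L C κ) (n : ℕ) :
    Measurable[ℱ n] fun ω => ‖θs n ω - θ‖ ^ 2 :=
  ((measurable_norm.comp (measurable_id.sub_const θ)).pow_const 2).comp (S.measurable_iterate n)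

/-- The event that the algorithm is close to its limiting regime at time `n`: the preconditioner is
close to its limit, the residual of the Newton step is at most an eighth of the distance to `θ`,
and this distance is at most `1`. -/
def regular (G : Vec d → ℝ) (θ : Vec d) (K : ℕ → Ω → Vec d →L[ℝ] Vec d) (θs : ℕ → Ω → Vec d)
    (T : Vec d →L[ℝ] Vec d) (κ : ℝ) (n : ℕ) : Set Ω :=
  {ω | ‖K n ω - T‖ ≤ κ} ∩
    ({ω | ‖(θs n ω - θ) - K n ω (∇ G (θs n ω))‖ ≤ 1 / 8 * ‖θs n ω - θ‖} ∩
      {ω | ‖θs n ω - θ‖ ≤ 1})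

theorem measurable_residual (S : PreconditionedDescent P ν ℱ c G θ Φ X K θs D T L C κ) (n : ℕ) :
    Measurable[ℱ n] fun ω => ‖(θs n ω - θ) - K n ω (∇ G (θs n ω))‖ := by
  have h := @measurable_norm_sub_clm_apply d Ω (ℱ n) G θ (K n) (θs n)
    S.continuous_gradient.measurable (S.measurable_precond n) (S.measurable_iterate n)
  exact h

theorem measurable_dist (S : PreconditionedDescent P ν ℱ c G θ Φ X K θs D T L C κ) (n : ℕ) :
    Measurable[ℱ n] fun ω => ‖θs n ω - θ‖ :=
  (measurable_norm.comp (measurable_id.sub_const θ)).comp (S.measurable_iterate n)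

theorem measurableSet_regular (S : PreconditionedDescent P ν ℱ c G θ Φ X K θs D T L C κ) (n : ℕ) :
    MeasurableSet[ℱ n] (regular G θ K θs T κ n) := by
  have h1 : MeasurableSet[ℱ n]
      {ω | ‖(θs n ω - θ) - K n ω (∇ G (θs n ω))‖ ≤ 1 / 8 * ‖θs n ω - θ‖} :=
    measurableSet_le (S.measurable_residual n) ((S.measurable_dist n).const_mul _)
  have h2 : MeasurableSet[ℱ n] {ω | ‖θs n ω - θ‖ ≤ 1} :=
    measurableSet_le (S.measurable_dist n) measurable_const
  exact (S.measurableSet_norm_sub_le n).inter (h1.inter h2)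

variable [IsProbabilityMeasure P] [IsProbabilityMeasure ν]

/-- The preconditioned mean step is asymptotically the exact Newton step, up to an error that is
negligible with respect to the distance to `θ`. -/
theorem ae_residual_isLittleO (S : PreconditionedDescent P ν ℱ c G θ Φ X K θs D T L C κ) :
    ∀ᵐ ω ∂P, (fun n => (θs n ω - θ) - K n ω (∇ G (θs n ω))) =o[atTop] fun n => θs n ω - θ := by
  filter_upwards [S.ae_tendsto_iterate, S.tendsto_precond] with ω hθ hK
  have h1 : (fun n => ∇ G (θs n ω) - D (θs n ω - θ)) =o[atTop] fun n => θs n ω - θ := by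
    have := S.hasFDerivAt.isLittleO.comp_tendsto hθ
    simpa [S.gradient_eq_zero, Function.comp_def] using this
  have hKb : (fun n => K n ω) =O[atTop] fun _ => (1 : ℝ) := hK.isBigO_one ℝ
  have hK0 : (fun n => K n ω - T) =o[atTop] fun _ => (1 : ℝ) := by
    rw [isLittleO_one_iff]
    simpa using hK.sub_const T
  have h2 : (fun n => K n ω (∇ G (θs n ω) - D (θs n ω - θ))) =o[atTop] fun n => θs n ω - θ := by
    have h := hKb.norm_left.mul_isLittleO h1.norm_norm
    refine IsBigO.trans_isLittleO (IsBigO.of_bound 1 (Eventually.of_forall fun n => ?_))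
      (h.trans_isBigO ?_)
    · rw [one_mul, norm_mul, norm_norm, norm_norm]; exact (K n ω).le_opNorm _
    · simpa using (isBigO_refl (fun n => θs n ω - θ) atTop).norm_left
  have h3 : (fun n => (K n ω - T) (D (θs n ω - θ))) =o[atTop] fun n => θs n ω - θ := by
    have hD : (fun n => D (θs n ω - θ)) =O[atTop] fun n => θs n ω - θ :=
      IsBigO.of_bound ‖D‖ (Eventually.of_forall fun n => D.le_opNorm _)
    have h := hK0.norm_left.mul_isBigO hD.norm_norm
    refine IsBigO.trans_isLittleO (IsBigO.of_bound 1 (Eventually.of_forall fun n => ?_))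
      (h.trans_isBigO ?_)
    · rw [one_mul, norm_mul, norm_norm, norm_norm]; exact (K n ω - T).le_opNorm _
    · simpa using (isBigO_refl (fun n => θs n ω - θ) atTop).norm_left
  refine (h2.add h3).neg_left.congr_left fun n => ?_
  simp only [map_sub, sub_apply, S.inverse]
  abel

theorem ae_eventually_regular (S : PreconditionedDescent P ν ℱ c G θ Φ X K θs D T L C κ) :
    ∀ᵐ ω ∂P, ∀ᶠ n in atTop, ω ∈ regular G θ K θs T κ n := by
  filter_upwards [S.eventually_norm_sub_le, S.ae_residual_isLittleO, S.ae_tendsto_iterate]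
    with ω h1 h2 h3
  have h4 := (tendsto_iff_norm_sub_tendsto_zero.1 h3).eventually (gt_mem_nhds one_pos)
  filter_upwards [h1, h2.def (show (0 : ℝ) < 1 / 8 by norm_num), h4] with n a b e
  exact ⟨a, b, le_of_lt e⟩

theorem setLIntegral_weight_step_le (S : PreconditionedDescent P ν ℱ c G θ Φ X K θs D T L C κ)
    {δ : ℝ} (hδ : 0 < δ) {n : ℕ} (hn2 : 2 ≤ n) (hn6 : 6 + 6 * c ≤ n) {A : Set Ω}
    (hA : MeasurableSet[ℱ n] A) (hAB : A ⊆ regular G θ K θs T κ n) :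
    ∫⁻ ω in A, ENNReal.ofReal (weight δ (n + 1) * ‖θs (n + 1) ω - θ‖ ^ 2) ∂P
      + ∫⁻ ω in A, ENNReal.ofReal (1 / (2 * (n : ℝ)) * (weight δ n * ‖θs n ω - θ‖ ^ 2)) ∂P
      ≤ ENNReal.ofReal (1 + 0) * ∫⁻ ω in A, ENNReal.ofReal (weight δ n * ‖θs n ω - θ‖ ^ 2) ∂P
        + ENNReal.ofReal ((‖T‖ + κ) ^ 2 * (C * (1 + L))
          * (1 / ((n : ℝ) * Real.log ((n : ℝ) + 1) ^ (1 + δ)))) * P A := by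
  have hL := S.L_pos
  have hC := S.C_nonneg
  have hM0 : 0 ≤ (‖T‖ + κ) ^ 2 * (C * (1 + L)) := by positivity
  have hn2' : (2 : ℝ) ≤ n := by exact_mod_cast hn2
  have hw := weight_nonneg δ n
  have hw1 := weight_nonneg δ (n + 1)
  have hlog : 0 < Real.log ((n : ℝ) + 1) := Real.log_pos (by linarith)
  have hlogr : 0 < Real.log ((n : ℝ) + 1) ^ (1 + δ) := Real.rpow_pos_of_pos hlog _
  have hfm : Measurable fun y : Vec d => weight δ (n + 1) * ‖y - θ‖ ^ 2 :=
    ((measurable_id.sub_const θ).norm.pow_const 2).const_mul _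
  refine S.setLIntegral_step_le n hA hfm (fun y => mul_nonneg hw1 (sq_nonneg _))
    (p := fun h => (2 * weight δ (n + 1)) • (h - θ)) hw1 (fun h y => le_of_eq ?_)
    (((S.measurable_sq_dist n).const_mul _).const_mul _) ((S.measurable_sq_dist n).const_mul _)
    (fun ω => mul_nonneg (by positivity) (mul_nonneg hw (sq_nonneg _)))
    (fun ω => mul_nonneg hw (sq_nonneg _)) le_rfl
    (mul_nonneg hM0 (by positivity)) fun ω hω => ?_
  · have e : y - θ = (h - θ) + (y - h) := by abel
    rw [e, norm_add_sq_real, inner_smul_left]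
    simp only [conj_trivial]
    ring
  · obtain ⟨hk, hr, hu1⟩ := hAB hω
    refine weight_step_le S.c_nonneg hδ hn2 hn6 hr hM0 ?_
    have hV := S.excess_le (θs n ω)
    have hV0 := S.excess_nonneg (θs n ω)
    have hsq : ‖θs n ω - θ‖ ^ 2 ≤ 1 := pow_le_one₀ (norm_nonneg _) hu1
    have hκ := S.κ_pos
    gcongr
    · exact norm_le_of_norm_sub_le hk
    · nlinarith

/-- The rate of convergence under second moments only: `n ‖θₙ - θ‖² / (log n) ^ (1 + δ)` satisfies a
Robbins–Siegmund inequality whose perturbation `1 / (n (log n) ^ (1 + δ))` is summable and whose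
gain, half of this quantity divided by `n`, forces the limit to vanish. -/
theorem ae_isLittleO_log_rpow_div (S : PreconditionedDescent P ν ℱ c G θ Φ X K θs D T L C κ) {δ : ℝ}
    (hδ : 0 < δ) : ∀ᵐ ω ∂P, (fun n => ‖θs n ω - θ‖ ^ 2) =o[atTop]
      fun n : ℕ => Real.log (n : ℝ) ^ (1 + δ) / (n : ℝ) := by
  have hL := S.L_pos
  have hC := S.C_nonneg
  have hM0 : 0 ≤ (‖T‖ + κ) ^ 2 * (C * (1 + L)) := by positivity
  have hmain : ∀ᵐ ω ∂P,
      (∃ l, Tendsto (fun n => weight δ n * ‖θs n ω - θ‖ ^ 2) atTop (𝓝 l)) ∧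
      Summable (fun n : ℕ => 1 / (2 * (n : ℝ)) * (weight δ n * ‖θs n ω - θ‖ ^ 2)) := by
    obtain ⟨n₀, hn₀⟩ := exists_nat_ge (6 + 6 * c)
    refine robbinsSiegmund (ℱ := ℱ) (B := regular G θ K θs T κ) (α := fun _ => 0)
      (fun n ω => mul_nonneg (weight_nonneg δ n) (sq_nonneg _))
      (fun n ω => mul_nonneg (by positivity) (mul_nonneg (weight_nonneg δ n) (sq_nonneg _)))
      (fun n => (S.measurable_sq_dist n).const_mul _)
      (fun n => ((S.measurable_sq_dist n).const_mul _).const_mul _)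
      (fun _ => le_rfl) summable_zero
      (fun n => mul_nonneg hM0 (one_div_nonneg.2 (mul_nonneg (Nat.cast_nonneg n)
        (Real.rpow_nonneg (Real.log_nonneg (by linarith [(Nat.cast_nonneg n : (0 : ℝ) ≤ n)])) _))))
      ((summable_one_div_mul_log_rpow hδ).mul_left _)
      S.measurableSet_regular S.ae_eventually_regular ?_
    filter_upwards [eventually_ge_atTop (max n₀ 2)] with n hn A hA hAB
    exact S.setLIntegral_weight_step_le hδ ((le_max_right _ _).trans hn)
      (hn₀.trans (by exact_mod_cast (le_max_left _ _).trans hn)) hA hAB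
  filter_upwards [hmain] with ω ⟨⟨l, hl⟩, hs⟩
  -- A positive limit would make the gains comparable to the harmonic series.
  have hl0 : l = 0 := by
    refine le_antisymm (not_lt.1 fun hlpos => ?_) (ge_of_tendsto hl
      (Eventually.of_forall fun n => mul_nonneg (weight_nonneg δ n) (sq_nonneg _)))
    refine Real.not_summable_one_div_natCast ?_
    refine (hs.mul_left (4 / l)).of_norm_bounded_eventually_nat ?_
    filter_upwards [hl.eventually (lt_mem_nhds (half_lt_self hlpos)), eventually_ge_atTop 1]
      with n hn hn1
    have hn1' : (1 : ℝ) ≤ n := by exact_mod_cast hn1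
    rw [Real.norm_of_nonneg (by positivity)]
    calc 1 / (n : ℝ) = 4 / l * (1 / (2 * (n : ℝ)) * (l / 2)) := by field_simp; ring
      _ ≤ _ := by gcongr
  rw [hl0] at hl
  rw [isLittleO_iff_tendsto']
  · refine hl.congr fun n => ?_
    unfold weight
    rw [div_div_eq_mul_div, mul_comm, mul_div_assoc]
  · filter_upwards [eventually_ge_atTop 2] with n hn h0
    have hn' : (2 : ℝ) ≤ n := by exact_mod_cast hn
    have hpos : 0 < Real.log n ^ (1 + δ) / (n : ℝ) :=
      div_pos (Real.rpow_pos_of_pos (Real.log_pos (by linarith)) _) (by linarith)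
    exact absurd h0 hpos.ne'

end PreconditionedDescent
end Rate

/-! ### Exponential moments at the scale `√(log n / n)` -/

section LogScale

/-- The scale `√(log (n + 3) / (n + 3))`; the shift by `3 > e` makes it antitone and at most `1`. -/
def logScale (n : ℕ) : ℝ := Real.sqrt (Real.log ((n : ℝ) + 3) / ((n : ℝ) + 3))

theorem one_lt_log_add_three (n : ℕ) : 1 < Real.log ((n : ℝ) + 3) := by
  rw [Real.lt_log_iff_exp_lt (by positivity)]
  have := Real.exp_one_lt_d9
  have : (0 : ℝ) ≤ n := Nat.cast_nonneg n
  linarith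

theorem logScale_pos (n : ℕ) : 0 < logScale n :=
  Real.sqrt_pos.2 (div_pos (by linarith [one_lt_log_add_three n]) (by positivity))

theorem logScale_sq (n : ℕ) : logScale n ^ 2 = Real.log ((n : ℝ) + 3) / ((n : ℝ) + 3) :=
  Real.sq_sqrt (div_nonneg (by linarith [one_lt_log_add_three n]) (by positivity))

theorem logScale_le_one (n : ℕ) : logScale n ≤ 1 := by
  refine Real.sqrt_le_one.2 ?_
  rw [div_le_one (by positivity)]
  linarith [Real.log_le_sub_one_of_pos (show (0 : ℝ) < (n : ℝ) + 3 by positivity)]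

theorem logScale_antitone : Antitone logScale := by
  intro m n hmn
  have he : ∀ k : ℕ, Real.exp 1 ≤ (k : ℝ) + 3 := fun k => by
    have := Real.exp_one_lt_d9
    have : (0 : ℝ) ≤ k := Nat.cast_nonneg k
    linarith
  have hmn' : (m : ℝ) ≤ n := by exact_mod_cast hmn
  exact Real.sqrt_le_sqrt (Real.log_div_self_antitoneOn (he m) (he n) (by linarith))

theorem one_le_mul_logScale (n : ℕ) : 1 ≤ ((n : ℝ) + 3) * logScale n := by
  have h1 := one_lt_log_add_three n
  have h2 : (1 : ℝ) ≤ (((n : ℝ) + 3) * logScale n) ^ 2 := by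
    rw [mul_pow, logScale_sq]
    have hn : (0 : ℝ) < (n : ℝ) + 3 := by positivity
    have : ((n : ℝ) + 3) ^ 2 * (Real.log ((n : ℝ) + 3) / ((n : ℝ) + 3))
      = ((n : ℝ) + 3) * Real.log ((n : ℝ) + 3) := by field_simp
    rw [this]
    have : (0 : ℝ) ≤ n := Nat.cast_nonneg n
    nlinarith
  have h3 : 0 ≤ ((n : ℝ) + 3) * logScale n := mul_nonneg (by positivity) (logScale_pos n).le
  nlinarith

theorem sum_inv_sqrt_le (n : ℕ) :
    ∑ k ∈ Finset.range n, 1 / Real.sqrt ((k : ℝ) + 3) ≤ 2 * Real.sqrt ((n : ℝ) + 2) := by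
  induction n with
  | zero => simp
  | succ n ih =>
    rw [Finset.sum_range_succ]
    push_cast
    have e : (n : ℝ) + 1 + 2 = (n : ℝ) + 3 := by ring
    rw [e]
    have h3 : 0 < Real.sqrt ((n : ℝ) + 3) := Real.sqrt_pos.2 (by positivity)
    have h2 : 0 ≤ Real.sqrt ((n : ℝ) + 2) := Real.sqrt_nonneg _
    have s3 : Real.sqrt ((n : ℝ) + 3) ^ 2 = (n : ℝ) + 3 := Real.sq_sqrt (by positivity)
    have s2 : Real.sqrt ((n : ℝ) + 2) ^ 2 = (n : ℝ) + 2 := Real.sq_sqrt (by positivity)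
    have : 1 / Real.sqrt ((n : ℝ) + 3)
        ≤ 2 * (Real.sqrt ((n : ℝ) + 3) - Real.sqrt ((n : ℝ) + 2)) := by
      rw [div_le_iff₀ h3]
      nlinarith [sq_nonneg (Real.sqrt ((n : ℝ) + 3) - Real.sqrt ((n : ℝ) + 2))]
    linarith

theorem sum_logScale_le (n : ℕ) :
    ∑ k ∈ Finset.range n, logScale k ≤ 2 * (((n : ℝ) + 3) * logScale n) := by
  have hn : (0 : ℝ) < (n : ℝ) + 3 := by positivity
  have hl := one_lt_log_add_three n
  calc ∑ k ∈ Finset.range n, logScale k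
      ≤ ∑ k ∈ Finset.range n, Real.sqrt (Real.log ((n : ℝ) + 3)) * (1 / Real.sqrt ((k : ℝ) + 3)) := by
        refine Finset.sum_le_sum fun k hk => ?_
        have hkn : (k : ℝ) ≤ n := by exact_mod_cast (Finset.mem_range.1 hk).le
        unfold logScale
        rw [Real.sqrt_div (by linarith [one_lt_log_add_three k]), mul_one_div]
        gcongr
    _ ≤ Real.sqrt (Real.log ((n : ℝ) + 3)) * (2 * Real.sqrt ((n : ℝ) + 3)) := by
        rw [← Finset.mul_sum]
        gcongr
        exact (sum_inv_sqrt_le n).trans (by gcongr; norm_num)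
    _ = 2 * (((n : ℝ) + 3) * logScale n) := by
        unfold logScale
        rw [Real.sqrt_div (by linarith)]
        have h3 : 0 < Real.sqrt ((n : ℝ) + 3) := Real.sqrt_pos.2 hn
        have s3 : Real.sqrt ((n : ℝ) + 3) ^ 2 = (n : ℝ) + 3 := Real.sq_sqrt hn.le
        field_simp
        rw [s3]

theorem summable_logScale_rpow {η : ℝ} (hη : 0 < η) :
    Summable (fun n : ℕ => logScale n ^ (2 + 2 * η)) := by
  have hs : Summable (fun n : ℕ => ((n : ℝ) + 3) ^ (-(1 + η / 2))) := by
    have h := (summable_nat_add_iff 3).2 (Real.summable_nat_rpow.2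
      (show -(1 + η / 2) < -1 by linarith))
    exact h.congr fun n => by push_cast; ring_nf
  refine summable_of_isBigO_nat hs ?_
  have h1 : (fun x : ℝ => Real.log x ^ (1 + η)) =O[atTop] fun x => x ^ (η / 2) :=
    (isLittleO_log_rpow_rpow_atTop (1 + η) (by linarith)).isBigO
  have ht : Tendsto (fun n : ℕ => (n : ℝ) + 3) atTop atTop :=
    tendsto_atTop_add_const_right _ _ tendsto_natCast_atTop_atTop
  have h2 := (h1.comp_tendsto ht).mul
    (isBigO_refl (fun n : ℕ => ((n : ℝ) + 3) ^ (-(1 + η))) atTop)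
  refine h2.congr (fun n => ?_) (fun n => ?_)
  · have hl := one_lt_log_add_three n
    have hn : (0 : ℝ) < (n : ℝ) + 3 := by positivity
    have e : logScale n ^ (2 + 2 * η) = (logScale n ^ 2) ^ (1 + η) := by
      rw [← Real.rpow_natCast, ← Real.rpow_mul (logScale_pos n).le]
      congr 1; push_cast; ring
    rw [e, logScale_sq, Real.div_rpow (by linarith) hn.le, Real.rpow_neg hn.le, div_eq_mul_inv]
    rfl
  · have hn : (0 : ℝ) < (n : ℝ) + 3 := by positivity
    simp only [Function.comp_apply]
    rw [← Real.rpow_add hn]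
    congr 1; ring

/-- A discrete Grönwall argument at the scale `logScale`: a small multiple of the past averages
cannot change the order of magnitude. -/
theorem exists_le_mul_logScale {x e : ℕ → ℝ} {R : ℝ} (hx : ∀ n, 0 ≤ x n)
    (he : ∀ᶠ n in atTop, e n ≤ 1 / 16 * x n)
    (h : ∀ᶠ n : ℕ in atTop,
      (n : ℝ) * x n ≤ R * (((n : ℝ) + 3) * logScale n) + ∑ k ∈ Finset.range n, e k) :
    ∃ Q, ∀ᶠ n in atTop, x n ≤ Q * logScale n := by
  obtain ⟨N, hN⟩ := eventually_atTop.1 (he.and (h.and (eventually_ge_atTop 1)))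
  set E : ℝ := |∑ k ∈ Finset.range N, e k| with hE
  set Q : ℝ := 8 * (|R| + E) with hQ
  have hQ0 : 0 ≤ Q := by positivity
  refine ⟨Q, eventually_atTop.2 ⟨N, ?_⟩⟩
  intro n
  induction n using Nat.strong_induction_on with
  | _ n ih =>
    intro hn
    obtain ⟨-, h1, h2⟩ := hN n hn
    have hn1 : (1 : ℝ) ≤ n := by exact_mod_cast h2
    have hr := one_le_mul_logScale n
    set r := ((n : ℝ) + 3) * logScale n with hr_def
    have hsum : ∑ k ∈ Finset.range n, e k ≤ E + Q / 8 * r := by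
      rw [← Finset.sum_range_add_sum_Ico _ hn]
      refine add_le_add (le_abs_self _) ?_
      calc ∑ k ∈ Finset.Ico N n, e k ≤ ∑ k ∈ Finset.Ico N n, Q / 16 * logScale k := by
            refine Finset.sum_le_sum fun k hk => ?_
            obtain ⟨hk1, hk2⟩ := Finset.mem_Ico.1 hk
            have := (hN k hk1).1
            have := ih k hk2 hk1
            linarith
        _ ≤ ∑ k ∈ Finset.range n, Q / 16 * logScale k := by
            refine Finset.sum_le_sum_of_subset_of_nonneg (fun k hk => ?_) fun k _ _ =>
              mul_nonneg (by positivity) (logScale_pos k).le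
            exact Finset.mem_range.2 (Finset.mem_Ico.1 hk).2
        _ = Q / 16 * ∑ k ∈ Finset.range n, logScale k := by rw [Finset.mul_sum]
        _ ≤ Q / 16 * (2 * r) := by gcongr; exact sum_logScale_le n
        _ = Q / 8 * r := by ring
    have hE0 : 0 ≤ E := abs_nonneg _
    have h3 : (n : ℝ) * x n ≤ |R| * r + E * r + Q / 8 * r := by
      have a1 : R * r ≤ |R| * r := by gcongr; exact le_abs_self R
      have a2 : E ≤ E * r := le_mul_of_one_le_right hE0 hr
      linarith
    have h4 : ((n : ℝ) + 3) * x n ≤ 4 * ((n : ℝ) * x n) := by nlinarith [hx n]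
    have h5 : ((n : ℝ) + 3) * x n ≤ ((n : ℝ) + 3) * (Q * logScale n) := by
      calc ((n : ℝ) + 3) * x n ≤ 4 * (|R| * r + E * r + Q / 8 * r) := h4.trans (by linarith)
        _ = Q * r := by rw [hQ]; ring
        _ = _ := by rw [hr_def]; ring
    exact le_of_mul_le_mul_left h5 (by positivity)

end LogScale

section Exponential
open scoped RealInnerProductSpace

variable {Ω 𝓧 : Type*} {mΩ : MeasurableSpace Ω} [MeasurableSpace 𝓧] {d : ℕ}

/-- An exponential moment bound for one component of centred noise `γ - w`, truncated where
`‖w‖ ≤ τ`. The truncation makes the noise bounded, and shifts its mean by at most a second moment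
divided by `τ`. -/
theorem lintegral_exp_trunc_le {ν : Measure 𝓧} [IsProbabilityMeasure ν] {w : 𝓧 → Vec d}
    {γ v : Vec d} {b q τ l : ℝ} (hint : Integrable w ν) (hmean : ∫ x, w x ∂ν = γ)
    (hsqi : Integrable (fun x => ‖w x‖ ^ 2) ν) (hsq : ∫ x, ‖w x‖ ^ 2 ∂ν ≤ q) (hγ : ‖γ‖ ≤ b)
    (hv : ‖v‖ ≤ 1) (hτ : 0 < τ) (hl : 0 ≤ l) (hlb : l * (b + τ) ≤ 1) :
    ∫⁻ x, ENNReal.ofReal (Real.exp (l * if ‖w x‖ ≤ τ then ⟪v, γ - w x⟫ else 0)) ∂ν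
      ≤ ENNReal.ofReal (Real.exp (l * ((2 * b ^ 2 + 2 * q) / τ) + l ^ 2 * (2 * b ^ 2 + 2 * q))) := by
  have hb : 0 ≤ b := (norm_nonneg _).trans hγ
  set R : 𝓧 → ℝ := fun x => 1 + l * (⟪v, γ - w x⟫ + (2 * b ^ 2 + 2 * ‖w x‖ ^ 2) / τ)
    + l ^ 2 * (2 * b ^ 2 + 2 * ‖w x‖ ^ 2) with hR
  have hpt : ∀ x, Real.exp (l * if ‖w x‖ ≤ τ then ⟪v, γ - w x⟫ else 0) ≤ R x := by
    intro x
    have hin : |⟪v, γ - w x⟫| ≤ b + ‖w x‖ := by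
      calc |⟪v, γ - w x⟫| ≤ ‖v‖ * ‖γ - w x‖ := abs_real_inner_le_norm _ _
        _ ≤ 1 * (‖γ‖ + ‖w x‖) := by gcongr; exact norm_sub_le _ _
        _ ≤ b + ‖w x‖ := by linarith
    have hw0 := norm_nonneg (w x)
    simp only [hR]
    split_ifs with hx
    · set y := ⟪v, γ - w x⟫ with hy
      have h1 : |l * y| ≤ 1 := by
        rw [abs_mul, abs_of_nonneg hl]
        refine le_trans ?_ hlb
        gcongr
        linarith
      have h2 := (abs_le.1 (Real.abs_exp_sub_one_sub_id_le h1)).2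
      have h3 : y ^ 2 ≤ 2 * b ^ 2 + 2 * ‖w x‖ ^ 2 := by
        rw [← sq_abs]
        nlinarith [sq_nonneg (b - ‖w x‖), abs_nonneg y]
      have h4 : 0 ≤ l * ((2 * b ^ 2 + 2 * ‖w x‖ ^ 2) / τ) := by positivity
      have h5 : l ^ 2 * y ^ 2 ≤ l ^ 2 * (2 * b ^ 2 + 2 * ‖w x‖ ^ 2) := by gcongr
      nlinarith
    · rw [mul_zero, Real.exp_zero]
      have hx' : τ ≤ ‖w x‖ := (not_le.1 hx).le
      have h1 : b + ‖w x‖ ≤ (2 * b ^ 2 + 2 * ‖w x‖ ^ 2) / τ := by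
        rw [le_div_iff₀ hτ]
        nlinarith [sq_nonneg (b - ‖w x‖)]
      have h2 := (abs_le.1 hin).1
      have h3 : 0 ≤ l * (⟪v, γ - w x⟫ + (2 * b ^ 2 + 2 * ‖w x‖ ^ 2) / τ) :=
        mul_nonneg hl (by linarith)
      have h4 : 0 ≤ l ^ 2 * (2 * b ^ 2 + 2 * ‖w x‖ ^ 2) := by positivity
      linarith
  have hvi : Integrable (fun x => ⟪v, γ - w x⟫) ν :=
    ((integrable_const γ).sub hint).const_inner v
  have hvz : ∫ x, ⟪v, γ - w x⟫ ∂ν = 0 := by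
    have h := integral_inner (𝕜 := ℝ) (f := fun x => γ - w x)
      ((integrable_const γ).sub hint) v
    rw [h, integral_sub (integrable_const γ) hint, hmean]
    simp
  have hs1 : Integrable (fun x => 2 * b ^ 2 + 2 * ‖w x‖ ^ 2) ν :=
    (integrable_const _).add (hsqi.const_mul 2)
  have hs2 : ∫ x, (2 * b ^ 2 + 2 * ‖w x‖ ^ 2) ∂ν ≤ 2 * b ^ 2 + 2 * q := by
    rw [integral_add (integrable_const _) (hsqi.const_mul 2),
      integral_const_mul 2 fun x => ‖w x‖ ^ 2]
    simp only [integral_const, probReal_univ, one_smul]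
    linarith
  have hRi : Integrable R ν :=
    ((integrable_const _).add ((hvi.add (hs1.div_const τ)).const_mul l)).add (hs1.const_mul _)
  have hRint : ∫ x, R x ∂ν ≤ 1 + (l * ((2 * b ^ 2 + 2 * q) / τ) + l ^ 2 * (2 * b ^ 2 + 2 * q)) := by
    have e : ∫ x, R x ∂ν = 1 + l * ((∫ x, (2 * b ^ 2 + 2 * ‖w x‖ ^ 2) ∂ν) / τ)
        + l ^ 2 * ∫ x, (2 * b ^ 2 + 2 * ‖w x‖ ^ 2) ∂ν := by
      simp only [hR]
      rw [integral_add, integral_add, integral_const_mul, integral_const_mul, integral_add,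
        integral_div, hvz]
      · simp
      · exact hvi
      · exact hs1.div_const τ
      · exact integrable_const _
      · exact (hvi.add (hs1.div_const τ)).const_mul l
      · exact (integrable_const _).add ((hvi.add (hs1.div_const τ)).const_mul l)
      · exact hs1.const_mul _
    rw [e, add_assoc]
    gcongr
  calc _ ≤ ∫⁻ x, ENNReal.ofReal (R x) ∂ν :=
        lintegral_mono fun x => ENNReal.ofReal_le_ofReal (hpt x)
    _ = ENNReal.ofReal (∫ x, R x ∂ν) := (ofReal_integral_eq_lintegral_ofReal hRi
        (Eventually.of_forall fun x => (Real.exp_pos _).le.trans (hpt x))).symm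
    _ ≤ _ := ENNReal.ofReal_le_ofReal (hRint.trans (by
        rw [add_comm]; exact Real.add_one_le_exp _))

/-- A Chernoff bound along a sequence, with Borel–Cantelli: if the exponential moments of `Z n` at
the parameter `s * logScale n` grow at most polynomially, then `Z n` is almost surely at most of
order `√(n log n)`. -/
theorem ae_exists_eventually_le_of_exp_moment {P : Measure Ω} [IsFiniteMeasure P]
    {Z : ℕ → Ω → ℝ} {s A : ℝ} (hs : 0 < s) (hZ : ∀ n, AEMeasurable (Z n) P)
    (h : ∀ n, ∫⁻ ω, ENNReal.ofReal (Real.exp (s * logScale n * Z n ω)) ∂P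
      ≤ ENNReal.ofReal (Real.exp (A * Real.log ((n : ℝ) + 3)))) :
    ∃ R : ℝ, ∀ᵐ ω ∂P, ∀ᶠ n : ℕ in atTop, Z n ω ≤ R * (((n : ℝ) + 3) * logScale n) := by
  set R : ℝ := (A + 2) / s with hR
  refine ⟨R, ?_⟩
  have hbound : ∀ n : ℕ, P {ω | R * (((n : ℝ) + 3) * logScale n) < Z n ω}
      ≤ ENNReal.ofReal (1 / ((n : ℝ) + 3) ^ 2) := by
    intro n
    have hn : (0 : ℝ) < (n : ℝ) + 3 := by positivity
    have hlog : s * logScale n * (R * (((n : ℝ) + 3) * logScale n))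
        = (A + 2) * Real.log ((n : ℝ) + 3) := by
      have : s * logScale n * (R * (((n : ℝ) + 3) * logScale n))
        = (s * R) * ((n : ℝ) + 3) * logScale n ^ 2 := by ring
      rw [this, logScale_sq, hR]; field_simp
    have hsub : {ω | R * (((n : ℝ) + 3) * logScale n) < Z n ω} ⊆
        {ω | ENNReal.ofReal (Real.exp ((A + 2) * Real.log ((n : ℝ) + 3)))
          ≤ ENNReal.ofReal (Real.exp (s * logScale n * Z n ω))} := by
      intro ω hω
      refine ENNReal.ofReal_le_ofReal (Real.exp_le_exp.2 ?_)
      rw [← hlog]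
      exact mul_le_mul_of_nonneg_left (le_of_lt hω) (mul_pos hs (logScale_pos n)).le
    have hpos : 0 < Real.exp ((A + 2) * Real.log ((n : ℝ) + 3)) := Real.exp_pos _
    calc _ ≤ _ := measure_mono hsub
      _ ≤ (∫⁻ ω, ENNReal.ofReal (Real.exp (s * logScale n * Z n ω)) ∂P)
          / ENNReal.ofReal (Real.exp ((A + 2) * Real.log ((n : ℝ) + 3))) :=
          meas_ge_le_lintegral_div (((hZ n).const_mul _).exp.ennreal_ofReal)
            (by simpa using hpos) ENNReal.ofReal_ne_top
      _ ≤ ENNReal.ofReal (Real.exp (A * Real.log ((n : ℝ) + 3)))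
          / ENNReal.ofReal (Real.exp ((A + 2) * Real.log ((n : ℝ) + 3))) := by gcongr; exact h n
      _ = ENNReal.ofReal (1 / ((n : ℝ) + 3) ^ 2) := by
          rw [← ENNReal.ofReal_div_of_pos hpos, ← Real.exp_sub]
          congr 1
          have : A * Real.log ((n : ℝ) + 3) - (A + 2) * Real.log ((n : ℝ) + 3)
            = -(((2 : ℕ) : ℝ) * Real.log ((n : ℝ) + 3)) := by push_cast; ring
          rw [this, ← Real.log_pow, Real.exp_neg, Real.exp_log (by positivity), one_div]
  have hsum : ∑' n : ℕ, P {ω | R * (((n : ℝ) + 3) * logScale n) < Z n ω} ≠ ∞ := by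
    have hs2 : Summable (fun n : ℕ => 1 / ((n : ℝ) + 3) ^ 2) := by
      have := (summable_nat_add_iff 3).2 (Real.summable_one_div_nat_pow.2 one_lt_two)
      simpa using this
    refine ne_top_of_le_ne_top ?_ (ENNReal.tsum_le_tsum hbound)
    rw [← ENNReal.ofReal_tsum_of_nonneg (fun n => by positivity) hs2]
    exact ENNReal.ofReal_ne_top
  filter_upwards [ae_eventually_notMem hsum] with ω hω
  filter_upwards [hω] with n hn
  exact not_lt.1 hn

end Exponential

/-! ### The rate of convergence under higher moments -/

section Noise
open scoped RealInnerProductSpace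

variable {Ω 𝓧 : Type*} {mΩ : MeasurableSpace Ω} [MeasurableSpace 𝓧] {d : ℕ}

/-- The rescaled increment `(n + 1 + c) (θₙ - θₙ₊₁)`, which is the preconditioned stochastic
gradient; in this form it visibly depends on the iterates only. -/
def increment (c : ℝ) (θs : ℕ → Ω → Vec d) (n : ℕ) (ω : Ω) : Vec d :=
  (gain c n)⁻¹ • (θs n ω - θs (n + 1) ω)

/-- The component along `v` of the noise `k ∇G(h) - w`, set to zero unless the preconditioner `k`
is close to `T`, the iterate `h` is close to `θ`, and the preconditioned gradient `w` is at most
`τ`. -/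
def truncNoise (G : Vec d → ℝ) (θ : Vec d) (T : Vec d →L[ℝ] Vec d) (κ : ℝ) (v : Vec d) (τ : ℝ)
    (k : Vec d →L[ℝ] Vec d) (h w : Vec d) : ℝ :=
  if ‖k - T‖ ≤ κ ∧ ‖h - θ‖ ≤ 1 then (if ‖w‖ ≤ τ then ⟪v, k (∇ G h) - w⟫ else 0) else 0

/-- The sum of the truncated noise up to time `n`, the truncation level at time `k` being
`1 / logScale k`. -/
def truncSum (G : Vec d → ℝ) (θ : Vec d) (T : Vec d →L[ℝ] Vec d) (κ : ℝ) (v : Vec d) (c : ℝ)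
    (K : ℕ → Ω → Vec d →L[ℝ] Vec d) (θs : ℕ → Ω → Vec d) (n : ℕ) (ω : Ω) : ℝ :=
  ∑ k ∈ Finset.range n,
    truncNoise G θ T κ v (logScale k)⁻¹ (K k ω) (θs k ω) (increment c θs k ω)

theorem measurable_truncNoise {S : Type*} [MeasurableSpace S] {G : Vec d → ℝ} {θ : Vec d}
    {T : Vec d →L[ℝ] Vec d} {κ : ℝ} {v : Vec d} {τ : ℝ} (hG : Measurable (∇ G))
    {k : S → Vec d →L[ℝ] Vec d} {h w : S → Vec d} (hk : Measurable k) (hh : Measurable h)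
    (hw : Measurable w) : Measurable fun s => truncNoise G θ T κ v τ (k s) (h s) (w s) := by
  have h1 : MeasurableSet {s | ‖k s - T‖ ≤ κ} :=
    measurableSet_le (hk.sub_const T).norm measurable_const
  have h2 : MeasurableSet {s | ‖h s - θ‖ ≤ 1} :=
    measurableSet_le (hh.sub_const θ).norm measurable_const
  have h3 : MeasurableSet {s | ‖w s‖ ≤ τ} := measurableSet_le hw.norm measurable_const
  have h4 : Measurable fun s => k s (∇ G (h s)) := measurable_clm_apply.comp (hk.prodMk (hG.comp hh))
  have h5 : Measurable fun s => ⟪v, k s (∇ G (h s)) - w s⟫ := measurable_const.inner (h4.sub hw)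
  exact Measurable.ite (h1.inter h2) (Measurable.ite h3 h5 measurable_const) measurable_const

namespace PreconditionedDescent

variable {P : Measure Ω} {ν : Measure 𝓧}
  {ℱ : Filtration ℕ mΩ} {c : ℝ} {G : Vec d → ℝ} {θ : Vec d} {Φ : 𝓧 → Vec d → Vec d}
  {X : ℕ → Ω → 𝓧} {K : ℕ → Ω → Vec d →L[ℝ] Vec d} {θs : ℕ → Ω → Vec d}
  {D T : Vec d →L[ℝ] Vec d} {L C κ : ℝ}

theorem measurable_increment (S : PreconditionedDescent P ν ℱ c G θ Φ X K θs D T L C κ) (n : ℕ) :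
    Measurable[ℱ (n + 1)] (increment c θs n) := by
  have h1 : Measurable[ℱ (n + 1)] (θs n) :=
    (S.measurable_iterate n).mono (ℱ.mono (Nat.le_succ n)) le_rfl
  have h2 := h1.sub (S.measurable_iterate (n + 1))
  exact h2.const_smul (gain c n)⁻¹

theorem ae_increment_eq (S : PreconditionedDescent P ν ℱ c G θ Φ X K θs D T L C κ) :
    ∀ᵐ ω ∂P, ∀ n, increment c θs n ω = K n ω (Φ (X (n + 1) ω) (θs n ω)) := by
  filter_upwards [S.step] with ω hω n
  rw [increment, hω n, sub_sub_cancel, inv_smul_smul₀ (gain_pos S.c_nonneg n).ne']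

theorem measurable_truncSum (S : PreconditionedDescent P ν ℱ c G θ Φ X K θs D T L C κ) (v : Vec d)
    (n : ℕ) : Measurable[ℱ n] (truncSum G θ T κ v c K θs n) := by
  refine Finset.measurable_sum _ fun k hk => ?_
  have hkn : k + 1 ≤ n := Finset.mem_range.1 hk
  have h1 := (S.measurable_precond k).mono (ℱ.mono (Nat.le_succ k)) le_rfl
  have h2 := (S.measurable_iterate k).mono (ℱ.mono (Nat.le_succ k)) le_rfl
  have h3 := @measurable_truncNoise d Ω (ℱ (k + 1)) G θ T κ v (logScale k)⁻¹
    S.continuous_gradient.measurable _ _ _ h1 h2 (S.measurable_increment k)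
  exact h3.mono (ℱ.mono hkn) le_rfl

variable [IsProbabilityMeasure ν]

theorem lintegral_exp_truncNoise_le (S : PreconditionedDescent P ν ℱ c G θ Φ X K θs D T L C κ)
    {v : Vec d} (hv : ‖v‖ ≤ 1) (k : Vec d →L[ℝ] Vec d) (h : Vec d) {b q τ l : ℝ}
    (hb : b = (‖T‖ + κ) * L) (hq : q = (‖T‖ + κ) ^ 2 * (C * (1 + L)))
    (hτ : 0 < τ) (hl : 0 ≤ l) (hlb : l * (b + τ) ≤ 1) :
    ∫⁻ x, ENNReal.ofReal (Real.exp (l * truncNoise G θ T κ v τ k h (k (Φ x h)))) ∂ν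
      ≤ ENNReal.ofReal (Real.exp (l * ((2 * b ^ 2 + 2 * q) / τ) + l ^ 2 * (2 * b ^ 2 + 2 * q))) := by
  have hL := S.L_pos
  have hC := S.C_nonneg
  have hκ := S.κ_pos
  have hq0 : 0 ≤ q := by rw [hq]; positivity
  unfold truncNoise
  split_ifs with hgood
  · obtain ⟨hk, hh⟩ := hgood
    have hkm := norm_le_of_norm_sub_le hk
    have hM : 0 ≤ C * (1 + (G h - G θ)) := mul_nonneg hC (by linarith [S.excess_nonneg h])
    obtain ⟨hi, hmean⟩ := S.unbiased h
    have hlin : ∫⁻ x, ENNReal.ofReal (‖k (Φ x h)‖ ^ 2) ∂ν ≤ ENNReal.ofReal q := by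
      calc ∫⁻ x, ENNReal.ofReal (‖k (Φ x h)‖ ^ 2) ∂ν
          ≤ ∫⁻ x, ENNReal.ofReal (‖k‖ ^ 2) * ‖Φ x h‖ₑ ^ 2 ∂ν := by
            refine lintegral_mono fun x => ?_
            rw [← ofReal_norm, ← ENNReal.ofReal_pow (norm_nonneg _),
              ← ENNReal.ofReal_mul (sq_nonneg _), ← mul_pow]
            exact ENNReal.ofReal_le_ofReal (pow_le_pow_left₀ (norm_nonneg _) (k.le_opNorm _) 2)
        _ = ENNReal.ofReal (‖k‖ ^ 2) * ∫⁻ x, ‖Φ x h‖ₑ ^ 2 ∂ν :=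
            lintegral_const_mul'' _ (hi.1.enorm.pow_const 2)
        _ ≤ ENNReal.ofReal (‖k‖ ^ 2) * ENNReal.ofReal (C * (1 + (G h - G θ))) := by
            gcongr; exact S.second_moment h
        _ ≤ ENNReal.ofReal q := by
            rw [← ENNReal.ofReal_mul (sq_nonneg _), hq]
            refine ENNReal.ofReal_le_ofReal ?_
            have h1 := S.excess_le h
            have h2 : ‖h - θ‖ ^ 2 ≤ 1 := pow_le_one₀ (norm_nonneg _) hh
            gcongr
            nlinarith
    have hwi : Integrable (fun x => k (Φ x h)) ν := k.integrable_comp hi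
    have hsqi : Integrable (fun x => ‖k (Φ x h)‖ ^ 2) ν := by
      refine ⟨hwi.1.norm.pow 2, ?_⟩
      rw [hasFiniteIntegral_iff_ofReal (Eventually.of_forall fun x => by positivity)]
      exact hlin.trans_lt ENNReal.ofReal_lt_top
    refine lintegral_exp_trunc_le hwi ?_ hsqi ?_ ?_ hv hτ hl hlb
    · rw [ContinuousLinearMap.integral_comp_comm k hi, hmean]
    · rw [← ENNReal.ofReal_le_ofReal_iff hq0, ofReal_integral_eq_lintegral_ofReal hsqi
        (Eventually.of_forall fun x => by positivity)]
      exact hlin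
    · rw [hb]
      calc ‖k (∇ G h)‖ ≤ ‖k‖ * ‖∇ G h‖ := k.le_opNorm _
        _ ≤ (‖T‖ + κ) * (L * 1) := by
          gcongr
          exact (S.norm_gradient_le h).trans (by gcongr)
        _ = _ := by ring
  · rw [mul_zero, Real.exp_zero, lintegral_const, measure_univ, mul_one]
    refine ENNReal.ofReal_le_ofReal (Real.one_le_exp ?_)
    positivity

variable [IsProbabilityMeasure P]

/-- The truncated noise at time `n` is integrated out conditionally on the past, which multiplies
the exponential moment of the sum by a deterministic factor. -/
theorem lintegral_exp_truncSum_succ_le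
    (S : PreconditionedDescent P ν ℱ c G θ Φ X K θs D T L C κ)
    {v : Vec d} (hv : ‖v‖ ≤ 1) (n : ℕ) {b q l : ℝ}
    (hb : b = (‖T‖ + κ) * L) (hq : q = (‖T‖ + κ) ^ 2 * (C * (1 + L)))
    (hl : 0 ≤ l) (hlb : l * (b + (logScale n)⁻¹) ≤ 1) :
    ∫⁻ ω, ENNReal.ofReal (Real.exp (l * truncSum G θ T κ v c K θs (n + 1) ω)) ∂P
      ≤ ENNReal.ofReal (Real.exp (l * ((2 * b ^ 2 + 2 * q) * logScale n)
          + l ^ 2 * (2 * b ^ 2 + 2 * q)))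
        * ∫⁻ ω, ENNReal.ofReal (Real.exp (l * truncSum G θ T κ v c K θs n ω)) ∂P := by
  set Z := truncSum G θ T κ v c K θs n with hZ
  have hZm : Measurable[ℱ n] Z := S.measurable_truncSum v n
  have hF : Measurable (Function.uncurry fun (x : 𝓧) (z : ℝ × ((Vec d →L[ℝ] Vec d) × Vec d)) =>
      ENNReal.ofReal (Real.exp (l * z.1)) * ENNReal.ofReal (Real.exp
        (l * truncNoise G θ T κ v (logScale n)⁻¹ z.2.1 z.2.2 (z.2.1 (Φ x z.2.2))))) := by
    have m1 : Measurable fun p : 𝓧 × (ℝ × ((Vec d →L[ℝ] Vec d) × Vec d)) => p.2.1 :=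
      measurable_fst.comp measurable_snd
    have m2 : Measurable fun p : 𝓧 × (ℝ × ((Vec d →L[ℝ] Vec d) × Vec d)) => p.2.2.1 :=
      measurable_fst.comp (measurable_snd.comp measurable_snd)
    have m3 : Measurable fun p : 𝓧 × (ℝ × ((Vec d →L[ℝ] Vec d) × Vec d)) => p.2.2.2 :=
      measurable_snd.comp (measurable_snd.comp measurable_snd)
    have m4 : Measurable fun p : 𝓧 × (ℝ × ((Vec d →L[ℝ] Vec d) × Vec d)) => Φ p.1 p.2.2.2 :=
      S.measurable_oracle.comp (measurable_fst.prodMk m3)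
    have m5 : Measurable fun p : 𝓧 × (ℝ × ((Vec d →L[ℝ] Vec d) × Vec d)) =>
        p.2.2.1 (Φ p.1 p.2.2.2) := measurable_clm_apply.comp (m2.prodMk m4)
    have m6 := measurable_truncNoise (θ := θ) (T := T) (κ := κ) (v := v) (τ := (logScale n)⁻¹)
      S.continuous_gradient.measurable m2 m3 m5
    exact ((m1.const_mul l).exp.ennreal_ofReal).mul ((m6.const_mul l).exp.ennreal_ofReal)
  have hfreeze := setLIntegral_comp_eq_of_indep (ℱ.le n) (S.measurable_data n) (S.law n)
    (S.indep n) (hZm.prodMk ((S.measurable_precond n).prodMk (S.measurable_iterate n)))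
    (@MeasurableSet.univ Ω (ℱ n)) hF
  simp only [Measure.restrict_univ] at hfreeze
  have hZm' : Measurable Z := hZm.mono (ℱ.le n) le_rfl
  calc ∫⁻ ω, ENNReal.ofReal (Real.exp (l * truncSum G θ T κ v c K θs (n + 1) ω)) ∂P
      = ∫⁻ ω, ENNReal.ofReal (Real.exp (l * Z ω)) * ENNReal.ofReal (Real.exp
        (l * truncNoise G θ T κ v (logScale n)⁻¹ (K n ω) (θs n ω)
          (K n ω (Φ (X (n + 1) ω) (θs n ω))))) ∂P := by
        refine lintegral_congr_ae ?_
        filter_upwards [S.ae_increment_eq] with ω hω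
        rw [← hω n, ← ENNReal.ofReal_mul (Real.exp_pos _).le, ← Real.exp_add, ← mul_add]
        simp only [hZ, truncSum, Finset.sum_range_succ]
    _ = ∫⁻ ω, ∫⁻ x, ENNReal.ofReal (Real.exp (l * Z ω)) * ENNReal.ofReal (Real.exp
        (l * truncNoise G θ T κ v (logScale n)⁻¹ (K n ω) (θs n ω)
          (K n ω (Φ x (θs n ω))))) ∂ν ∂P := hfreeze
    _ ≤ ∫⁻ ω, ENNReal.ofReal (Real.exp (l * ((2 * b ^ 2 + 2 * q) * logScale n)
          + l ^ 2 * (2 * b ^ 2 + 2 * q))) * ENNReal.ofReal (Real.exp (l * Z ω)) ∂P := by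
        refine lintegral_mono fun ω => ?_
        rw [lintegral_const_mul' _ _ ENNReal.ofReal_ne_top, mul_comm]
        have h1 := S.lintegral_exp_truncNoise_le hv (K n ω) (θs n ω) hb hq
          (inv_pos.2 (logScale_pos n)) hl hlb
        rw [div_inv_eq_mul] at h1
        exact mul_le_mul_left h1 _
    _ = _ := lintegral_const_mul _ (hZm'.const_mul l).exp.ennreal_ofReal

theorem lintegral_exp_truncSum_le (S : PreconditionedDescent P ν ℱ c G θ Φ X K θs D T L C κ)
    {v : Vec d} (hv : ‖v‖ ≤ 1) {b q l : ℝ} {n : ℕ}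
    (hb : b = (‖T‖ + κ) * L) (hq : q = (‖T‖ + κ) ^ 2 * (C * (1 + L)))
    (hl : 0 ≤ l) (hlb : ∀ k < n, l * (b + (logScale k)⁻¹) ≤ 1) :
    ∫⁻ ω, ENNReal.ofReal (Real.exp (l * truncSum G θ T κ v c K θs n ω)) ∂P
      ≤ ENNReal.ofReal (Real.exp (l * ((2 * b ^ 2 + 2 * q) * ∑ k ∈ Finset.range n, logScale k)
          + n * (l ^ 2 * (2 * b ^ 2 + 2 * q)))) := by
  induction n with
  | zero => simp [truncSum]
  | succ n ih =>
    refine (S.lintegral_exp_truncSum_succ_le hv n hb hq hl (hlb n (Nat.lt_succ_self n))).trans ?_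
    refine (mul_le_mul_right (ih fun k hk => hlb k (hk.trans (Nat.lt_succ_self n))) _).trans ?_
    rw [← ENNReal.ofReal_mul (Real.exp_pos _).le, ← Real.exp_add, Finset.sum_range_succ]
    refine ENNReal.ofReal_le_ofReal (Real.exp_le_exp.2 (le_of_eq ?_))
    push_cast; ring

/-- The truncated sums are of order `√(n log n)`. With exponents proportional to `logScale n`, both
the bias and the variance of the truncated noise contribute `O(log n)` to the exponent of their
exponential moments, so that a Chernoff bound makes the deviation probabilities summable. -/
theorem ae_truncSum_le (S : PreconditionedDescent P ν ℱ c G θ Φ X K θs D T L C κ)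
    {v : Vec d} (hv : ‖v‖ ≤ 1) : ∃ R : ℝ, ∀ᵐ ω ∂P, ∀ᶠ n : ℕ in atTop,
      truncSum G θ T κ v c K θs n ω ≤ R * (((n : ℝ) + 3) * logScale n) := by
  have hL := S.L_pos
  have hC := S.C_nonneg
  have hκ := S.κ_pos
  obtain ⟨b, hb⟩ : ∃ b, b = (‖T‖ + κ) * L := ⟨_, rfl⟩
  obtain ⟨q, hq⟩ : ∃ q, q = (‖T‖ + κ) ^ 2 * (C * (1 + L)) := ⟨_, rfl⟩
  have hb0 : 0 ≤ b := by rw [hb]; positivity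
  have hq0 : 0 ≤ q := by rw [hq]; positivity
  set Q := 2 * b ^ 2 + 2 * q with hQ
  have hQ0 : 0 ≤ Q := by positivity
  -- With this `s`, the exponent `s * logScale n` times the truncated noise is at most `1`.
  set s : ℝ := 1 / (b + 1) with hs
  have hs0 : 0 < s := by positivity
  refine ae_exists_eventually_le_of_exp_moment (s := s) (A := 2 * s * Q + s ^ 2 * Q) hs0
    (fun n => ((S.measurable_truncSum v n).mono (ℱ.le n) le_rfl).aemeasurable) fun n => ?_
  have hσ := logScale_pos n
  have hn : (0 : ℝ) < (n : ℝ) + 3 := by positivity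
  refine (S.lintegral_exp_truncSum_le hv hb hq (mul_pos hs0 hσ).le fun k hk => ?_).trans ?_
  · have h1 : logScale n * (logScale k)⁻¹ ≤ 1 := by
      rw [← div_eq_mul_inv, div_le_one (logScale_pos k)]
      exact logScale_antitone hk.le
    have h2 : logScale n * b ≤ b := mul_le_of_le_one_left hb0 (logScale_le_one n)
    calc s * logScale n * (b + (logScale k)⁻¹)
        = s * (logScale n * b + logScale n * (logScale k)⁻¹) := by ring
      _ ≤ s * (b + 1) := by gcongr
      _ = 1 := by rw [hs]; field_simp
  · refine ENNReal.ofReal_le_ofReal (Real.exp_le_exp.2 ?_)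
    have hsq : ((n : ℝ) + 3) * logScale n ^ 2 = Real.log ((n : ℝ) + 3) := by
      rw [logScale_sq]; field_simp
    have h1 : s * logScale n * (Q * ∑ k ∈ Finset.range n, logScale k)
        ≤ 2 * s * Q * Real.log ((n : ℝ) + 3) := by
      calc _ ≤ s * logScale n * (Q * (2 * (((n : ℝ) + 3) * logScale n))) := by
            gcongr; exact sum_logScale_le n
        _ = 2 * s * Q * (((n : ℝ) + 3) * logScale n ^ 2) := by ring
        _ = _ := by rw [hsq]
    have h2 : (n : ℝ) * ((s * logScale n) ^ 2 * Q) ≤ s ^ 2 * Q * Real.log ((n : ℝ) + 3) := by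
      calc _ ≤ ((n : ℝ) + 3) * ((s * logScale n) ^ 2 * Q) := by gcongr; linarith
        _ = s ^ 2 * Q * (((n : ℝ) + 3) * logScale n ^ 2) := by ring
        _ = _ := by rw [hsq]
    linarith

/-- Under a moment condition of order `2 + 2η`, almost surely the truncation is eventually
inactive, by Borel–Cantelli: the level `1 / logScale n` is exceeded with probability at most of
order `(log n / n) ^ (1 + η)`, on events of the past where the moments are bounded. -/
theorem ae_eventually_norm_increment_le
    (S : PreconditionedDescent P ν ℱ c G θ Φ X K θs D T L C κ) {η B : ℝ} (hη : 0 < η) (hB : 0 < B)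
    (hmom : ∀ h, ∫⁻ x, ‖Φ x h‖ₑ ^ (2 + 2 * η) ∂ν
      ≤ ENNReal.ofReal (B * (1 + ‖h - θ‖ ^ (2 + 2 * η)))) :
    ∀ᵐ ω ∂P, ∀ᶠ n in atTop, ‖increment c θs n ω‖ ≤ (logScale n)⁻¹ := by
  have hκ := S.κ_pos
  set m : ℝ := ‖T‖ + κ with hm
  have hm0 : 0 ≤ m := add_nonneg (norm_nonneg _) hκ.le
  have hp0 : 0 < 2 + 2 * η := by linarith
  set Good : ℕ → Set Ω := fun n => {ω | ‖K n ω - T‖ ≤ κ} ∩ {ω | ‖θs n ω - θ‖ ≤ 1} with hGood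
  have hGm : ∀ n, MeasurableSet[ℱ n] (Good n) := fun n =>
    (S.measurableSet_norm_sub_le n).inter (measurableSet_le (S.measurable_dist n) measurable_const)
  set E : ℕ → Set Ω := fun n =>
    {ω | (logScale n)⁻¹ < ‖K n ω (Φ (X (n + 1) ω) (θs n ω))‖} ∩ Good n with hE
  have hprob : ∀ n, P (E n)
      ≤ ENNReal.ofReal (m ^ (2 + 2 * η) * (B * 2)) * ENNReal.ofReal (logScale n ^ (2 + 2 * η)) := by
    intro n
    have hσ := logScale_pos n
    have hFm : Measurable (Function.uncurry fun (x : 𝓧) (z : (Vec d →L[ℝ] Vec d) × Vec d) =>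
        ENNReal.ofReal ((logScale n * ‖z.1 (Φ x z.2)‖) ^ (2 + 2 * η))) := by
      have m2 : Measurable fun p : 𝓧 × ((Vec d →L[ℝ] Vec d) × Vec d) => p.2.1 :=
        measurable_fst.comp measurable_snd
      have m3 : Measurable fun p : 𝓧 × ((Vec d →L[ℝ] Vec d) × Vec d) => p.2.2 :=
        measurable_snd.comp measurable_snd
      have m4 : Measurable fun p : 𝓧 × ((Vec d →L[ℝ] Vec d) × Vec d) => Φ p.1 p.2.2 :=
        S.measurable_oracle.comp (measurable_fst.prodMk m3)
      have m5 : Measurable fun p : 𝓧 × ((Vec d →L[ℝ] Vec d) × Vec d) =>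
        p.2.1 (Φ p.1 p.2.2) := measurable_clm_apply.comp (m2.prodMk m4)
      exact ((m5.norm.const_mul _).pow_const _).ennreal_ofReal
    have hfreeze := setLIntegral_comp_eq_of_indep (ℱ.le n) (S.measurable_data n) (S.law n)
      (S.indep n) ((S.measurable_precond n).prodMk (S.measurable_iterate n)) (hGm n) hFm
    have hGm' : MeasurableSet (Good n) := ℱ.le n _ (hGm n)
    calc P (E n) = ∫⁻ ω in E n, 1 ∂P := by simp
      _ ≤ ∫⁻ ω in E n, ENNReal.ofReal
            ((logScale n * ‖K n ω (Φ (X (n + 1) ω) (θs n ω))‖) ^ (2 + 2 * η)) ∂P := by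
          refine lintegral_mono_ae ?_
          have hEm : MeasurableSet (E n) := by
            have m1 : Measurable fun ω => K n ω (Φ (X (n + 1) ω) (θs n ω)) := by
              have hθm : Measurable (θs n) := (S.measurable_iterate n).mono (ℱ.le n) le_rfl
              have hKm : Measurable (K n) := (S.measurable_precond n).mono (ℱ.le n) le_rfl
              have m0 : Measurable fun ω => Φ (X (n + 1) ω) (θs n ω) :=
                S.measurable_oracle.comp ((S.measurable_data n).prodMk hθm)
              exact measurable_clm_apply.comp (hKm.prodMk m0)
            exact (measurableSet_lt measurable_const m1.norm).inter hGm'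
          filter_upwards [ae_restrict_mem hEm] with ω hω
          have h1 : 1 ≤ logScale n * ‖K n ω (Φ (X (n + 1) ω) (θs n ω))‖ := by
            have := mul_le_mul_of_nonneg_left (le_of_lt hω.1) hσ.le
            rwa [mul_inv_cancel₀ hσ.ne'] at this
          rw [← ENNReal.ofReal_one]
          exact ENNReal.ofReal_le_ofReal (Real.one_le_rpow h1 hp0.le)
      _ ≤ ∫⁻ ω in Good n, ENNReal.ofReal
            ((logScale n * ‖K n ω (Φ (X (n + 1) ω) (θs n ω))‖) ^ (2 + 2 * η)) ∂P :=
          lintegral_mono_set Set.inter_subset_right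
      _ = ∫⁻ ω in Good n, ∫⁻ x, ENNReal.ofReal
            ((logScale n * ‖K n ω (Φ x (θs n ω))‖) ^ (2 + 2 * η)) ∂ν ∂P := hfreeze
      _ ≤ ∫⁻ ω in Good n, ENNReal.ofReal (m ^ (2 + 2 * η) * (B * 2))
            * ENNReal.ofReal (logScale n ^ (2 + 2 * η)) ∂P := by
          refine setLIntegral_mono measurable_const fun ω hω => ?_
          have hkm : ‖K n ω‖ ≤ m := norm_le_of_norm_sub_le hω.1
          have hmσ : 0 ≤ (logScale n * m) ^ (2 + 2 * η) := by positivity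
          calc ∫⁻ x, ENNReal.ofReal ((logScale n * ‖K n ω (Φ x (θs n ω))‖) ^ (2 + 2 * η)) ∂ν
              ≤ ∫⁻ x, ENNReal.ofReal ((logScale n * m) ^ (2 + 2 * η))
                  * ‖Φ x (θs n ω)‖ₑ ^ (2 + 2 * η) ∂ν := by
                refine lintegral_mono fun x => ?_
                rw [← ofReal_norm, ENNReal.ofReal_rpow_of_nonneg (norm_nonneg _) hp0.le,
                  ← ENNReal.ofReal_mul hmσ, ← Real.mul_rpow (by positivity) (norm_nonneg _)]
                refine ENNReal.ofReal_le_ofReal (Real.rpow_le_rpow (by positivity) ?_ hp0.le)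
                rw [mul_assoc]
                gcongr
                exact ((K n ω).le_opNorm _).trans (by gcongr)
            _ = ENNReal.ofReal ((logScale n * m) ^ (2 + 2 * η))
                  * ∫⁻ x, ‖Φ x (θs n ω)‖ₑ ^ (2 + 2 * η) ∂ν :=
                lintegral_const_mul' _ _ ENNReal.ofReal_ne_top
            _ ≤ ENNReal.ofReal ((logScale n * m) ^ (2 + 2 * η)) * ENNReal.ofReal (B * 2) := by
                gcongr
                refine (hmom _).trans (ENNReal.ofReal_le_ofReal ?_)
                have : ‖θs n ω - θ‖ ^ (2 + 2 * η) ≤ 1 :=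
                  Real.rpow_le_one (norm_nonneg _) hω.2 hp0.le
                gcongr; linarith
            _ = _ := by
                rw [← ENNReal.ofReal_mul hmσ, ← ENNReal.ofReal_mul (by positivity),
                  Real.mul_rpow hσ.le hm0]
                congr 1; ring
      _ ≤ _ := by
          rw [setLIntegral_const]
          exact mul_le_of_le_one_right' prob_le_one
  have hsum : ∑' n, P (E n) ≠ ∞ := by
    refine ne_top_of_le_ne_top ?_ (ENNReal.tsum_le_tsum hprob)
    rw [ENNReal.tsum_mul_left, ← ENNReal.ofReal_tsum_of_nonneg
      (fun n => Real.rpow_nonneg (logScale_pos n).le _) (summable_logScale_rpow hη)]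
    exact ENNReal.mul_ne_top ENNReal.ofReal_ne_top ENNReal.ofReal_ne_top
  filter_upwards [ae_eventually_notMem hsum, S.ae_increment_eq, S.eventually_norm_sub_le,
    S.ae_tendsto_iterate] with ω h1 h2 h3 h4
  have h5 := (tendsto_iff_norm_sub_tendsto_zero.1 h4).eventually (gt_mem_nhds one_pos)
  filter_upwards [h1, h3, h5] with n a1 a2 a3
  rw [h2 n]
  by_contra hcon
  exact a1 ⟨not_le.1 hcon, a2, le_of_lt a3⟩

/-- The accumulated noise of the algorithm is of order `√(n log n)` in every direction. -/
theorem ae_noise_inner_le (S : PreconditionedDescent P ν ℱ c G θ Φ X K θs D T L C κ) {η B : ℝ}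
    (hη : 0 < η) (hB : 0 < B) (hmom : ∀ h, ∫⁻ x, ‖Φ x h‖ₑ ^ (2 + 2 * η) ∂ν
      ≤ ENNReal.ofReal (B * (1 + ‖h - θ‖ ^ (2 + 2 * η)))) {v : Vec d} (hv : ‖v‖ ≤ 1) :
    ∀ᵐ ω ∂P, ∃ R : ℝ, ∀ᶠ n : ℕ in atTop,
      ⟪v, ∑ k ∈ Finset.range n, (K k ω (∇ G (θs k ω)) - increment c θs k ω)⟫
        ≤ R * (((n : ℝ) + 3) * logScale n) := by
  obtain ⟨R, hR⟩ := S.ae_truncSum_le hv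
  filter_upwards [hR, S.ae_eventually_norm_increment_le hη hB hmom, S.eventually_norm_sub_le,
    S.ae_tendsto_iterate] with ω h1 h2 h3 h4
  have h5 := (tendsto_iff_norm_sub_tendsto_zero.1 h4).eventually (gt_mem_nhds one_pos)
  obtain ⟨N, hN⟩ := eventually_atTop.1 (h2.and (h3.and h5))
  set y : ℕ → ℝ := fun k => ⟪v, K k ω (∇ G (θs k ω)) - increment c θs k ω⟫ with hy
  -- From time `N` on, the noise and its truncation agree.
  set z : ℕ → ℝ := fun k =>
    truncNoise G θ T κ v (logScale k)⁻¹ (K k ω) (θs k ω) (increment c θs k ω) with hz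
  have hyz : ∀ k, N ≤ k → y k = z k := fun k hk => by
    obtain ⟨a1, a2, a3⟩ := hN k hk
    simp only [hy, hz, truncNoise]
    rw [if_pos ⟨a2, le_of_lt a3⟩, if_pos a1]
  set J : ℝ := |∑ k ∈ Finset.range N, (y k - z k)| with hJ
  refine ⟨R + J, ?_⟩
  filter_upwards [h1, eventually_ge_atTop N] with n hn hNn
  have hdiff : ∑ k ∈ Finset.range n, y k - ∑ k ∈ Finset.range n, z k
      = ∑ k ∈ Finset.range N, (y k - z k) := by
    rw [← Finset.sum_sub_distrib, ← Finset.sum_range_add_sum_Ico _ hNn, add_eq_left]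
    exact Finset.sum_eq_zero fun k hk => by
      rw [hyz k (Finset.mem_Ico.1 hk).1, sub_self]
  have hJ1 : J ≤ J * (((n : ℝ) + 3) * logScale n) :=
    le_mul_of_one_le_right (abs_nonneg _) (one_le_mul_logScale n)
  have hle := le_abs_self (∑ k ∈ Finset.range N, (y k - z k))
  have hn' : ∑ k ∈ Finset.range n, z k ≤ R * (((n : ℝ) + 3) * logScale n) := hn
  rw [inner_sum]
  change ∑ k ∈ Finset.range n, y k ≤ _
  rw [add_mul]
  linarith

theorem ae_norm_noise_le (S : PreconditionedDescent P ν ℱ c G θ Φ X K θs D T L C κ) {η B : ℝ}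
    (hη : 0 < η) (hB : 0 < B) (hmom : ∀ h, ∫⁻ x, ‖Φ x h‖ₑ ^ (2 + 2 * η) ∂ν
      ≤ ENNReal.ofReal (B * (1 + ‖h - θ‖ ^ (2 + 2 * η)))) :
    ∀ᵐ ω ∂P, ∃ R : ℝ, ∀ᶠ n : ℕ in atTop,
      ‖∑ k ∈ Finset.range n, (K k ω (∇ G (θs k ω)) - increment c θs k ω)‖
        ≤ R * (((n : ℝ) + 3) * logScale n) := by
  have hside : ∀ (i : Fin d) (ε : ℝ), |ε| = 1 → ∀ᵐ ω ∂P, ∃ R : ℝ, ∀ᶠ n : ℕ in atTop,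
      ε * (∑ k ∈ Finset.range n, (K k ω (∇ G (θs k ω)) - increment c θs k ω)) i
        ≤ R * (((n : ℝ) + 3) * logScale n) := by
    intro i ε hε
    have hv : ‖(EuclideanSpace.single i ε : Vec d)‖ ≤ 1 := by simp [hε]
    filter_upwards [S.ae_noise_inner_le hη hB hmom hv] with ω hω
    obtain ⟨R, hR⟩ := hω
    refine ⟨R, hR.mono fun n hn => ?_⟩
    rw [EuclideanSpace.inner_single_left] at hn
    simpa using hn
  have h1 := (ae_all_iff (μ := P)).2 fun i => hside i 1 (by simp)
  have h2 := (ae_all_iff (μ := P)).2 fun i => hside i (-1) (by simp)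
  filter_upwards [h1, h2] with ω a1 a2
  choose R1 hR1 using a1
  choose R2 hR2 using a2
  refine ⟨∑ i, (|R1 i| + |R2 i|), ?_⟩
  filter_upwards [eventually_all.2 hR1, eventually_all.2 hR2] with n b1 b2
  set N := ∑ k ∈ Finset.range n, (K k ω (∇ G (θs k ω)) - increment c θs k ω) with hN
  have hr : 0 ≤ ((n : ℝ) + 3) * logScale n := zero_le_one.trans (one_le_mul_logScale n)
  have hcoord : ∀ i, |N i| ≤ (|R1 i| + |R2 i|) * (((n : ℝ) + 3) * logScale n) := by
    intro i
    have c1 := b1 i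
    have c2 := b2 i
    have d1 := mul_le_mul_of_nonneg_right (le_abs_self (R1 i)) hr
    have d2 := mul_le_mul_of_nonneg_right (le_abs_self (R2 i)) hr
    have d3 := mul_nonneg (abs_nonneg (R1 i)) hr
    have d4 := mul_nonneg (abs_nonneg (R2 i)) hr
    rw [add_mul]
    exact abs_le.2 ⟨by linarith, by linarith⟩
  have hnorm : ‖N‖ ≤ ∑ i, |N i| := by
    rw [EuclideanSpace.norm_eq]
    refine Real.sqrt_le_iff.2 ⟨Finset.sum_nonneg fun i _ => abs_nonneg _, ?_⟩
    simp only [Real.norm_eq_abs]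
    exact Finset.sum_sq_le_sq_sum_of_nonneg fun i _ => abs_nonneg _
  calc ‖N‖ ≤ ∑ i, |N i| := hnorm
    _ ≤ ∑ i, (|R1 i| + |R2 i|) * (((n : ℝ) + 3) * logScale n) :=
        Finset.sum_le_sum fun i _ => hcoord i
    _ = _ := by rw [Finset.sum_mul]

/-- Summing the recursion `(n + 1 + c) uₙ₊₁ = (n + c) uₙ + (uₙ - Kₙ ∇G(θₙ)) + (Kₙ ∇G(θₙ) - Yₙ)` for
`uₙ = θₙ - θ`, where `Yₙ` is the rescaled increment. -/
theorem smul_sub_eq_sum (hc : 0 ≤ c) (n : ℕ) (ω : Ω) :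
    ((n : ℝ) + c) • (θs n ω - θ) = c • (θs 0 ω - θ)
      + ∑ k ∈ Finset.range n, ((θs k ω - θ) - K k ω (∇ G (θs k ω)))
      + ∑ k ∈ Finset.range n, (K k ω (∇ G (θs k ω)) - increment c θs k ω) := by
  induction n with
  | zero => simp
  | succ n ih =>
    have hg : (n : ℝ) + 1 + c ≠ 0 := by positivity
    have hstep : ((n : ℝ) + 1 + c) • (θs (n + 1) ω - θ)
        = ((n : ℝ) + c) • (θs n ω - θ) + ((θs n ω - θ) - increment c θs n ω) := by
      have e : increment c θs n ω = ((n : ℝ) + 1 + c) • (θs n ω - θs (n + 1) ω) := by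
        simp [increment, gain]
      rw [e]
      module
    rw [Finset.sum_range_succ, Finset.sum_range_succ]
    push_cast
    rw [hstep, ih]
    abel

/-- The rate of convergence under moments of order larger than two: in the summed recursion the
noise is of order `√(n log n)`, and the residuals, being negligible with respect to `‖θₖ - θ‖`, are
absorbed by the Grönwall argument. -/
theorem ae_isBigO_log_div (S : PreconditionedDescent P ν ℱ c G θ Φ X K θs D T L C κ) {η B : ℝ}
    (hη : 0 < η) (hB : 0 < B) (hmom : ∀ h, ∫⁻ x, ‖Φ x h‖ₑ ^ (2 + 2 * η) ∂ν
      ≤ ENNReal.ofReal (B * (1 + ‖h - θ‖ ^ (2 + 2 * η)))) :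
    ∀ᵐ ω ∂P, (fun n => ‖θs n ω - θ‖ ^ 2) =O[atTop]
      fun n : ℕ => Real.log (n : ℝ) / (n : ℝ) := by
  have hc := S.c_nonneg
  filter_upwards [S.ae_norm_noise_le hη hB hmom, S.ae_residual_isLittleO] with ω ⟨R, hR⟩ hres
  obtain ⟨Q, hQ⟩ := exists_le_mul_logScale (x := fun n => ‖θs n ω - θ‖)
    (e := fun n => ‖(θs n ω - θ) - K n ω (∇ G (θs n ω))‖) (R := R + c * ‖θs 0 ω - θ‖)
    (fun n => norm_nonneg _) (hres.def (by norm_num)) (by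
      filter_upwards [hR] with n hn
      have h1 := congrArg norm (smul_sub_eq_sum (θ := θ) (G := G) (K := K) (θs := θs) hc n ω)
      rw [norm_smul, Real.norm_of_nonneg (by positivity)] at h1
      have h2 : c * ‖θs 0 ω - θ‖ ≤ c * ‖θs 0 ω - θ‖ * (((n : ℝ) + 3) * logScale n) :=
        le_mul_of_one_le_right (by positivity) (one_le_mul_logScale n)
      have h3 : ‖c • (θs 0 ω - θ)‖ = c * ‖θs 0 ω - θ‖ := by
        rw [norm_smul, Real.norm_of_nonneg hc]
      calc (n : ℝ) * ‖θs n ω - θ‖ ≤ ((n : ℝ) + c) * ‖θs n ω - θ‖ := by gcongr; linarith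
        _ ≤ ‖c • (θs 0 ω - θ)‖
            + ‖∑ k ∈ Finset.range n, ((θs k ω - θ) - K k ω (∇ G (θs k ω)))‖
            + ‖∑ k ∈ Finset.range n, (K k ω (∇ G (θs k ω)) - increment c θs k ω)‖ := by
          rw [h1]; exact norm_add₃_le
        _ ≤ c * ‖θs 0 ω - θ‖ * (((n : ℝ) + 3) * logScale n)
            + ∑ k ∈ Finset.range n, ‖(θs k ω - θ) - K k ω (∇ G (θs k ω))‖
            + R * (((n : ℝ) + 3) * logScale n) := by
          gcongr
          · rw [h3]; exact h2
          · exact norm_sum_le _ _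
        _ = _ := by ring)
  refine IsBigO.of_bound (2 * Q ^ 2) ?_
  filter_upwards [hQ, eventually_ge_atTop 3] with n hn hn3
  have hn3' : (3 : ℝ) ≤ n := by exact_mod_cast hn3
  have hlog : 0 < Real.log n := Real.log_pos (by linarith)
  rw [Real.norm_of_nonneg (sq_nonneg _), Real.norm_of_nonneg (by positivity)]
  have h1 : Real.log ((n : ℝ) + 3) ≤ 2 * Real.log n := by
    have : 2 * Real.log (n : ℝ) = Real.log ((n : ℝ) ^ 2) := by rw [Real.log_pow]; norm_num
    rw [this]
    exact Real.log_le_log (by positivity) (by nlinarith)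
  calc ‖θs n ω - θ‖ ^ 2 ≤ (Q * logScale n) ^ 2 := pow_le_pow_left₀ (norm_nonneg _) hn 2
    _ = Q ^ 2 * (Real.log ((n : ℝ) + 3) / ((n : ℝ) + 3)) := by rw [mul_pow, logScale_sq]
    _ ≤ Q ^ 2 * (2 * Real.log n / n) := by gcongr; linarith
    _ = _ := by ring

end PreconditionedDescent
end Noise

/-! ### The stochastic Newton algorithm as a preconditioned descent -/

section Reduction
open scoped RealInnerProductSpace

variable {Ω 𝓧 : Type*} {mΩ : MeasurableSpace Ω} [MeasurableSpace 𝓧] {d : ℕ}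

theorem continuous_toEuclideanCLM :
    Continuous (fun A : Matrix (Fin d) (Fin d) ℝ => Matrix.toEuclideanCLM (n := Fin d) (𝕜 := ℝ) A) :=
  LinearMap.continuous_of_finiteDimensional
    (Matrix.toEuclideanCLM (n := Fin d) (𝕜 := ℝ)).toAlgEquiv.toLinearMap

theorem measurable_toEuclideanCLM_inv {S : Type*} [MeasurableSpace S]
    {A : S → Matrix (Fin d) (Fin d) ℝ} (hA : ∀ i j, Measurable fun s => A s i j) :
    Measurable fun s => Matrix.toEuclideanCLM (n := Fin d) (𝕜 := ℝ) (A s)⁻¹ := by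
  have h1 : Measurable fun s => (fun i j => A s i j : Fin d → Fin d → ℝ) :=
    measurable_pi_lambda _ fun i => measurable_pi_lambda _ fun j => hA i j
  have hof : Continuous fun B : Fin d → Fin d → ℝ => (Matrix.of B : Matrix (Fin d) (Fin d) ℝ) :=
    continuous_id
  have h2 : Measurable fun B : Fin d → Fin d → ℝ => (Matrix.of B).det⁻¹ •
      Matrix.toEuclideanCLM (n := Fin d) (𝕜 := ℝ) (Matrix.of B).adjugate :=
    hof.matrix_det.measurable.inv.smul
      (continuous_toEuclideanCLM.comp hof.matrix_adjugate).measurable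
  have h3 : (fun s => Matrix.toEuclideanCLM (n := Fin d) (𝕜 := ℝ) (A s)⁻¹) = fun s =>
      (A s).det⁻¹ • Matrix.toEuclideanCLM (n := Fin d) (𝕜 := ℝ) (A s).adjugate := by
    funext s
    rw [Matrix.inv_def, Ring.inverse_eq_inv', map_smul]
  rw [h3]
  exact h2.comp h1

theorem tendsto_toEuclideanCLM_inv {A : ℕ → Matrix (Fin d) (Fin d) ℝ}
    {H : Matrix (Fin d) (Fin d) ℝ} (hH : H.PosDef) (hA : Tendsto A atTop (𝓝 H)) :
    Tendsto (fun n => Matrix.toEuclideanCLM (n := Fin d) (𝕜 := ℝ) (A n)⁻¹) atTop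
      (𝓝 (Matrix.toEuclideanCLM (n := Fin d) (𝕜 := ℝ) H⁻¹)) := by
  have hinv : ContinuousAt Inv.inv H := by
    refine continuousAt_matrix_inv H ?_
    rw [Ring.inverse_eq_inv']
    exact continuousAt_inv₀ hH.det_pos.ne'
  exact (continuous_toEuclideanCLM.tendsto _).comp (hinv.tendsto.comp hA)

/-- The stochastic Newton algorithm is a preconditioned stochastic descent whose preconditioner
converges to the inverse of the Hessian at `θ`. -/
theorem exists_preconditionedDescent {P : Measure Ω} [IsProbabilityMeasure P] {ν : Measure 𝓧}
    [IsProbabilityMeasure ν] {g : 𝓧 → Vec d → ℝ} {θ : Vec d} {ℱ : Filtration ℕ mΩ} {c : ℝ}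
    (hc : 0 ≤ c) {X : ℕ → Ω → 𝓧} {Hbar : ℕ → Ω → Matrix (Fin d) (Fin d) ℝ} {θs : ℕ → Ω → Vec d}
    (hframe : Framework ν g) (hX : IsSample P ν X) (hSNA : IsStochasticNewton P ℱ g c X Hbar θs)
    (hA1 : FirstOrder ν g θ) (hA2 : SecondOrder (risk ν g) θ)
    (hH2a : HessianConsistent P Hbar (hessian (risk ν g) θ)) :
    ∃ (Φ : 𝓧 → Vec d → Vec d) (K : ℕ → Ω → Vec d →L[ℝ] Vec d) (D T : Vec d →L[ℝ] Vec d)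
      (L C κ : ℝ), (∀ᵐ x ∂ν, ∀ h, Φ x h = ∇ (g x) h) ∧
        PreconditionedDescent P ν ℱ c (risk ν g) θ Φ X K θs D T L C κ := by
  obtain ⟨Φ, hΦm, hΦ⟩ := exists_measurable_gradient hframe.measurable_loss hA1.differentiable_loss
  obtain ⟨L, hL, hhess⟩ := hA2.hessian_bounded
  obtain ⟨C, C', hC, hC', hsq⟩ := hA1.second_moment
  set H := hessian (risk ν g) θ with hH
  have hpos : H.PosDef := hA2.hessian_pos
  obtain ⟨κ₁, hκ₁, hc₁⟩ := exists_coercive_of_posDef hpos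
  obtain ⟨κ₂, hκ₂, hc₂⟩ := exists_coercive_of_posDef hpos.inv
  have hd : Differentiable ℝ (risk ν g) := hA2.contDiff.differentiable (by norm_num)
  refine ⟨Φ, fun n ω => Matrix.toEuclideanCLM (n := Fin d) (𝕜 := ℝ) (Hbar n ω)⁻¹,
    Matrix.toEuclideanCLM (n := Fin d) (𝕜 := ℝ) H, Matrix.toEuclideanCLM (n := Fin d) (𝕜 := ℝ) H⁻¹,
    L, max C C', min κ₁ κ₂, hΦ.mono fun x hx => hx.2, ?_⟩
  have hstep : ∀ᵐ ω ∂P, ∀ n, ∀ h, Φ (X (n + 1) ω) h = ∇ (g (X (n + 1) ω)) h := by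
    refine ae_all_iff.2 fun n => ?_
    have := hX.law n ▸ hΦ
    exact (ae_of_ae_map (hX.measurable n).aemeasurable this).mono fun ω hω => hω.2
  refine
    { c_nonneg := hc
      L_pos := hL
      C_nonneg := hC.trans (le_max_left _ _)
      κ_pos := lt_min hκ₁ hκ₂
      convex := hframe.convex_risk
      differentiable := hd
      lipschitz := norm_gradient_sub_le hA2.contDiff hhess
      gradient_eq_zero := hA1.gradient_eq_zero
      hasFDerivAt := ?_
      coercive_D := fun v => le_trans ?_ (hc₁ v)
      coercive_T := fun v => le_trans ?_ (hc₂ v)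
      inverse := fun v => ?_
      measurable_oracle := hΦm
      unbiased := fun h => integral_gradient_eq hframe hA1 hA2.contDiff hΦm hΦ h
      second_moment := fun h => ?_
      measurable_data := hX.measurable
      law := hX.law
      indep := hSNA.indep
      measurable_iterate := hSNA.measurable_iterate
      measurable_precond := fun n => ?_
      step := hstep.mono fun ω hω n => ?_
      tendsto_precond := hH2a.mono fun ω hω => tendsto_toEuclideanCLM_inv hpos hω }
  · rw [hH, toEuclideanCLM_hessian]
    exact (differentiable_gradient hA2.contDiff θ).hasFDerivAt
  · gcongr; exact min_le_left _ _
  · gcongr; exact min_le_right _ _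
  · rw [← mul_apply_eq_comp, ← map_mul,
      Matrix.nonsing_inv_mul _ ((Matrix.isUnit_iff_isUnit_det _).1 hpos.isUnit), map_one]
    rfl
  · have h0 : 0 ≤ risk ν g h - risk ν g θ := sub_nonneg.2
      (isMinimum_of_gradient_eq_zero hframe.convex_risk hd hA1.gradient_eq_zero h)
    calc ∫⁻ x, ‖Φ x h‖ₑ ^ 2 ∂ν = ∫⁻ x, ‖∇ (g x) h‖ₑ ^ 2 ∂ν :=
          lintegral_congr_ae (hΦ.mono fun x hx => by simp only [hx.2])
      _ ≤ _ := hsq h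
      _ ≤ _ := by
        refine ENNReal.ofReal_le_ofReal ?_
        rw [mul_add, mul_one]
        gcongr
        · exact le_max_left _ _
        · exact le_max_right _ _
  · exact @measurable_toEuclideanCLM_inv d Ω (ℱ n) (Hbar n) (hSNA.measurable_hessian n)
  · rw [hSNA.step n ω, hω n]; rfl

end Reduction

end StochNewton

end

theorem mainTheorem9 {Ω 𝓧 : Type*} [mΩ : MeasurableSpace Ω] [MeasurableSpace 𝓧] {d : ℕ}
    (P : Measure Ω) [IsProbabilityMeasure P] (ν : Measure 𝓧) [IsProbabilityMeasure ν]
    (g : 𝓧 → StochNewton.Vec d → ℝ) (θ : StochNewton.Vec d)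
    (ℱ : Filtration ℕ mΩ) (c : ℝ) (hc : 0 ≤ c) (X : ℕ → Ω → 𝓧)
    (Hbar : ℕ → Ω → Matrix (Fin d) (Fin d) ℝ) (θs : ℕ → Ω → StochNewton.Vec d)
    (hframe : StochNewton.Framework ν g)
    (hX : StochNewton.IsSample P ν X)
    (hSNA : StochNewton.IsStochasticNewton P ℱ g c X Hbar θs)
    (hA1 : StochNewton.FirstOrder ν g θ)
    (hA2 : StochNewton.SecondOrder (StochNewton.risk ν g) θ)
    (hH1 : StochNewton.EigenvalueControl P Hbar)
    (hH2a : StochNewton.HessianConsistent P Hbar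
      (StochNewton.hessian (StochNewton.risk ν g) θ)) :
    (∀ δ : ℝ, 0 < δ → ∀ᵐ ω ∂P,
      (fun n => ‖θs n ω - θ‖ ^ 2) =o[atTop]
        fun n : ℕ => Real.log (n : ℝ) ^ (1 + δ) / (n : ℝ)) ∧
    (StochNewton.MomentCondition ν g θ → ∀ᵐ ω ∂P,
      (fun n => ‖θs n ω - θ‖ ^ 2) =O[atTop]
        fun n : ℕ => Real.log (n : ℝ) / (n : ℝ)) := by
  obtain ⟨Φ, K, D, T, L, C, κ, hΦ, S⟩ :=
    StochNewton.exists_preconditionedDescent hc hframe hX hSNA hA1 hA2 hH2a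
  refine ⟨fun δ hδ => S.ae_isLittleO_log_rpow_div hδ, fun ⟨η, B, hη, hB, hmom⟩ => ?_⟩
  refine S.ae_isBigO_log_div hη hB fun h => le_trans (le_of_eq ?_) (hmom h)
  exact lintegral_congr_ae (hΦ.mono fun x hx => by simp only [hx])
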